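/- **Setting.** Let $P$ be a probability law on a measurable space $\mathcal X$, let $\Theta\subset\mathbb R^d$ be compact and convex with $\|\theta\|\le R\sqrt d$ on $\Theta$, and let $\rho:\mathcal X\times\mathbb R^d\to\mathbb R$ be measurable in $x$ and twice continuously differentiable in $\theta$; for $\theta\in\Theta$ let $\rho(X,\theta)$ and $\nabla\rho(X,\theta)$ be integrable, $X\sim P$. Assume, for constants $\tau_1,\tau_2,W,C_1,C_2>0$: * $\mathbb E\,\nabla^2\rho(X,\theta)\succeq\tau_1 I_d$ for all $\theta\in\mathbb R^d$; * for all $\theta\in\Theta$, unit vectors $v$ and $t\ge 0$: $\mathbb P\big(v^\top(\nabla\rho(X,\theta)-\mathbb E\nabla\rho(X,\theta))\ge t\big)\le e^{-t^2/C_1^2}$ and $\mathbb P\big(v^\top(\nabla^2\rho(X,\theta)-\mathbb E\nabla^2\rho(X,\theta))v\ge t\big)\le e^{-t^2/C_2^2}$; * $\|\nabla^2\rho(x,\theta)-\nabla^2\rho(x,\theta')\|\le W\|\theta-\theta'\|$ and $\|\nabla^2\rho(x,\theta)\|\le\tau_2$ for all $x\in\mathcal X$, $\theta,\theta'\in\mathbb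 R^d$ (operator norms). Let $\theta_0$ be the unique minimizer of $\mathbb E\rho(X,\theta)$ over $\Theta$, lying in the interior of $\Theta$, let $\Sigma=\operatorname{Var}(\nabla\rho(X,\theta_0))$, and assume $\operatorname{tr}\Sigma\ge s>0$. **Algorithm (FedHybrid).** Client $i\in\{1,\dots,m\}$, $m\ge1$, holds $n_i$ observations $x^{(i)}_1,\dots,x^{(i)}_{n_i}$; all observations are i.i.d. with law $P$; $N=\sum_i n_i$. Let $\mu,C_B>0$, $B=C_B\sqrt{d\vee\log N}$, and let the step sizes satisfy $\eta_1,\eta_2\in[\frac1{2\tau_2},\frac9{10\tau_2}]$. All vectors $Z_{it},Z'_{ik}$ below are $\mathcal N(0,I_d)$, independent of each other and of the data. Stage 1: $\theta_i^{(0)}=0$ and, for $0\le t<K_{1i}$, $$\theta_i^{(t+1)}=\theta_i^{(t)}-\frac{\eta_1}{n_i}\sum_{j=1}^{n_i}\nabla\rho(x^{(i)}_j,\theta_i^{(t)})+\frac{2B\eta_1\sqrt{2K_{1i}}}{\mu n_i}Z_{it};\qquad \bar\theta=\sum_{i=1}^m\frac{n_i}{N}\theta_i^{(K_{1i})}.$$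 Stage 2: $\theta^{(0)}=\bar\theta$ and, for $0\le k<K_2$, $$\theta^{(k+1)}=\theta^{(k)}-\eta_2\sum_{i=1}^m w_i\Big(\frac1{n_i}\sum_{j=1}^{n_i}\nabla\rho(x^{(i)}_j,\theta^{(k)})+\frac{2B\sqrt{2K_2}}{\mu n_i}Z'_{ik}\Big);\qquad \hat\theta_{\rm AG2}=\theta^{(K_2)}.$$ Put $\ell=\log\frac{3\tau_2}{3\tau_2-\tau_1}$ and $v_i=\dfrac{\operatorname{tr}\Sigma}{n_i}+\dfrac{2C_B^2d(d\vee\log N)\log m}{\mu^2n_i^2\,\ell}$. The weights are $w_i=v_i^{-1}/\sum_jv_j^{-1}$. **Theorem 3.4 (Error bound for FedHybrid).** There is a constant $A>0$ depending only on $\tau_1,\tau_2,W,C_1,C_2,R,s$ (not on $d,m,n_i,K_{1i},\mu,C_B,\eta_1,\eta_2$, nor otherwise on $P$, $\rho$ and $\Theta$) such that the following holds. If $K_{1i}\ge 4\log(n_i)/\ell$ for all $i$, $K_2=\lceil 2\log(m)/\ell\rceil$, and the sample sizes are large enough in the sense that, for all $i$, $$n_i\ \ge\ A\big(d(1+\log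 d)+K_{1i}\big)\qquad\text{and}\qquad n_i\min(m^3,n_i)\ \ge\ A\,\frac{C_B^2\,d\,(d\vee\log N)\,K_{1i}}{\mu^2},$$ then $\|\hat\theta_{\rm AG2}-\theta_0\|^2$ is integrable and $$\mathbb E\big\|\hat\theta_{\rm AG2}-\theta_0\big\|^2\ \le\ \frac{17}{\tau_1^2}\left(\sum_{i=1}^m\left(\frac{\operatorname{tr}\Sigma}{n_i}+\frac{2C_B^2d(d\vee\log N)\log m}{\mu^2n_i^2\log(3\tau_2/(3\tau_2-\tau_1))}\right)^{-1}\right)^{-1}.$$ -/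

import Mathlib

open MeasureTheory ProbabilityTheory

universe u

noncomputable section

namespace FedHybrid

/-- The ambient Euclidean space of parameters. -/
abbrev Vec (d : ℕ) : Type := EuclideanSpace ℝ (Fin d)

section Loss

variable {d : ℕ} {𝒳 : Type u}

/-- The gradient of the loss `ρ(x, ·)` at `θ`. -/
def grad (ρ : 𝒳 → Vec d → ℝ) (x : 𝒳) (θ : Vec d) : Vec d :=
  gradient (ρ x) θ

/-- The Hessian of the loss `ρ(x, ·)` at `θ`, as a linear operator (with its operator norm). -/
def hess (ρ : 𝒳 → Vec d → ℝ) (x : 𝒳) (θ : Vec d) : Vec d →L[ℝ] Vec d :=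
  fderiv ℝ (grad ρ x) θ

variable [MeasurableSpace 𝒳]

/-- The expected loss `E ρ(X, θ)`, for `X` with law `P`. -/
def popLoss (P : Measure 𝒳) (ρ : 𝒳 → Vec d → ℝ) (θ : Vec d) : ℝ :=
  ∫ x, ρ x θ ∂P

/-- The expected gradient `E ∇ρ(X, θ)`. -/
def popGrad (P : Measure 𝒳) (ρ : 𝒳 → Vec d → ℝ) (θ : Vec d) : Vec d :=
  ∫ x, grad ρ x θ ∂P

/-- The expected Hessian `E ∇²ρ(X, θ)`. -/
def popHess (P : Measure 𝒳) (ρ : 𝒳 → Vec d → ℝ) (θ : Vec d) : Vec d →L[ℝ] Vec d :=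
  ∫ x, hess ρ x θ ∂P

/-- The covariance matrix `Var(∇ρ(X, θ))`. -/
def gradCov (P : Measure 𝒳) (ρ : 𝒳 → Vec d → ℝ) (θ : Vec d) : Matrix (Fin d) (Fin d) ℝ :=
  Matrix.of fun a b => covariance (fun x => grad ρ x θ a) (fun x => grad ρ x θ b) P

/-- `θ₀` is the unique minimizer of the expected loss over `Θ`; it lies in the interior. -/
structure IsTarget (P : Measure 𝒳) (ρ : 𝒳 → Vec d → ℝ) (Θ : Set (Vec d)) (θ₀ : Vec d) :
    Prop where
  mem_interior : θ₀ ∈ interior Θ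
  unique_min : ∀ θ ∈ Θ, θ ≠ θ₀ → popLoss P ρ θ₀ < popLoss P ρ θ

/-- The regularity assumptions on the loss `ρ`, the data law `P` and the parameter space `Θ`.
Because gradient descent is not projected on `Θ`, convexity and smoothness are required at all
points of the space; the tail bounds are only required on `Θ`. -/
structure Assumptions (P : Measure 𝒳) (ρ : 𝒳 → Vec d → ℝ) (Θ : Set (Vec d))
    (τ₁ τ₂ W C₁ C₂ : ℝ) : Prop where
  measurable_loss : ∀ θ, Measurable fun x => ρ x θ
  contDiff_loss : ∀ x, ContDiff ℝ 2 (ρ x)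
  integrable_loss : ∀ θ ∈ Θ, Integrable (fun x => ρ x θ) P
  integrable_grad : ∀ θ ∈ Θ, Integrable (fun x => grad ρ x θ) P
  -- the parameter space
  compact : IsCompact Θ
  convex : Convex ℝ Θ
  -- strong convexity of the expected loss
  strong_convex : ∀ θ v : Vec d, τ₁ * ‖v‖ ^ 2 ≤ inner ℝ v (popHess P ρ θ v)
  -- sub-Gaussian gradients and Hessians
  subGaussian_grad : ∀ θ ∈ Θ, ∀ v : Vec d, ‖v‖ = 1 → ∀ t : ℝ, 0 ≤ t →
    P.real {x | t ≤ inner ℝ v (grad ρ x θ - popGrad P ρ θ)} ≤ Real.exp (-t ^ 2 / C₁ ^ 2)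
  subGaussian_hess : ∀ θ ∈ Θ, ∀ v : Vec d, ‖v‖ = 1 → ∀ t : ℝ, 0 ≤ t →
    P.real {x | t ≤ inner ℝ v ((hess ρ x θ - popHess P ρ θ) v)} ≤ Real.exp (-t ^ 2 / C₂ ^ 2)
  -- smoothness
  hess_lipschitz : ∀ x, ∀ θ θ' : Vec d, ‖hess ρ x θ - hess ρ x θ'‖ ≤ W * ‖θ - θ'‖
  hess_bound : ∀ x, ∀ θ : Vec d, ‖hess ρ x θ‖ ≤ τ₂

end Loss

section Algorithm

variable {d m : ℕ} {𝒳 : Type u}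

/-- The average gradient `(1/k) ∑ⱼ ∇ρ(xⱼ, θ)` of a data set of size `k`. -/
def avgGrad (ρ : 𝒳 → Vec d → ℝ) {k : ℕ} (x : Fin k → 𝒳) (θ : Vec d) : Vec d :=
  (k : ℝ)⁻¹ • ∑ j, grad ρ (x j) θ

/-- Noisy gradient descent of one client, started at `0`, with step size `η`, noise scale `a` and
noise vectors `z 0, z 1, …`. -/
def localGD (ρ : 𝒳 → Vec d → ℝ) {k : ℕ} (x : Fin k → 𝒳) (η a : ℝ) (z : ℕ → Vec d) :
    ℕ → Vec d
  | 0 => 0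
  | t + 1 => localGD ρ x η a z t - η • avgGrad ρ x (localGD ρ x η a z t) + a • z t

/-- Server gradient descent: at each step client `i` sends its average gradient perturbed by
`σ i` times a noise vector, and the server moves along the `w`-weighted sum of what it receives. -/
def fedSGD (ρ : 𝒳 → Vec d → ℝ) {n : Fin m → ℕ} (x : ∀ i, Fin (n i) → 𝒳) (η : ℝ)
    (w σ : Fin m → ℝ) (z : Fin m → ℕ → Vec d) (init : Vec d) : ℕ → Vec d
  | 0 => init
  | k + 1 => fedSGD ρ x η w σ z init k -
      η • ∑ i, w i • (avgGrad ρ (x i) (fedSGD ρ x η w σ z init k) + σ i • z i k)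

/-- The total sample size. -/
def totalSize (n : Fin m → ℕ) : ℕ := ∑ i, n i

/-- The first stage: each client runs `K₁ i` steps of private gradient descent, and the server
averages the results with weights `n i / N`. -/
def stageOne (ρ : 𝒳 → Vec d → ℝ) {n : Fin m → ℕ} (x : ∀ i, Fin (n i) → 𝒳) (η₁ μ B : ℝ)
    (K₁ : Fin m → ℕ) (z : Fin m → ℕ → Vec d) : Vec d :=
  ∑ i, ((n i : ℝ) / (totalSize n : ℝ)) •
    localGD ρ (x i) η₁ (2 * B * η₁ * √(2 * (K₁ i : ℝ)) / (μ * (n i : ℝ))) (z i) (K₁ i)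

/-- The output of the hybrid algorithm: `K₂` steps of private server gradient descent with weights
`w`, initialized at the output of the first stage. -/
def fedHybrid (ρ : 𝒳 → Vec d → ℝ) {n : Fin m → ℕ} (η₁ η₂ μ B : ℝ) (K₁ : Fin m → ℕ) (K₂ : ℕ)
    (w : Fin m → ℝ) (x : ∀ i, Fin (n i) → 𝒳) (z₁ z₂ : Fin m → ℕ → Vec d) : Vec d :=
  fedSGD ρ x η₂ w (fun i => 2 * B * √(2 * (K₂ : ℝ)) / (μ * (n i : ℝ))) z₂
    (stageOne ρ x η₁ μ B K₁ z₁) K₂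

/-- The data sets of all clients, the noise vectors of the first stage (client, iteration) and
the noise vectors of the second stage (client, iteration). -/
abbrev Sample (𝒳 : Type u) (d : ℕ) {m : ℕ} (n : Fin m → ℕ) : Type u :=
  (∀ i, Fin (n i) → 𝒳) × (Fin m → ℕ → Vec d) × (Fin m → ℕ → Vec d)

/-- The law of the sample: all data points are i.i.d. with law `P`, all noise vectors are i.i.d.
standard Gaussian, and data and noise are independent. -/
def sampleLaw [MeasurableSpace 𝒳] (P : Measure 𝒳) [IsProbabilityMeasure P] (d : ℕ)
    (n : Fin m → ℕ) : Measure (Sample 𝒳 d n) :=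
  (Measure.pi fun i => Measure.pi fun _ : Fin (n i) => P).prod
    ((Measure.pi fun _ : Fin m => Measure.infinitePi fun _ : ℕ => stdGaussian (Vec d)).prod
      (Measure.pi fun _ : Fin m => Measure.infinitePi fun _ : ℕ => stdGaussian (Vec d)))

/-- The quantity `d ∨ log N`. -/
def dimLog (d : ℕ) (n : Fin m → ℕ) : ℝ :=
  max (d : ℝ) (Real.log (totalSize n : ℝ))

/-- The logarithm `log (3τ₂ / (3τ₂ - τ₁))` that governs the iteration counts. -/
def rateLog (τ₁ τ₂ : ℝ) : ℝ := Real.log (3 * τ₂ / (3 * τ₂ - τ₁))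

/-- The error contribution of client `i`, where `v` stands for `tr Σ`:
`tr Σ / n_i + 2 C_B² d (d ∨ log N) log m / (μ² n_i² log (3τ₂ / (3τ₂ - τ₁)))`. -/
def clientErr (d : ℕ) (n : Fin m → ℕ) (v CB μ τ₁ τ₂ : ℝ) (i : Fin m) : ℝ :=
  v / (n i : ℝ) +
    2 * CB ^ 2 * (d : ℝ) * dimLog d n * Real.log (m : ℝ) /
      (μ ^ 2 * (n i : ℝ) ^ 2 * rateLog τ₁ τ₂)

/-- The weights of the server, proportional to the inverse error contributions and summing
to one. -/
def serverWeight (d : ℕ) (n : Fin m → ℕ) (v CB μ τ₁ τ₂ : ℝ) (i : Fin m) : ℝ :=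
  (clientErr d n v CB μ τ₁ τ₂ i)⁻¹ / ∑ j, (clientErr d n v CB μ τ₁ τ₂ j)⁻¹

end Algorithm

end FedHybrid

end

/-! Where an averaged Hessian is at least τ = (19/20)τ₁, the map θ ↦ θ - ηg(θ) has symmetric
derivative I - ηH with form between 0 and 1 - ητ, hence contracts towards θ₀ up to the perturbation
ηg(θ₀) and the injected noise. Summing the geometric series leaves (‖g(θ₀)‖ + noise)/τ in L² plus a
contracted initial error (`RegularField.norm_iterate_sub_le`). The same deterministic lemma serves
clients and server, because the server descends along a convex combination of client fields.

On the server, ‖g(θ₀)‖ has second moment x = tr Σ · ∑ wᵢ²/nᵢ. With G = C_B² d (d ∨ log N)/μ², the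
noise has second moment at most 10.4·y, where y = G · (2 log m/ℓ) · ∑ wᵢ²/nᵢ²; the number 10.4 is 8
times the rounding loss 1.3 in K₂. Inverse variance weights give x + y = V, the harmonic quantity of
the theorem (`isWeight`). Stage one, run for 4 log(nᵢ)/ℓ steps, produces errors of order √(tr Σ/nᵢ)
plus noise of order √(m³/(A nᵢ)). Averaging with weights nᵢ/N costs at most √m, and the server
contraction by m⁻² absorbs both √m and √(m³)·√m = m². What remains is √(tr Σ/N)/τ, at most √x/τ,
plus a small multiple of 1/√N (`init_error_le`). Cauchy–Schwarz bounds 2√x + √(10.4 y) by √(14.4 V),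
and the remainders fit below (41/10)√V/τ₁, whose square is below 17V/τ₁² (`total_error_le`).

The difficulty is that m is not bounded in terms of the nᵢ, so no union bound over clients is
available and some clients may behave badly. A client is bad with probability exponentially small in
nᵢ: the boundedness and Lipschitz continuity of the Hessian allow Hoeffding's inequality on a net,
and nᵢ ≥ A d(1 + log d) beats the metric entropy. Even on the bad event iterates grow only like 2^K
with K ≤ nᵢ/A. Hence the excess Xᵢ, a multiple of 1 + gradient + error restricted to the bad event,
has L^q norm at most nᵢ⁻⁴ (`eventually_exists_client_excess`). Both systems of weights are at most
nᵢ³/Λ with Λ of order √N, so a truncation argument shows that the weighted sums of excesses exceed 1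
only with probability below any prescribed power of N (`pi_meas_one_lt_sum_le`). Off that event, bad
clients cost the server only τ₁/50 of convexity (`Assumptions.inner_sum_avgHess_ge`). On it, the
crude growth 2^{K₂} is polynomial in m, and Hölder's inequality makes the contribution negligible
against 1/√N ≤ √(V/s).

All local analysis takes place in one ball around θ₀ with radius the smallest sample size. Errors
are tracked by real bounds on L^p norms, which add up by Minkowski (`LpBound`). Every largeness
requirement is stated for all sufficiently large A, so that the finitely many of them are met
simultaneously. -/

namespace FedHybrid

/-! ### Bounds on `L^p` norms of real functions -/

/-- The real function `f` is a.e. measurable and its `L^p` norm is at most the real number `a`. -/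
structure LpBound {α : Type*} [MeasurableSpace α] (μ : Measure α) (p : ENNReal) (f : α → ℝ)
    (a : ℝ) : Prop where
  aesm : AEStronglyMeasurable f μ
  nonneg : 0 ≤ a
  le : eLpNorm f p μ ≤ ENNReal.ofReal a

namespace LpBound

variable {α β : Type*} [MeasurableSpace α] [MeasurableSpace β] {μ : Measure α} {ν : Measure β}
  {p q : ENNReal} {f g : α → ℝ} {a b : ℝ}

lemma memLp (h : LpBound μ p f a) : MemLp f p μ :=
  ⟨h.aesm, h.le.trans_lt ENNReal.ofReal_lt_top⟩

lemma weaken (h : LpBound μ p f a) (hab : a ≤ b) : LpBound μ p f b :=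
  ⟨h.aesm, h.nonneg.trans hab, h.le.trans (ENNReal.ofReal_le_ofReal hab)⟩

lemma add (hp : 1 ≤ p) (hf : LpBound μ p f a) (hg : LpBound μ p g b) :
    LpBound μ p (fun x => f x + g x) (a + b) := by
  refine ⟨hf.aesm.add hg.aesm, add_nonneg hf.nonneg hg.nonneg, ?_⟩
  calc eLpNorm (f + g) p μ ≤ eLpNorm f p μ + eLpNorm g p μ := eLpNorm_add_le hf.aesm hg.aesm hp
    _ ≤ ENNReal.ofReal a + ENNReal.ofReal b := add_le_add hf.le hg.le
    _ = ENNReal.ofReal (a + b) := (ENNReal.ofReal_add hf.nonneg hg.nonneg).symm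

lemma zero : LpBound μ p (fun _ => (0 : ℝ)) 0 :=
  ⟨aestronglyMeasurable_const, le_rfl, by simp⟩

lemma sum (hp : 1 ≤ p) {ι : Type*} (s : Finset ι) {f : ι → α → ℝ} {a : ι → ℝ}
    (h : ∀ i ∈ s, LpBound μ p (f i) (a i)) :
    LpBound μ p (fun x => ∑ i ∈ s, f i x) (∑ i ∈ s, a i) := by
  classical
  induction s using Finset.induction_on with
  | empty => simpa using zero
  | insert i s hi ih =>
    simp only [Finset.sum_insert hi]
    exact (h i (Finset.mem_insert_self i s)).add hp
      (ih fun j hj => h j (Finset.mem_insert_of_mem hj))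

lemma const_mul (h : LpBound μ p f a) {c : ℝ} (hc : 0 ≤ c) :
    LpBound μ p (fun x => c * f x) (c * a) := by
  refine ⟨h.aesm.const_mul c, mul_nonneg hc h.nonneg, ?_⟩
  calc eLpNorm (c • f) p μ = ‖c‖ₑ * eLpNorm f p μ := eLpNorm_const_smul c f p μ
    _ ≤ ENNReal.ofReal c * ENNReal.ofReal a := by
        rw [Real.enorm_eq_ofReal hc]
        gcongr
        exact h.le
    _ = ENNReal.ofReal (c * a) := (ENNReal.ofReal_mul hc).symm

lemma const [IsProbabilityMeasure μ] (hp : p ≠ 0) {c : ℝ} (hc : 0 ≤ c) :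
    LpBound μ p (fun _ => c) c := by
  refine ⟨aestronglyMeasurable_const, hc, ?_⟩
  rw [eLpNorm_const c hp (NeZero.ne μ)]
  simp [Real.enorm_eq_ofReal hc]

lemma mono (hg : LpBound μ p g a) (hf : AEStronglyMeasurable f μ) (h : ∀ x, |f x| ≤ g x) :
    LpBound μ p f a :=
  ⟨hf, hg.nonneg, (eLpNorm_mono_real fun x => by simpa using h x).trans hg.le⟩

lemma exponent_le [IsProbabilityMeasure μ] (h : LpBound μ q f a) (hpq : p ≤ q) :
    LpBound μ p f a :=
  ⟨h.aesm, h.nonneg, (eLpNorm_le_eLpNorm_of_exponent_le hpq h.aesm).trans h.le⟩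

lemma comp {f : β → ℝ} (h : LpBound ν p f a) {φ : α → β} (hφ : MeasurePreserving φ μ ν) :
    LpBound μ p (fun x => f (φ x)) a :=
  ⟨h.aesm.comp_measurePreserving hφ, h.nonneg,
    (eLpNorm_comp_measurePreserving h.aesm hφ).trans_le h.le⟩

lemma integral_pow {k : ℕ} (hk : k ≠ 0) (h : LpBound μ k f a) :
    ∫⁻ x, ENNReal.ofReal (|f x| ^ k) ∂μ ≤ ENNReal.ofReal (a ^ k) := by
  have h1 := h.le
  rw [eLpNorm_eq_lintegral_rpow_enorm_toReal (by simpa using hk) (by simp)] at h1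
  have h2 := ENNReal.rpow_le_rpow h1 (z := (k : ℝ)) (by positivity)
  rw [← ENNReal.rpow_mul] at h2
  have hk' : (k : ℝ) ≠ 0 := by exact_mod_cast hk
  simp only [ENNReal.toReal_natCast, one_div, inv_mul_cancel₀ hk', ENNReal.rpow_one,
    ENNReal.rpow_natCast] at h2
  rw [ENNReal.ofReal_pow h.nonneg]
  refine le_trans (le_of_eq (lintegral_congr fun x => ?_)) h2
  rw [ENNReal.ofReal_pow (abs_nonneg _), ← Real.norm_eq_abs, ofReal_norm]

lemma of_integral_pow {k : ℕ} (hk : k ≠ 0) (hf : AEStronglyMeasurable f μ) (ha : 0 ≤ a)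
    (h : ∫⁻ x, ENNReal.ofReal (|f x| ^ k) ∂μ ≤ ENNReal.ofReal (a ^ k)) : LpBound μ k f a := by
  refine ⟨hf, ha, ?_⟩
  have hk' : (k : ℝ) ≠ 0 := by exact_mod_cast hk
  rw [eLpNorm_eq_lintegral_rpow_enorm_toReal (by simpa using hk) (by simp)]
  have h2 : ∫⁻ x, ‖f x‖ₑ ^ (k : ENNReal).toReal ∂μ ≤ ENNReal.ofReal (a ^ k) := by
    refine le_trans (le_of_eq (lintegral_congr fun x => ?_)) h
    rw [ENNReal.ofReal_pow (abs_nonneg _), ← Real.norm_eq_abs, ofReal_norm]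
    simp
  calc _ ≤ (ENNReal.ofReal (a ^ k)) ^ (1 / (k : ENNReal).toReal) :=
        ENNReal.rpow_le_rpow h2 (by positivity)
    _ = ENNReal.ofReal a := by
        rw [ENNReal.ofReal_pow ha, ← ENNReal.rpow_natCast, ← ENNReal.rpow_mul]
        simp [hk']

/-- The second moment of a function with an `L²` bound. -/
lemma integrable_sq_and_integral_le (h : LpBound μ 2 f a) :
    Integrable (fun x => f x ^ 2) μ ∧ ∫ x, f x ^ 2 ∂μ ≤ a ^ 2 := by
  have hi : Integrable (fun x => f x ^ 2) μ := h.memLp.integrable_sq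
  refine ⟨hi, ?_⟩
  rw [integral_eq_lintegral_of_nonneg_ae (Filter.Eventually.of_forall fun x => sq_nonneg _)
    hi.aestronglyMeasurable]
  refine ENNReal.toReal_le_of_le_ofReal (sq_nonneg a) ?_
  have := integral_pow (k := 2) two_ne_zero (by exact_mod_cast h)
  simpa using this

lemma of_integral_sq (hf : AEStronglyMeasurable f μ) (ha : 0 ≤ a)
    (hi : Integrable (fun x => f x ^ 2) μ) (h : ∫ x, f x ^ 2 ∂μ ≤ a ^ 2) : LpBound μ 2 f a := by
  have := of_integral_pow (k := 2) two_ne_zero hf ha (by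
    simp only [sq_abs]
    rw [← ofReal_integral_eq_lintegral_ofReal hi (Filter.Eventually.of_forall fun x => sq_nonneg _)]
    exact ENNReal.ofReal_le_ofReal h)
  exact_mod_cast this

/-- Markov's inequality. -/
lemma meas_gt_le {k : ℕ} (hk : k ≠ 0) (h : LpBound μ k f a) {ε : ℝ} (hε : 0 < ε) :
    μ {x | ε ≤ |f x|} ≤ ENNReal.ofReal ((a / ε) ^ k) := by
  have h1 := h.integral_pow hk
  have h2 := meas_ge_le_lintegral_div (μ := μ)
    (f := fun x => ENNReal.ofReal (|f x| ^ k)) (ε := ENNReal.ofReal (ε ^ k))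
    ((h.aesm.aemeasurable.abs.pow_const k).ennreal_ofReal)
    (by simp only [ne_eq, ENNReal.ofReal_eq_zero, not_le]; positivity) ENNReal.ofReal_ne_top
  calc μ {x | ε ≤ |f x|} ≤ μ {x | ENNReal.ofReal (ε ^ k) ≤ ENNReal.ofReal (|f x| ^ k)} := by
        refine measure_mono fun x hx => ?_
        exact ENNReal.ofReal_le_ofReal (pow_le_pow_left₀ hε.le hx k)
    _ ≤ _ := h2
    _ ≤ ENNReal.ofReal (a ^ k) / ENNReal.ofReal (ε ^ k) := by gcongr
    _ = ENNReal.ofReal ((a / ε) ^ k) := by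
        rw [← ENNReal.ofReal_div_of_pos (by positivity), div_pow]

/-- Hölder's inequality for the restriction to an event: the `L^k` norm is at most
the probability to the power `1 / (2k)` times the `L^{2k}` norm. -/
lemma indicator {k : ℕ} (hk : k ≠ 0) (h : LpBound μ (2 * k : ℕ) f a) {s : Set α}
    (hs : MeasurableSet s) {b : ℝ} (hb : 0 ≤ b) (hμ : μ s ≤ ENNReal.ofReal (b ^ (2 * k))) :
    LpBound μ k (s.indicator f) (b * a) := by
  have h2k : 2 * k ≠ 0 := by omega
  refine of_integral_pow hk (h.aesm.indicator hs) (mul_nonneg hb h.nonneg) ?_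
  have h1 := h.integral_pow h2k
  have hm : AEMeasurable (fun x => ENNReal.ofReal (|f x| ^ k)) μ :=
    (h.aesm.aemeasurable.abs.pow_const k).ennreal_ofReal
  -- Cauchy–Schwarz for `|f| ^ k` and the indicator; taking square roots turns the powers `2 * k`
  -- into powers `k`.
  have hH := ENNReal.lintegral_mul_le_Lp_mul_Lq μ Real.HolderConjugate.two_two hm
    (g := s.indicator fun _ => 1) ((aemeasurable_const).indicator hs)
  have e1 : ∀ x, ENNReal.ofReal (|f x| ^ k) ^ (2 : ℝ) = ENNReal.ofReal (|f x| ^ (2 * k)) := by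
    intro x
    rw [ENNReal.rpow_ofNat, ← ENNReal.ofReal_pow (by positivity), ← pow_mul, mul_comm]
  have e2 : ∫⁻ x, (s.indicator (fun _ => (1 : ENNReal)) x) ^ (2 : ℝ) ∂μ = μ s := by
    rw [← lintegral_indicator_one hs]
    refine lintegral_congr fun x => ?_
    by_cases hx : x ∈ s <;> simp [hx]
  simp only [e1, e2] at hH
  calc ∫⁻ x, ENNReal.ofReal (|s.indicator f x| ^ k) ∂μ
      = ∫⁻ x, ENNReal.ofReal (|f x| ^ k) * s.indicator (fun _ => 1) x ∂μ := by
        refine lintegral_congr fun x => ?_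
        by_cases hx : x ∈ s <;> simp [hx, hk]
    _ ≤ _ := hH
    _ ≤ ENNReal.ofReal (a ^ (2 * k)) ^ (1 / (2 : ℝ)) *
        ENNReal.ofReal (b ^ (2 * k)) ^ (1 / (2 : ℝ)) := by gcongr
    _ = ENNReal.ofReal ((b * a) ^ k) := by
        have e3 : ∀ c : ℝ, 0 ≤ c →
            ENNReal.ofReal (c ^ (2 * k)) ^ (1 / (2 : ℝ)) = ENNReal.ofReal (c ^ k) := by
          intro c hc
          rw [mul_comm 2 k, pow_mul, ENNReal.ofReal_pow (by positivity), ← ENNReal.rpow_natCast,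
            ← ENNReal.rpow_mul]
          simp
        rw [e3 a h.nonneg, e3 b hb, ← ENNReal.ofReal_mul (pow_nonneg h.nonneg k), mul_pow, mul_comm]

end LpBound

/-! ### Perturbed gradient steps -/

section Descent

variable {E : Type*} [NormedAddCommGroup E] [InnerProductSpace ℝ E]

/-- A symmetric operator whose quadratic form lies between `0` and `c` has norm at most `c`. -/
lemma norm_le_of_symmetric_of_inner_mem_Icc {T : E →L[ℝ] E} (hT : T.IsSymmetric) {c : ℝ}
    (hc : 0 ≤ c) (h0 : ∀ v, 0 ≤ inner ℝ v (T v)) (h1 : ∀ v, inner ℝ v (T v) ≤ c * ‖v‖ ^ 2) :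
    ‖T‖ ≤ c := by
  -- Symmetry makes the norm equal to the supremum of the absolute Rayleigh quotients, so bounds on
  -- the quadratic form suffice.
  rw [ContinuousLinearMap.norm_eq_iSup_rayleighQuotient T hT]
  refine ciSup_le fun v => ?_
  have e : T.rayleighQuotient v = inner ℝ v (T v) / ‖v‖ ^ 2 := by
    simp [ContinuousLinearMap.rayleighQuotient, ContinuousLinearMap.reApplyInnerSelf,
      real_inner_comm]
  rw [e, abs_of_nonneg (div_nonneg (h0 v) (sq_nonneg _))]
  exact div_le_of_le_mul₀ (sq_nonneg _) hc (h1 v)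

/-- A field `g` whose derivative is symmetric, bounded above by `τ₂` in norm and, on the ball of
radius `r` around `θ₀`, bounded below by `τ` as a quadratic form. -/
structure RegularField (g : E → E) (H : E → E →L[ℝ] E) (τ₂ : ℝ) : Prop where
  deriv : ∀ θ, HasFDerivAt g (H θ) θ
  symm : ∀ θ, (H θ).IsSymmetric
  bound : ∀ θ, ‖H θ‖ ≤ τ₂

variable {g : E → E} {H : E → E →L[ℝ] E} {τ τ₂ η r : ℝ} {θ₀ : E}

lemma RegularField.inner_le (hg : RegularField g H τ₂) (θ v : E) :
    inner ℝ v (H θ v) ≤ τ₂ * ‖v‖ ^ 2 := by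
  calc inner ℝ v (H θ v) ≤ ‖v‖ * ‖H θ v‖ := real_inner_le_norm _ _
    _ ≤ ‖v‖ * (τ₂ * ‖v‖) := by
        gcongr
        exact (H θ).le_of_opNorm_le (hg.bound θ) v
    _ = τ₂ * ‖v‖ ^ 2 := by ring

/-- A gradient step is a contraction towards `θ₀` where the field is strongly monotone. -/
lemma RegularField.norm_step_sub_le (hg : RegularField g H τ₂) (hη : 0 ≤ η) (hη₂ : η * τ₂ ≤ 1)
    (hτ : τ ≤ τ₂)
    (hlow : ∀ θ, ‖θ - θ₀‖ ≤ r → ∀ v, τ * ‖v‖ ^ 2 ≤ inner ℝ v (H θ v))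
    {θ : E} (hθ : ‖θ - θ₀‖ ≤ r) :
    ‖(θ - η • g θ) - (θ₀ - η • g θ₀)‖ ≤ (1 - η * τ) * ‖θ - θ₀‖ := by
  have hr : 0 ≤ r := (norm_nonneg _).trans hθ
  -- The mean value inequality on the convex ball reduces the claim to the derivative `I - ηH`: its
  -- form is nonnegative because `η * τ₂ ≤ 1`, and at most `1 - η * τ` by the lower bound on `H`.
  have hd : ∀ y ∈ Metric.closedBall θ₀ r, HasFDerivWithinAt (fun y => y - η • g y)
      (ContinuousLinearMap.id ℝ E - η • H y) (Metric.closedBall θ₀ r) y := fun y _ =>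
    ((hasFDerivAt_id y).sub ((hg.deriv y).const_smul η)).hasFDerivWithinAt
  refine Convex.norm_image_sub_le_of_norm_hasFDerivWithin_le hd (fun y hy => ?_)
    (convex_closedBall θ₀ r) (Metric.mem_closedBall_self hr) (by simpa [dist_eq_norm] using hθ)
  have hy' : ‖y - θ₀‖ ≤ r := by simpa [dist_eq_norm] using hy
  have hin : ∀ v, inner ℝ v ((ContinuousLinearMap.id ℝ E - η • H y) v) =
      ‖v‖ ^ 2 - η * inner ℝ v (H y v) := fun v => by
    simp [inner_sub_right, inner_smul_right]
  refine norm_le_of_symmetric_of_inner_mem_Icc ?_ ?_ (fun v => ?_) fun v => ?_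
  · intro v w
    have := hg.symm y v w
    simp only [ContinuousLinearMap.coe_coe] at this
    simp [inner_sub_left, inner_sub_right, inner_smul_left, inner_smul_right, this]
  · have := mul_le_mul_of_nonneg_left hτ hη
    linarith
  · rw [hin]
    have h1 := mul_le_mul_of_nonneg_left (hg.inner_le y v) hη
    have h2 := mul_le_mul_of_nonneg_right hη₂ (sq_nonneg ‖v‖)
    linarith
  · rw [hin]
    have h1 := mul_le_mul_of_nonneg_left (hlow y hy' v) hη
    linarith

/-- Without monotonicity a gradient step at most doubles the distance to `θ₀`. -/
lemma RegularField.norm_step_sub_le_two_mul (hg : RegularField g H τ₂) (hη : 0 ≤ η)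
    (hη₂ : η * τ₂ ≤ 1) (θ : E) :
    ‖(θ - η • g θ) - (θ₀ - η • g θ₀)‖ ≤ 2 * ‖θ - θ₀‖ := by
  have hd : ∀ y ∈ Set.univ, HasFDerivWithinAt g (H y) Set.univ y := fun y _ =>
    (hg.deriv y).hasFDerivWithinAt
  have h := Convex.norm_image_sub_le_of_norm_hasFDerivWithin_le hd (fun y _ => hg.bound y)
    convex_univ (Set.mem_univ θ₀) (Set.mem_univ θ)
  have e : (θ - η • g θ) - (θ₀ - η • g θ₀) = (θ - θ₀) - η • (g θ - g θ₀) := by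
    rw [smul_sub]; abel
  rw [e]
  calc _ ≤ ‖θ - θ₀‖ + ‖η • (g θ - g θ₀)‖ := norm_sub_le _ _
    _ = ‖θ - θ₀‖ + η * ‖g θ - g θ₀‖ := by rw [norm_smul, Real.norm_of_nonneg hη]
    _ ≤ ‖θ - θ₀‖ + η * (τ₂ * ‖θ - θ₀‖) := by gcongr
    _ ≤ 2 * ‖θ - θ₀‖ := by nlinarith [mul_le_mul_of_nonneg_right hη₂ (norm_nonneg (θ - θ₀))]

/-- Iterates of a perturbed gradient descent stay in the ball where the field is strongly monotone
and converge linearly up to the accumulated perturbations. -/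
lemma RegularField.norm_iterate_sub_le (hg : RegularField g H τ₂) (hη : 0 ≤ η) (hη₂ : η * τ₂ ≤ 1)
    (hτ : τ ≤ τ₂)
    (hlow : ∀ θ, ‖θ - θ₀‖ ≤ r → ∀ v, τ * ‖v‖ ^ 2 ≤ inner ℝ v (H θ v))
    {x ν : ℕ → E} {K : ℕ} (hx : ∀ k < K, x (k + 1) = x k - η • g (x k) + ν k)
    (h0 : ‖x 0 - θ₀‖ ≤ r) (hν : ∀ k < K, η * ‖g θ₀‖ + ‖ν k‖ ≤ η * τ * r) :
    ‖x K - θ₀‖ ≤ r ∧ ‖x K - θ₀‖ ≤ (1 - η * τ) ^ K * ‖x 0 - θ₀‖ +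
      ∑ k ∈ Finset.range K, (1 - η * τ) ^ (K - 1 - k) * (η * ‖g θ₀‖ + ‖ν k‖) := by
  have hq : 0 ≤ 1 - η * τ := by
    have := mul_le_mul_of_nonneg_left hτ hη
    linarith
  induction K with
  | zero => simpa using h0
  | succ K ih =>
    obtain ⟨i1, i2⟩ := ih (fun k hk => hx k (by omega)) fun k hk => hν k (by omega)
    have hs := hg.norm_step_sub_le hη hη₂ hτ hlow i1
    have e : x (K + 1) - θ₀ = ((x K - η • g (x K)) - (θ₀ - η • g θ₀)) + (ν K - η • g θ₀) := by
      rw [hx K (by omega)]; abel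
    have h1 : ‖x (K + 1) - θ₀‖ ≤ (1 - η * τ) * ‖x K - θ₀‖ + (η * ‖g θ₀‖ + ‖ν K‖) := by
      rw [e]
      calc _ ≤ ‖(x K - η • g (x K)) - (θ₀ - η • g θ₀)‖ + ‖ν K - η • g θ₀‖ := norm_add_le _ _
        _ ≤ (1 - η * τ) * ‖x K - θ₀‖ + (‖ν K‖ + ‖η • g θ₀‖) :=
            add_le_add hs (norm_sub_le _ _)
        _ = _ := by rw [norm_smul, Real.norm_of_nonneg hη]; ring
    refine ⟨?_, ?_⟩
    -- The ball is invariant because (1 - ητ)r + ητr = r.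
    · have h2 := mul_le_mul_of_nonneg_left i1 hq
      have h3 := hν K (by omega)
      linarith
    · rw [Finset.sum_range_succ]
      have h2 := mul_le_mul_of_nonneg_left i2 hq
      have e2 : (1 - η * τ) * ∑ k ∈ Finset.range K, (1 - η * τ) ^ (K - 1 - k) *
          (η * ‖g θ₀‖ + ‖ν k‖) = ∑ k ∈ Finset.range K, (1 - η * τ) ^ (K + 1 - 1 - k) *
          (η * ‖g θ₀‖ + ‖ν k‖) := by
        rw [Finset.mul_sum]
        refine Finset.sum_congr rfl fun k hk => ?_
        rw [← mul_assoc, ← pow_succ']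
        congr 2
        have := Finset.mem_range.1 hk
        omega
      have e3 : K + 1 - 1 - K = 0 := by omega
      rw [← e2, e3, pow_zero, one_mul, pow_succ']
      linarith

/-- The crude growth bound for a perturbed gradient descent. -/
lemma RegularField.norm_iterate_sub_le_two_pow (hg : RegularField g H τ₂) (hη : 0 ≤ η)
    (hη₂ : η * τ₂ ≤ 1) {x ν : ℕ → E} {K : ℕ}
    (hx : ∀ k < K, x (k + 1) = x k - η • g (x k) + ν k) (θ₀ : E) :
    ‖x K - θ₀‖ ≤ 2 ^ K * (‖x 0 - θ₀‖ + ∑ k ∈ Finset.range K, (η * ‖g θ₀‖ + ‖ν k‖)) := by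
  induction K with
  | zero => simp
  | succ K ih =>
    have ih := ih fun k hk => hx k (by omega)
    have hs := hg.norm_step_sub_le_two_mul (θ₀ := θ₀) hη hη₂ (x K)
    have e : x (K + 1) - θ₀ = ((x K - η • g (x K)) - (θ₀ - η • g θ₀)) + (ν K - η • g θ₀) := by
      rw [hx K (by omega)]; abel
    rw [e, Finset.sum_range_succ, pow_succ']
    have h0 : 0 ≤ η * ‖g θ₀‖ + ‖ν K‖ := by positivity
    have h1 : (1 : ℝ) ≤ 2 * 2 ^ K := by
      have := one_le_pow₀ (M₀ := ℝ) one_le_two (n := K)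
      linarith
    calc _ ≤ ‖(x K - η • g (x K)) - (θ₀ - η • g θ₀)‖ + ‖ν K - η • g θ₀‖ := norm_add_le _ _
      _ ≤ 2 * ‖x K - θ₀‖ + (‖ν K‖ + ‖η • g θ₀‖) := add_le_add hs (norm_sub_le _ _)
      _ = 2 * ‖x K - θ₀‖ + (η * ‖g θ₀‖ + ‖ν K‖) := by
          rw [norm_smul, Real.norm_of_nonneg hη]; ring
      _ ≤ _ := by nlinarith [mul_le_mul_of_nonneg_right h1 h0]

end Descent

/-! ### Exponential moments from sub-Gaussian tails -/

section Tails

variable {α : Type*} [MeasurableSpace α] {μ : Measure α}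

lemma summable_tail : Summable fun k : ℕ => 2 * Real.exp (((k : ℝ) + 1) ^ 2 / 2 - (k : ℝ) ^ 2) := by
  refine Summable.mul_left 2 (Summable.of_nonneg_of_le (fun k => (Real.exp_pos _).le) (fun k => ?_)
    ((Real.summable_exp_neg_nat).mul_left (Real.exp (5 / 2))))
  rw [← Real.exp_add]
  refine Real.exp_le_exp.2 ?_
  -- The exponent is at most 5/2 - k, the gap being (k - 2)²/2.
  nlinarith [sq_nonneg ((k : ℝ) - 2)]

/-- The bound on `E exp (Y² / (2 C²))` for variables with sub-Gaussian tails of scale `C`. -/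
noncomputable def tailConst : ℝ := ∑' k : ℕ, 2 * Real.exp (((k : ℝ) + 1) ^ 2 / 2 - (k : ℝ) ^ 2)

lemma one_le_tailConst : 1 ≤ tailConst := by
  have h := summable_tail.le_tsum 0 fun k _ => by positivity
  refine le_trans ?_ h
  have : (1 : ℝ) ≤ Real.exp (((0 : ℕ) + 1) ^ 2 / 2 - ((0 : ℕ) : ℝ) ^ 2) :=
    Real.one_le_exp (by norm_num)
  linarith

/-- Slice by the integer part k of |Y|/C: on that slice the integrand is at most exp((k + 1)²/2),
while the slice has probability at most 2 exp(-k²). The factor 2 in the denominator of the exponent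
leaves room for the series to converge. -/
lemma lintegral_exp_sq_le [IsProbabilityMeasure μ] {Y : α → ℝ} (hY : Measurable Y) {C : ℝ}
    (hC : 0 < C)
    (h1 : ∀ t, 0 ≤ t → μ.real {x | t ≤ Y x} ≤ Real.exp (-t ^ 2 / C ^ 2))
    (h2 : ∀ t, 0 ≤ t → μ.real {x | t ≤ -Y x} ≤ Real.exp (-t ^ 2 / C ^ 2)) :
    ∫⁻ x, ENNReal.ofReal (Real.exp (Y x ^ 2 / (2 * C ^ 2))) ∂μ ≤ ENNReal.ofReal tailConst := by
  set s : ℕ → Set α := fun k => {x | C * k ≤ |Y x|} with hs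
  have hsm : ∀ k, MeasurableSet (s k) := fun k =>
    measurableSet_le measurable_const hY.abs
  have hp : ∀ x, ENNReal.ofReal (Real.exp (Y x ^ 2 / (2 * C ^ 2))) ≤
      ∑' k : ℕ, (s k).indicator (fun _ => ENNReal.ofReal (Real.exp (((k : ℝ) + 1) ^ 2 / 2))) x := by
    intro x
    set k := ⌊|Y x| / C⌋₊ with hk
    have hk1 : (k : ℝ) ≤ |Y x| / C := Nat.floor_le (by positivity)
    have hk2 : |Y x| / C < k + 1 := Nat.lt_floor_add_one _
    refine le_trans ?_ (ENNReal.le_tsum k)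
    have hx : x ∈ s k := by
      rw [le_div_iff₀ hC] at hk1
      simpa [hs, mul_comm] using hk1
    rw [Set.indicator_of_mem hx]
    refine ENNReal.ofReal_le_ofReal (Real.exp_le_exp.2 ?_)
    have e : Y x ^ 2 / (2 * C ^ 2) = (|Y x| / C) ^ 2 / 2 := by
      rw [div_pow, sq_abs]; field_simp
    rw [e]
    have : (0 : ℝ) ≤ |Y x| / C := by positivity
    gcongr
  have hμ : ∀ k : ℕ, μ (s k) ≤ ENNReal.ofReal (2 * Real.exp (-(k : ℝ) ^ 2)) := by
    intro k
    have hsub : s k ⊆ {x | C * k ≤ Y x} ∪ {x | C * k ≤ -Y x} := by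
      intro x hx
      rcases le_abs.1 (show C * k ≤ |Y x| from hx) with h | h
      · exact Or.inl h
      · exact Or.inr h
    have e : -(C * k) ^ 2 / C ^ 2 = -(k : ℝ) ^ 2 := by field_simp
    have h1' := h1 (C * k) (by positivity)
    have h2' := h2 (C * k) (by positivity)
    rw [e] at h1' h2'
    rw [← ofReal_measureReal]
    refine ENNReal.ofReal_le_ofReal ?_
    calc μ.real (s k) ≤ μ.real ({x | C * k ≤ Y x} ∪ {x | C * k ≤ -Y x}) := measureReal_mono hsub
      _ ≤ _ := measureReal_union_le _ _
      _ ≤ _ := by linarith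
  calc _ ≤ ∫⁻ x, ∑' k : ℕ, (s k).indicator
          (fun _ => ENNReal.ofReal (Real.exp (((k : ℝ) + 1) ^ 2 / 2))) x ∂μ := lintegral_mono hp
    _ = ∑' k : ℕ, ENNReal.ofReal (Real.exp (((k : ℝ) + 1) ^ 2 / 2)) * μ (s k) := by
        rw [lintegral_tsum fun k => (measurable_const.indicator (hsm k)).aemeasurable]
        refine tsum_congr fun k => ?_
        rw [lintegral_indicator_const (hsm k)]
    _ ≤ ∑' k : ℕ, ENNReal.ofReal (2 * Real.exp (((k : ℝ) + 1) ^ 2 / 2 - (k : ℝ) ^ 2)) := by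
        refine ENNReal.tsum_le_tsum fun k => ?_
        calc _ ≤ ENNReal.ofReal (Real.exp (((k : ℝ) + 1) ^ 2 / 2)) *
              ENNReal.ofReal (2 * Real.exp (-(k : ℝ) ^ 2)) := by gcongr; exact hμ k
          _ = _ := by
              rw [← ENNReal.ofReal_mul (Real.exp_pos _).le, sub_eq_add_neg, Real.exp_add]
              congr 1
              ring
    _ = ENNReal.ofReal tailConst := by
        rw [tailConst, ENNReal.ofReal_tsum_of_nonneg (fun k => by positivity) summable_tail]

variable {d : ℕ}

/-- The exponential moment of the squared norm of a vector with sub-Gaussian coordinates. -/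
lemma lintegral_exp_norm_sq_le [IsProbabilityMeasure μ] (hd : 0 < d) {G : α → Vec d}
    (hG : Measurable G) {C : ℝ} (hC : 0 < C)
    (h1 : ∀ c t, 0 ≤ t → μ.real {x | t ≤ G x c} ≤ Real.exp (-t ^ 2 / C ^ 2))
    (h2 : ∀ c t, 0 ≤ t → μ.real {x | t ≤ -G x c} ≤ Real.exp (-t ^ 2 / C ^ 2)) :
    ∫⁻ x, ENNReal.ofReal (Real.exp (‖G x‖ ^ 2 / (2 * C ^ 2 * d))) ∂μ ≤
      ENNReal.ofReal tailConst := by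
  have hd' : (0 : ℝ) < d := by exact_mod_cast hd
  have hGc : ∀ c, Measurable fun x => G x c := fun c => by fun_prop
  have hp : ∀ x, ENNReal.ofReal (Real.exp (‖G x‖ ^ 2 / (2 * C ^ 2 * d))) ≤
      ∑ c, ENNReal.ofReal (d : ℝ)⁻¹ * ENNReal.ofReal (Real.exp (G x c ^ 2 / (2 * C ^ 2))) := by
    intro x
    -- The normalized squared norm is the average of the d coordinate exponents, so Jensen reduces
    -- to single coordinates; no independence between coordinates is needed.
    have hJ := convexOn_exp.map_sum_le (t := Finset.univ) (w := fun _ : Fin d => (d : ℝ)⁻¹)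
      (p := fun c => G x c ^ 2 / (2 * C ^ 2)) (fun _ _ => by positivity)
      (by simp [hd'.ne']) (fun _ _ => Set.mem_univ _)
    have e : ‖G x‖ ^ 2 / (2 * C ^ 2 * d) = ∑ c, (d : ℝ)⁻¹ • (G x c ^ 2 / (2 * C ^ 2)) := by
      rw [EuclideanSpace.real_norm_sq_eq, ← Finset.smul_sum, ← Finset.sum_div, smul_eq_mul]
      field_simp
    rw [e]
    refine (ENNReal.ofReal_le_ofReal hJ).trans (le_of_eq ?_)
    rw [ENNReal.ofReal_sum_of_nonneg fun _ _ => by positivity]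
    refine Finset.sum_congr rfl fun c _ => ?_
    rw [smul_eq_mul, ENNReal.ofReal_mul (by positivity)]
  calc _ ≤ ∫⁻ x, ∑ c, ENNReal.ofReal (d : ℝ)⁻¹ *
          ENNReal.ofReal (Real.exp (G x c ^ 2 / (2 * C ^ 2))) ∂μ := lintegral_mono hp
    _ = ∑ c, ENNReal.ofReal (d : ℝ)⁻¹ *
          ∫⁻ x, ENNReal.ofReal (Real.exp (G x c ^ 2 / (2 * C ^ 2))) ∂μ := by
        rw [lintegral_finsetSum _ fun c _ => by have := hGc c; fun_prop]
        refine Finset.sum_congr rfl fun c _ => lintegral_const_mul _ ?_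
        have := hGc c
        fun_prop
    _ ≤ ∑ _c : Fin d, ENNReal.ofReal (d : ℝ)⁻¹ * ENNReal.ofReal tailConst := by
        gcongr with c
        exact lintegral_exp_sq_le (hGc c) hC (h1 c) (h2 c)
    _ = ENNReal.ofReal tailConst := by
        rw [Finset.sum_const, Finset.card_univ, Fintype.card_fin, nsmul_eq_mul,
          ← mul_assoc, ENNReal.ofReal_inv_of_pos hd', ENNReal.ofReal_natCast,
          ENNReal.mul_inv_cancel (by simpa using hd.ne') (by simp), one_mul]

/-- The constant in the bound of the `L^{2k}` norm by the sub-Gaussian scale. -/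
noncomputable def momentConst (k : ℕ) : ℝ := (k.factorial : ℝ) * tailConst + 1

lemma one_le_momentConst (k : ℕ) : 1 ≤ momentConst k := by
  have := one_le_tailConst
  unfold momentConst
  have : 0 ≤ (k.factorial : ℝ) * tailConst := by positivity
  linarith

/-- Moments from an exponential moment of the square. -/
lemma lpBound_of_lintegral_exp_sq {Z : α → ℝ} (hZ : Measurable Z) {A : ℝ} (hA : 0 ≤ A)
    (h : ∫⁻ x, ENNReal.ofReal (Real.exp (Z x ^ 2 / A ^ 2)) ∂μ ≤ ENNReal.ofReal tailConst)
    (hA0 : A ≠ 0) {k : ℕ} (hk : k ≠ 0) : LpBound μ (2 * k : ℕ) Z (A * momentConst k) := by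
  have hm := one_le_momentConst k
  have hA' : 0 < A := lt_of_le_of_ne hA (Ne.symm hA0)
  refine LpBound.of_integral_pow (by omega) hZ.aestronglyMeasurable (by positivity) ?_
  have hp : ∀ x, ENNReal.ofReal (|Z x| ^ (2 * k)) ≤
      ENNReal.ofReal (A ^ (2 * k) * k.factorial) *
        ENNReal.ofReal (Real.exp (Z x ^ 2 / A ^ 2)) := by
    intro x
    rw [← ENNReal.ofReal_mul (by positivity)]
    refine ENNReal.ofReal_le_ofReal ?_
    have h1 := Real.pow_div_factorial_le_exp (Z x ^ 2 / A ^ 2) (by positivity) k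
    rw [div_le_iff₀ (by positivity), div_pow, div_le_iff₀ (by positivity)] at h1
    rw [pow_mul |Z x|, sq_abs, pow_mul A]
    linarith
  calc _ ≤ ∫⁻ x, ENNReal.ofReal (A ^ (2 * k) * k.factorial) *
          ENNReal.ofReal (Real.exp (Z x ^ 2 / A ^ 2)) ∂μ := lintegral_mono hp
    _ = ENNReal.ofReal (A ^ (2 * k) * k.factorial) *
          ∫⁻ x, ENNReal.ofReal (Real.exp (Z x ^ 2 / A ^ 2)) ∂μ := by
        rw [lintegral_const_mul _ (by fun_prop)]
    _ ≤ ENNReal.ofReal (A ^ (2 * k) * k.factorial) * ENNReal.ofReal tailConst := by gcongr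
    _ ≤ ENNReal.ofReal ((A * momentConst k) ^ (2 * k)) := by
        rw [← ENNReal.ofReal_mul (by positivity), mul_pow, mul_assoc]
        refine ENNReal.ofReal_le_ofReal (mul_le_mul_of_nonneg_left ?_ (by positivity))
        -- As `momentConst k` is at least 1 it lies below its own power `2 * k`, which avoids
        -- extracting a root of k! · `tailConst`.
        calc (k.factorial : ℝ) * tailConst ≤ momentConst k := by unfold momentConst; linarith
          _ ≤ momentConst k ^ (2 * k) := le_self_pow₀ hm (by omega)

/-- The tail of a variable whose square has an exponential moment. -/
lemma meas_ge_le_of_lintegral_exp_sq {Z : α → ℝ} (hZ : Measurable Z) {A : ℝ} (hA : 0 < A)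
    (h : ∫⁻ x, ENNReal.ofReal (Real.exp (Z x ^ 2 / A ^ 2)) ∂μ ≤ ENNReal.ofReal tailConst)
    {t : ℝ} (ht : 0 ≤ t) :
    μ {x | t ≤ Z x} ≤ ENNReal.ofReal (tailConst * Real.exp (-(t ^ 2 / A ^ 2))) := by
  have h2 := meas_ge_le_lintegral_div (μ := μ)
    (f := fun x => ENNReal.ofReal (Real.exp (Z x ^ 2 / A ^ 2)))
    (ε := ENNReal.ofReal (Real.exp (t ^ 2 / A ^ 2))) (by fun_prop)
    (by simp only [ne_eq, ENNReal.ofReal_eq_zero, not_le]; positivity) ENNReal.ofReal_ne_top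
  calc μ {x | t ≤ Z x} ≤ _ := by
        refine measure_mono fun x hx => ?_
        have hx : t ≤ Z x := hx
        refine ENNReal.ofReal_le_ofReal (Real.exp_le_exp.2 ?_)
        gcongr
    _ ≤ _ := h2
    _ ≤ ENNReal.ofReal tailConst / ENNReal.ofReal (Real.exp (t ^ 2 / A ^ 2)) := by gcongr
    _ = _ := by
        rw [← ENNReal.ofReal_div_of_pos (Real.exp_pos _), Real.exp_neg, div_eq_mul_inv]

end Tails

/-! ### Sums of independent variables on product spaces -/

section Product

variable {ι : Type*} [Fintype ι] {α : ι → Type*} [∀ i, MeasurableSpace (α i)]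
  {κ : ∀ i, Measure (α i)} [∀ i, IsProbabilityMeasure (κ i)]

/-- The exponential Markov inequality for a sum of independent variables. -/
lemma pi_meas_ge_sum_le {f : ∀ i, α i → ℝ} (hf : ∀ i, Measurable (f i)) (a : ℝ) :
    Measure.pi κ {x | a ≤ ∑ i, f i (x i)} ≤
      ENNReal.ofReal (Real.exp (-a)) * ∏ i, ∫⁻ y, ENNReal.ofReal (Real.exp (f i y)) ∂κ i := by
  have hind : iIndepFun (fun i (x : ∀ i, α i) => ENNReal.ofReal (Real.exp (f i (x i))))
      (Measure.pi κ) :=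
    iIndepFun_pi (X := fun i y => ENNReal.ofReal (Real.exp (f i y))) fun i => by
      have := hf i
      fun_prop
  have hfm : ∀ i, Measurable fun y => ENNReal.ofReal (Real.exp (f i y)) := fun i => by
    have := hf i
    fun_prop
  have hme : ∀ i, Measurable fun x : ∀ i, α i => ENNReal.ofReal (Real.exp (f i (x i))) := fun i =>
    (hfm i).comp (measurable_pi_apply i)
  have h1 := lintegral_prod_eq_prod_lintegral_of_indepFun Finset.univ _ hind hme
  have h2 : ∀ i, ∫⁻ x : ∀ i, α i, ENNReal.ofReal (Real.exp (f i (x i))) ∂Measure.pi κ =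
      ∫⁻ y, ENNReal.ofReal (Real.exp (f i y)) ∂κ i := fun i =>
    (measurePreserving_eval κ i).lintegral_comp (hfm i)
  simp only [h2] at h1
  have h3 := meas_ge_le_lintegral_div (μ := Measure.pi κ)
    (f := fun x => ∏ i, ENNReal.ofReal (Real.exp (f i (x i))))
    (ε := ENNReal.ofReal (Real.exp a))
    (Finset.measurable_prod _ fun i _ => hme i).aemeasurable
    (by simp only [ne_eq, ENNReal.ofReal_eq_zero, not_le]; positivity) ENNReal.ofReal_ne_top
  rw [h1] at h3
  calc Measure.pi κ {x | a ≤ ∑ i, f i (x i)} ≤ _ := by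
        refine measure_mono fun x hx => ?_
        have hx : a ≤ ∑ i, f i (x i) := hx
        show ENNReal.ofReal (Real.exp a) ≤ ∏ i, ENNReal.ofReal (Real.exp (f i (x i)))
        rw [← ENNReal.ofReal_prod_of_nonneg fun i _ => (Real.exp_pos _).le, ← Real.exp_sum]
        exact ENNReal.ofReal_le_ofReal (Real.exp_le_exp.2 hx)
    _ ≤ _ := h3
    _ = _ := by
        rw [ENNReal.div_eq_inv_mul, ← ENNReal.ofReal_inv_of_pos (Real.exp_pos a), Real.exp_neg]

/-- A weighted sum of independent nonnegative variables with small high moments exceeds one only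
with small probability. -/
lemma pi_meas_one_lt_sum_le {X : ∀ i, α i → ℝ} (hX : ∀ i, Measurable (X i))
    (hX0 : ∀ i y, 0 ≤ X i y) {p b : ι → ℝ} (hp : ∀ i, 0 ≤ p i) {Λ : ℝ} (hΛ : 0 < Λ) {k : ℕ}
    (hk : k ≠ 0) (hXb : ∀ i, LpBound (κ i) k (X i) (b i)) (hpb : ∀ i, p i * b i ≤ 1 / Λ)
    (hsum : ∑ i, p i * b i ≤ 1 / 4) :
    Measure.pi κ {x | 1 < ∑ i, p i * X i (x i)} ≤
      ENNReal.ofReal (Fintype.card ι * (1 / √Λ) ^ k + Real.exp (-(√Λ / 2))) := by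
  set L := √Λ with hL
  have hL0 : 0 < L := Real.sqrt_pos.2 hΛ
  have hLL : L * L = Λ := Real.mul_self_sqrt hΛ.le
  -- Truncate each summand at 1/√Λ. If some summand reaches this level, the k-th moment with mean
  -- scale 1/Λ makes that event have probability at most (1/√Λ)^k. Otherwise the truncated sum
  -- exceeds 1, and exponential Markov with parameter √Λ applies.
  have hsub : {x : ∀ i, α i | 1 < ∑ i, p i * X i (x i)} ⊆
      (⋃ i, {x | 1 / L ≤ |p i * X i (x i)|}) ∪
        {x | L ≤ ∑ i, L * min (p i * X i (x i)) (1 / L)} := by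
    intro x hx
    have hx : 1 < ∑ i, p i * X i (x i) := hx
    by_cases h : ∃ i, 1 / L ≤ p i * X i (x i)
    · obtain ⟨i, hi⟩ := h
      exact Or.inl (Set.mem_iUnion.2 ⟨i, hi.trans (le_abs_self _)⟩)
    · push Not at h
      refine Or.inr ?_
      show L ≤ ∑ i, L * min (p i * X i (x i)) (1 / L)
      have : ∀ i, min (p i * X i (x i)) (1 / L) = p i * X i (x i) := fun i => min_eq_left (h i).le
      simp only [this, ← Finset.mul_sum]
      nlinarith
  have h1 : ∀ i, Measure.pi κ {x | 1 / L ≤ |p i * X i (x i)|} ≤ ENNReal.ofReal ((1 / L) ^ k) := by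
    intro i
    have hb := ((hXb i).const_mul (hp i)).comp (measurePreserving_eval κ i)
    refine (hb.meas_gt_le hk (ε := 1 / L) (by positivity)).trans (ENNReal.ofReal_le_ofReal ?_)
    have : 0 ≤ p i * b i := mul_nonneg (hp i) (hXb i).nonneg
    refine pow_le_pow_left₀ (by positivity) ?_ k
    rw [div_le_iff₀ (by positivity)]
    calc p i * b i ≤ 1 / Λ := hpb i
      _ = 1 / L * (1 / L) := by rw [← hLL]; field_simp
  have hm2 : ∀ i, Measurable fun y => L * min (p i * X i y) (1 / L) := fun i => by
    have := hX i
    fun_prop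
  have h2 : Measure.pi κ {x | L ≤ ∑ i, L * min (p i * X i (x i)) (1 / L)} ≤
      ENNReal.ofReal (Real.exp (-(L / 2))) := by
    refine (pi_meas_ge_sum_le (κ := κ) hm2 L).trans ?_
    have h3 : ∀ i, ∫⁻ y, ENNReal.ofReal (Real.exp (L * min (p i * X i y) (1 / L))) ∂κ i ≤
        ENNReal.ofReal (Real.exp (2 * L * (p i * b i))) := by
      intro i
      have hb1 : LpBound (κ i) (1 : ℕ) (X i) (b i) :=
        (hXb i).exponent_le (by exact_mod_cast Nat.one_le_iff_ne_zero.2 hk)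
      have hb2 := hb1.integral_pow one_ne_zero
      simp only [pow_one] at hb2
      have hpt : ∀ y, ENNReal.ofReal (Real.exp (L * min (p i * X i y) (1 / L))) ≤
          1 + ENNReal.ofReal (2 * L * p i) * ENNReal.ofReal |X i y| := by
        intro y
        have h0 : 0 ≤ p i * X i y := mul_nonneg (hp i) (hX0 i y)
        set z := L * min (p i * X i y) (1 / L) with hz
        have hz0 : 0 ≤ z := mul_nonneg hL0.le (le_min h0 (by positivity))
        have hz1 : z ≤ 1 := by
          calc z ≤ L * (1 / L) := mul_le_mul_of_nonneg_left (min_le_right _ _) hL0.le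
            _ = 1 := by field_simp
        have hz2 : z ≤ L * (p i * X i y) := by
          exact mul_le_mul_of_nonneg_left (min_le_left _ _) hL0.le
        -- After truncation the exponent lies in [0, 1], where exp has this linear bound; only the
        -- first moment of `X i` then enters the exponential moment.
        have he : Real.exp z ≤ 1 + 2 * z := by
          have := Real.abs_exp_sub_one_sub_id_le (x := z) (by rwa [abs_of_nonneg hz0])
          have := le_of_abs_le this
          nlinarith
        rw [abs_of_nonneg (hX0 i y), ← ENNReal.ofReal_one, ← ENNReal.ofReal_mul
          (by have := hp i; positivity), ← ENNReal.ofReal_add zero_le_one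
          (mul_nonneg (by have := hp i; positivity) (hX0 i y))]
        refine ENNReal.ofReal_le_ofReal ?_
        linarith
      have hm3 : Measurable fun y => ENNReal.ofReal |X i y| := (hX i).abs.ennreal_ofReal
      calc _ ≤ ∫⁻ y, (1 + ENNReal.ofReal (2 * L * p i) * ENNReal.ofReal |X i y|) ∂κ i :=
            lintegral_mono hpt
        _ = 1 + ENNReal.ofReal (2 * L * p i) * ∫⁻ y, ENNReal.ofReal |X i y| ∂κ i := by
            rw [lintegral_add_left measurable_const, lintegral_const_mul _ hm3]
            simp
        _ ≤ 1 + ENNReal.ofReal (2 * L * p i) * ENNReal.ofReal (b i) := by gcongr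
        _ = ENNReal.ofReal (1 + 2 * L * p i * b i) := by
            have := hp i
            rw [← ENNReal.ofReal_mul (by positivity), ENNReal.ofReal_add zero_le_one
              (mul_nonneg (by positivity) (hXb i).nonneg), ENNReal.ofReal_one]
        _ ≤ _ := by
            refine ENNReal.ofReal_le_ofReal ?_
            have := Real.add_one_le_exp (2 * L * (p i * b i))
            linarith
    calc _ ≤ ENNReal.ofReal (Real.exp (-L)) *
          ∏ i, ENNReal.ofReal (Real.exp (2 * L * (p i * b i))) := by
          gcongr with i
          exact h3 i
      _ = ENNReal.ofReal (Real.exp (-L + 2 * L * ∑ i, p i * b i)) := by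
          rw [← ENNReal.ofReal_prod_of_nonneg fun i _ => (Real.exp_pos _).le, ← Real.exp_sum,
            ← ENNReal.ofReal_mul (Real.exp_pos _).le, ← Real.exp_add, Finset.mul_sum]
      _ ≤ _ := by
          refine ENNReal.ofReal_le_ofReal (Real.exp_le_exp.2 ?_)
          -- With the sum of the `p i * b i` at most 1/4, the exponent -L + 2L/4 equals -L/2.
          nlinarith
  calc _ ≤ _ := measure_mono hsub
    _ ≤ _ := measure_union_le _ _
    _ ≤ ∑ _i : ι, ENNReal.ofReal ((1 / L) ^ k) + ENNReal.ofReal (Real.exp (-(L / 2))) := by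
        gcongr
        · refine (measure_iUnion_le _).trans ?_
          rw [tsum_fintype]
          exact Finset.sum_le_sum fun i _ => h1 i
    _ = _ := by
        rw [Finset.sum_const, nsmul_eq_mul, Finset.card_univ, ENNReal.ofReal_add (by positivity)
          (Real.exp_pos _).le, ENNReal.ofReal_mul (by positivity), ENNReal.ofReal_natCast]

/-- The second moment of a sum of independent centered vectors. -/
lemma pi_integral_norm_sq_sum {d : ℕ} {f : ∀ i, α i → Vec d} (hf : ∀ i, MemLp (f i) 2 (κ i))
    (h0 : ∀ i, ∫ y, f i y ∂κ i = 0) :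
    Integrable (fun x : ∀ i, α i => ‖∑ i, f i (x i)‖ ^ 2) (Measure.pi κ) ∧
      ∫ x, ‖∑ i, f i (x i)‖ ^ 2 ∂Measure.pi κ = ∑ i, ∫ y, ‖f i y‖ ^ 2 ∂κ i := by
  have hfc : ∀ i c, MemLp (fun y => f i y c) 2 (κ i) := fun i c =>
    (EuclideanSpace.proj (𝕜 := ℝ) c).comp_memLp' (hf i)
  have hfx : ∀ i, MemLp (fun x : ∀ i, α i => f i (x i)) 2 (Measure.pi κ) := fun i =>
    (hf i).comp_measurePreserving (measurePreserving_eval κ i)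
  have hF : MemLp (fun x : ∀ i, α i => ∑ i, f i (x i)) 2 (Measure.pi κ) :=
    memLp_finsetSum _ fun i _ => hfx i
  have hFc : ∀ c, MemLp (fun x : ∀ i, α i => (∑ i, f i (x i)) c) 2 (Measure.pi κ) := fun c =>
    (EuclideanSpace.proj (𝕜 := ℝ) c).comp_memLp' hF
  have h0c : ∀ i c, ∫ y, f i y c ∂κ i = 0 := fun i c => by
    have := (EuclideanSpace.proj (𝕜 := ℝ) c).integral_comp_comm
      ((hf i).integrable (by norm_num))
    simp only [h0 i, map_zero] at this
    exact this
  refine ⟨hF.integrable_norm_pow two_ne_zero, ?_⟩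
  -- Additivity of variances is applied coordinate by coordinate; centering turns each variance into
  -- a second moment.
  have hvar : ∀ c, ∫ x : ∀ i, α i, ((∑ i, f i (x i)) c) ^ 2 ∂Measure.pi κ =
      ∑ i, ∫ y, (f i y c) ^ 2 ∂κ i := by
    intro c
    have hv := variance_sum_pi (μ := κ) (X := fun i y => f i y c) fun i => hfc i c
    have e : (∑ i, fun ω : ∀ i, α i => f i (ω i) c) = fun ω => (∑ i, f i (ω i)) c := by
      ext ω; simp
    rw [e, variance_of_integral_eq_zero (hFc c).aestronglyMeasurable.aemeasurable] at hv
    · rw [hv]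
      exact Finset.sum_congr rfl fun i _ =>
        variance_of_integral_eq_zero (hfc i c).aestronglyMeasurable.aemeasurable (h0c i c)
    · have e2 : ∀ x : ∀ i, α i, (∑ i, f i (x i)) c = ∑ i, f i (x i) c := fun x => by simp
      simp only [e2]
      rw [integral_finsetSum _ fun i _ => ?_]
      · refine Finset.sum_eq_zero fun i _ => ?_
        have hm := (measurePreserving_eval κ i)
        have := integral_map (μ := Measure.pi κ) hm.measurable.aemeasurable
          (f := fun y => f i y c) (by rw [hm.map_eq]; exact (hfc i c).aestronglyMeasurable)
        rw [hm.map_eq, h0c i c] at this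
        exact this.symm
      · exact ((hfc i c).comp_measurePreserving (measurePreserving_eval κ i)).integrable
          (by norm_num)
  simp only [EuclideanSpace.real_norm_sq_eq]
  rw [integral_finsetSum _ fun c _ => (hFc c).integrable_sq]
  simp only [hvar]
  rw [Finset.sum_comm]
  refine Finset.sum_congr rfl fun i _ => ?_
  rw [integral_finsetSum _ fun c _ => (hfc i c).integrable_sq]

end Product

/-! ### Regularity of the loss -/

section Loss

variable {d : ℕ} {𝒳 : Type u} {ρ : 𝒳 → Vec d → ℝ}

lemma inner_grad (x : 𝒳) (θ v : Vec d) : inner ℝ (grad ρ x θ) v = fderiv ℝ (ρ x) θ v := by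
  simp [grad, gradient]

lemma contDiff_grad {x : 𝒳} (h : ContDiff ℝ 2 (ρ x)) : ContDiff ℝ 1 (grad ρ x) := by
  have h1 : ContDiff ℝ 1 (fderiv ℝ (ρ x)) := h.fderiv_right (by norm_num)
  exact ((InnerProductSpace.toDual ℝ (Vec d)).symm.toContinuousLinearEquiv.contDiff).comp h1

lemma hasFDerivAt_grad {x : 𝒳} (h : ContDiff ℝ 2 (ρ x)) (θ : Vec d) :
    HasFDerivAt (grad ρ x) (hess ρ x θ) θ :=
  ((contDiff_grad h).differentiable one_ne_zero θ).hasFDerivAt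

/-- The Hessian is defined as the derivative of the gradient. Identifying its form with the second
Fréchet derivative makes the symmetry of second derivatives available. -/
lemma inner_hess {x : 𝒳} (h : ContDiff ℝ 2 (ρ x)) (θ v w : Vec d) :
    inner ℝ (hess ρ x θ v) w = fderiv ℝ (fderiv ℝ (ρ x)) θ v w := by
  have h1 : HasFDerivAt (fun y => inner ℝ (grad ρ x y) w)
      ((innerSL ℝ w).comp (hess ρ x θ)) θ := by
    have := (innerSL ℝ w).hasFDerivAt.comp θ (hasFDerivAt_grad h θ)
    refine this.congr_of_eventuallyEq (Filter.Eventually.of_forall fun y => ?_)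
    simp [real_inner_comm]
  simp only [inner_grad] at h1
  have h2 : DifferentiableAt ℝ (fderiv ℝ (ρ x)) θ :=
    (h.fderiv_right (m := 1) (by norm_num)).differentiable one_ne_zero θ
  have h3 := h2.hasFDerivAt.clm_apply (hasFDerivAt_const w θ)
  have h4 := h1.unique h3
  have h5 := congrArg (fun T : Vec d →L[ℝ] ℝ => T v) h4
  simp at h5
  rw [real_inner_comm, h5]

lemma hess_isSymmetric {x : 𝒳} (h : ContDiff ℝ 2 (ρ x)) (θ : Vec d) :
    (hess ρ x θ).IsSymmetric := by
  intro v w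
  have hs := (h.contDiffAt (x := θ)).isSymmSndFDerivAt (by simp)
  have h1 := inner_hess h θ v w
  have h2 := inner_hess h θ w v
  have h3 := hs v w
  simp only [ContinuousLinearMap.coe_coe]
  rw [h1, h3, ← h2, real_inner_comm]

/-- Directional derivatives are limits of difference quotients along `1 / (n + 1)`. -/
lemma tendsto_diffQuotient {E F : Type*} [NormedAddCommGroup E] [NormedSpace ℝ E]
    [NormedAddCommGroup F] [NormedSpace ℝ F] {f : E → F} {f' : E →L[ℝ] F} {θ : E}
    (h : HasFDerivAt f f' θ) (v : E) :
    Filter.Tendsto (fun n : ℕ => ((n : ℝ) + 1) • (f (θ + ((n : ℝ) + 1)⁻¹ • v) - f θ))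
      Filter.atTop (nhds (f' v)) := by
  exact (h.lim_real v).comp
    (Filter.tendsto_atTop_add_const_right _ 1 tendsto_natCast_atTop_atTop)

/-! ### Measurability of gradients and Hessian forms -/

section Measurability

variable [MeasurableSpace 𝒳]

/-- Measurability in x is assumed only for the loss itself; directional derivatives inherit it as
pointwise limits of difference quotients along a fixed sequence. -/
lemma measurable_grad (hm : ∀ θ, Measurable fun x => ρ x θ) (hc : ∀ x, ContDiff ℝ 2 (ρ x))
    (θ : Vec d) : Measurable fun x => grad ρ x θ := by
  have h1 : ∀ v, Measurable fun x => fderiv ℝ (ρ x) θ v := fun v => by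
    refine measurable_of_tendsto_metrizable (f := fun (n : ℕ) x =>
      ((n : ℝ) + 1) • (ρ x (θ + ((n : ℝ) + 1)⁻¹ • v) - ρ x θ)) (fun n => ?_) ?_
    · exact (((hm _).sub (hm _)).const_smul ((n : ℝ) + 1) :)
    · rw [tendsto_pi_nhds]
      exact fun x => tendsto_diffQuotient
        ((hc x).differentiable two_ne_zero θ).hasFDerivAt v
  have h2 : ∀ c, Measurable fun x => grad ρ x θ c := fun c => by
    have e : (fun x => grad ρ x θ c) = fun x => fderiv ℝ (ρ x) θ (EuclideanSpace.single c 1) := by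
      ext x
      rw [← inner_grad]
      simp [EuclideanSpace.inner_single_right]
    rw [e]
    exact h1 _
  exact (WithLp.measurable_toLp 2 (Fin d → ℝ)).comp (measurable_pi_lambda _ h2)

/-- Continuity in θ together with measurability in x gives joint measurability, which is needed
because gradients are evaluated at iterates depending on the data. -/
lemma measurable_grad_uncurry (hm : ∀ θ, Measurable fun x => ρ x θ)
    (hc : ∀ x, ContDiff ℝ 2 (ρ x)) : Measurable fun p : 𝒳 × Vec d => grad ρ p.1 p.2 :=
  (measurable_uncurry_of_continuous_of_measurable (u := fun θ x => grad ρ x θ)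
    (fun x => (contDiff_grad (hc x)).continuous) (measurable_grad hm hc)).comp measurable_swap

lemma measurable_inner_hess (hm : ∀ θ, Measurable fun x => ρ x θ)
    (hc : ∀ x, ContDiff ℝ 2 (ρ x)) (θ v : Vec d) :
    Measurable fun x => inner ℝ v (hess ρ x θ v) := by
  have h1 : Measurable fun x => hess ρ x θ v := by
    refine measurable_of_tendsto_metrizable (f := fun (n : ℕ) x =>
      ((n : ℝ) + 1) • (grad ρ x (θ + ((n : ℝ) + 1)⁻¹ • v) - grad ρ x θ)) (fun n => ?_) ?_
    · exact (((measurable_grad hm hc _).sub (measurable_grad hm hc _)).const_smul ((n : ℝ) + 1) :)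
    · rw [tendsto_pi_nhds]
      exact fun x => tendsto_diffQuotient (hasFDerivAt_grad (hc x) θ) v
  exact measurable_const.inner h1

end Measurability

end Loss

/-! ### Population-level consequences of the assumptions -/

section Consequences

variable {d : ℕ} {𝒳 : Type u} [MeasurableSpace 𝒳] {P : Measure 𝒳}
  {ρ : 𝒳 → Vec d → ℝ} {Θ : Set (Vec d)} {θ₀ : Vec d} {τ₁ τ₂ W C₁ C₂ : ℝ}

namespace Assumptions

/-- The Bochner integral of a non-integrable function is 0 by convention, and a zero expected
Hessian would contradict strong convexity as soon as d is positive. -/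
lemma integrable_hess (hA : Assumptions P ρ Θ τ₁ τ₂ W C₁ C₂) (hτ₁ : 0 < τ₁) (hd : 0 < d)
    (θ : Vec d) : Integrable (fun x => hess ρ x θ) P := by
  by_contra h
  have h1 : popHess P ρ θ = 0 := integral_undef h
  have h2 := hA.strong_convex θ (EuclideanSpace.single ⟨0, hd⟩ 1)
  rw [h1] at h2
  simp at h2
  linarith

lemma integral_inner_hess (hA : Assumptions P ρ Θ τ₁ τ₂ W C₁ C₂) (hτ₁ : 0 < τ₁) (hd : 0 < d)
    (θ v : Vec d) : ∫ x, inner ℝ v (hess ρ x θ v) ∂P = inner ℝ v (popHess P ρ θ v) := by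
  have hi := hA.integrable_hess hτ₁ hd θ
  rw [popHess, ContinuousLinearMap.integral_apply hi, integral_inner (hi.apply_continuousLinearMap v)]

lemma inner_hess_le (hA : Assumptions P ρ Θ τ₁ τ₂ W C₁ C₂) (x : 𝒳) (θ v : Vec d) :
    |inner ℝ v (hess ρ x θ v)| ≤ τ₂ * ‖v‖ ^ 2 := by
  calc |inner ℝ v (hess ρ x θ v)| ≤ ‖v‖ * ‖hess ρ x θ v‖ := abs_real_inner_le_norm _ _
    _ ≤ ‖v‖ * (τ₂ * ‖v‖) := by
        gcongr
        exact (hess ρ x θ).le_of_opNorm_le (hA.hess_bound x θ) v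
    _ = τ₂ * ‖v‖ ^ 2 := by ring

variable [IsProbabilityMeasure P]

/-- Compare both bounds on the expected Hessian along one unit vector. This makes the case τ₁ > τ₂
of the theorem vacuous and gives the contraction factors their sign. -/
lemma tau_le (hA : Assumptions P ρ Θ τ₁ τ₂ W C₁ C₂) (hτ₁ : 0 < τ₁) (hd : 0 < d) : τ₁ ≤ τ₂ := by
  set v : Vec d := EuclideanSpace.single ⟨0, hd⟩ 1
  have hv : ‖v‖ = 1 := by simp [v]
  have h1 := hA.strong_convex 0 v
  rw [← hA.integral_inner_hess hτ₁ hd, hv] at h1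
  have h2 : ∫ x, inner ℝ v (hess ρ x 0 v) ∂P ≤ ∫ _x, τ₂ ∂P :=
    integral_mono (((hA.integrable_hess hτ₁ hd 0).apply_continuousLinearMap v).const_inner v)
      (integrable_const _) fun x => by
        have := hA.inner_hess_le x 0 v
        rw [hv, one_pow, mul_one] at this
        exact le_of_abs_le this
  simp at h1 h2
  linarith

/-- The expected gradient vanishes at the target. -/
lemma popGrad_eq_zero (hA : Assumptions P ρ Θ τ₁ τ₂ W C₁ C₂) (hT : IsTarget P ρ Θ θ₀) :
    popGrad P ρ θ₀ = 0 := by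
  have hΘ : θ₀ ∈ Θ := interior_subset hT.mem_interior
  have hm := measurable_grad hA.measurable_loss hA.contDiff_loss
  have hlip : ∀ x θ, ‖grad ρ x θ‖ ≤ ‖grad ρ x θ₀‖ + τ₂ * ‖θ - θ₀‖ := fun x θ => by
    have h := Convex.norm_image_sub_le_of_norm_hasFDerivWithin_le (s := Set.univ)
      (fun y _ => (hasFDerivAt_grad (hA.contDiff_loss x) y).hasFDerivWithinAt)
      (fun y _ => hA.hess_bound x y) convex_univ (Set.mem_univ θ₀) (Set.mem_univ θ)
    have := norm_le_norm_add_norm_sub' (grad ρ x θ) (grad ρ x θ₀)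
    linarith
  have hnorm : ∀ x θ, ‖fderiv ℝ (ρ x) θ‖ = ‖grad ρ x θ‖ := fun x θ => by simp [grad, gradient]
  have hi := hA.integrable_grad θ₀ hΘ
  set T : 𝒳 → (Vec d →L[ℝ] ℝ) := fun x => fderiv ℝ (ρ x) θ₀ with hTdef
  have eT : T = fun x => (InnerProductSpace.toDual ℝ (Vec d)) (grad ρ x θ₀) := by
    ext x; simp [T, grad, gradient]
  have hTi : Integrable T P := by
    rw [eT]
    exact (InnerProductSpace.toDual ℝ (Vec d)).toContinuousLinearEquiv.toContinuousLinearMap.integrable_comp hi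
  -- Differentiation under the integral on the unit ball around θ₀: the gradient is Lipschitz with
  -- constant τ₂, so it is dominated there by its integrable value at θ₀ plus |τ₂|.
  have hder := hasFDerivAt_integral_of_dominated_of_fderiv_le (μ := P) (F := fun θ x => ρ x θ)
    (F' := fun θ x => fderiv ℝ (ρ x) θ) (x₀ := θ₀) (s := Metric.ball θ₀ 1)
    (bound := fun x => ‖grad ρ x θ₀‖ + |τ₂|) (Metric.ball_mem_nhds θ₀ one_pos)
    (Filter.Eventually.of_forall fun θ => (hA.measurable_loss θ).aestronglyMeasurable)
    (hA.integrable_loss θ₀ hΘ) hTi.aestronglyMeasurable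
    (Filter.Eventually.of_forall fun x θ hθ => by
      rw [hnorm]
      have h1 := hlip x θ
      have h2 : ‖θ - θ₀‖ ≤ 1 := by
        have := Metric.mem_ball.1 hθ
        rw [dist_eq_norm] at this
        exact this.le
      have h3 : τ₂ * ‖θ - θ₀‖ ≤ |τ₂| * 1 := by
        gcongr
        exact le_abs_self _
      linarith)
    (hi.norm.add (integrable_const _))
    (Filter.Eventually.of_forall fun x θ _ =>
      ((hA.contDiff_loss x).differentiable two_ne_zero θ).hasFDerivAt)
  have hmin : IsLocalMin (fun θ => ∫ x, ρ x θ ∂P) θ₀ := by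
    filter_upwards [mem_interior_iff_mem_nhds.1 hT.mem_interior] with θ hθ
    rcases eq_or_ne θ θ₀ with rfl | hne
    · exact le_rfl
    · exact (hT.unique_min θ hθ hne).le
  have h0 := hmin.hasFDerivAt_eq_zero hder
  have h1 : ∫ x, T x ∂P = InnerProductSpace.toDual ℝ (Vec d) (popGrad P ρ θ₀) := by
    rw [eT, popGrad]
    exact (InnerProductSpace.toDual ℝ (Vec d)).toContinuousLinearEquiv.toContinuousLinearMap.integral_comp_comm hi
  rw [h1] at h0
  simpa using h0

/-- The exponential moment of the gradient at the target. -/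
lemma lintegral_exp_grad_le (hA : Assumptions P ρ Θ τ₁ τ₂ W C₁ C₂) (hT : IsTarget P ρ Θ θ₀)
    (hC₁ : 0 < C₁) (hd : 0 < d) :
    ∫⁻ x, ENNReal.ofReal (Real.exp (‖grad ρ x θ₀‖ ^ 2 / (C₁ * √(2 * d)) ^ 2)) ∂P ≤
      ENNReal.ofReal tailConst := by
  have hΘ : θ₀ ∈ Θ := interior_subset hT.mem_interior
  have h := lintegral_exp_norm_sq_le (μ := P) hd
    (measurable_grad hA.measurable_loss hA.contDiff_loss θ₀) hC₁ (fun c t ht => ?_)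
    (fun c t ht => ?_)
  · have e : (C₁ * √(2 * d)) ^ 2 = 2 * C₁ ^ 2 * d := by
      rw [mul_pow, Real.sq_sqrt (by positivity)]; ring
    rwa [e]
  · have := hA.subGaussian_grad θ₀ hΘ (EuclideanSpace.single c 1) (by simp) t ht
    rw [hA.popGrad_eq_zero hT] at this
    simpa [EuclideanSpace.inner_single_left] using this
  · have := hA.subGaussian_grad θ₀ hΘ (-EuclideanSpace.single c 1) (by simp) t ht
    rw [hA.popGrad_eq_zero hT] at this
    simpa [EuclideanSpace.inner_single_left] using this

lemma lpBound_grad (hA : Assumptions P ρ Θ τ₁ τ₂ W C₁ C₂) (hT : IsTarget P ρ Θ θ₀)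
    (hC₁ : 0 < C₁) (hd : 0 < d) {k : ℕ} (hk : k ≠ 0) :
    LpBound P (2 * k : ℕ) (fun x => ‖grad ρ x θ₀‖) (C₁ * √(2 * d) * momentConst k) :=
  lpBound_of_lintegral_exp_sq (measurable_grad hA.measurable_loss hA.contDiff_loss θ₀).norm
    (by positivity) (hA.lintegral_exp_grad_le hT hC₁ hd) (by positivity) hk

lemma memLp_grad (hA : Assumptions P ρ Θ τ₁ τ₂ W C₁ C₂) (hT : IsTarget P ρ Θ θ₀)
    (hC₁ : 0 < C₁) (hd : 0 < d) : MemLp (fun x => grad ρ x θ₀) 2 P := by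
  have h := (hA.lpBound_grad hT hC₁ hd one_ne_zero).memLp
  rw [memLp_norm_iff
    (measurable_grad hA.measurable_loss hA.contDiff_loss θ₀).aestronglyMeasurable] at h
  exact_mod_cast h

/-- The second moment of the gradient at the target is the trace of its covariance. -/
lemma integral_norm_grad_sq (hA : Assumptions P ρ Θ τ₁ τ₂ W C₁ C₂) (hT : IsTarget P ρ Θ θ₀)
    (hC₁ : 0 < C₁) (hd : 0 < d) :
    ∫ x, ‖grad ρ x θ₀‖ ^ 2 ∂P = (gradCov P ρ θ₀).trace := by
  have hL := hA.memLp_grad hT hC₁ hd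
  have hc : ∀ c, MemLp (fun x => grad ρ x θ₀ c) 2 P := fun c =>
    (EuclideanSpace.proj (𝕜 := ℝ) c).comp_memLp' hL
  have h0 : ∀ c, ∫ x, grad ρ x θ₀ c ∂P = 0 := fun c => by
    have h1 := (EuclideanSpace.proj (𝕜 := ℝ) c).integral_comp_comm (hL.integrable (by norm_num))
    have h2 := hA.popGrad_eq_zero hT
    rw [popGrad] at h2
    rw [h2, map_zero] at h1
    exact h1
  simp only [EuclideanSpace.real_norm_sq_eq, Matrix.trace, gradCov, Matrix.diag, Matrix.of_apply]
  rw [integral_finsetSum _ fun c _ => (hc c).integrable_sq]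
  refine Finset.sum_congr rfl fun c _ => ?_
  have hae := (hc c).aestronglyMeasurable.aemeasurable
  rw [covariance_self hae, variance_of_integral_eq_zero hae (h0 c)]

lemma trace_gradCov_le (hA : Assumptions P ρ Θ τ₁ τ₂ W C₁ C₂) (hT : IsTarget P ρ Θ θ₀)
    (hC₁ : 0 < C₁) (hd : 0 < d) :
    (gradCov P ρ θ₀).trace ≤ 2 * C₁ ^ 2 * momentConst 1 ^ 2 * d := by
  have h := hA.lpBound_grad hT hC₁ hd one_ne_zero
  have h1 : LpBound P 2 (fun x => ‖grad ρ x θ₀‖) (C₁ * √(2 * d) * momentConst 1) := by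
    exact_mod_cast h
  have h2 := h1.integrable_sq_and_integral_le.2
  rw [hA.integral_norm_grad_sq hT hC₁ hd, mul_pow, mul_pow, Real.sq_sqrt (by positivity)] at h2
  linarith

end Assumptions

end Consequences

/-! ### Uniform concentration of the empirical Hessian -/

/-- A bounded subset of Euclidean space has a net of controlled cardinality. -/
lemma exists_net {d : ℕ} (T : Set (Vec d)) (c : Vec d) {r δ : ℝ} (hr : 0 ≤ r)
    (hT : ∀ u ∈ T, ‖u - c‖ ≤ r) (hδ : 0 < δ) :
    ∃ F : Finset (Vec d), (∀ f ∈ F, f ∈ T) ∧ (F.card : ℝ) ≤ (2 * r / δ + 2) ^ d ∧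
      ∀ u ∈ T, ∃ f ∈ F, ‖u - f‖ ≤ δ * √d := by
  classical
  -- Each point is sent to the index of its cell in the cubic grid of side δ; two points in one cell
  -- differ by at most δ in each coordinate, hence by at most δ√d in norm.
  set φ : Vec d → Fin d → ℤ := fun u i => ⌊(u - c) i / δ⌋ with hφ
  set cells : Finset (Fin d → ℤ) :=
    Fintype.piFinset fun _ : Fin d => Finset.Icc ⌊-(r / δ)⌋ ⌊r / δ⌋ with hcells
  have hcard : (cells.card : ℝ) ≤ (2 * r / δ + 2) ^ d := by
    rw [hcells, Fintype.card_piFinset]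
    simp only [Int.card_Icc, Finset.prod_const, Finset.card_univ, Fintype.card_fin, Nat.cast_pow]
    refine pow_le_pow_left₀ (by positivity) ?_ d
    have h1 : (⌊r / δ⌋ : ℝ) ≤ r / δ := Int.floor_le _
    have h2 : -(r / δ) < ⌊-(r / δ)⌋ + 1 := Int.lt_floor_add_one _
    have h3 : ⌊-(r / δ)⌋ ≤ ⌊r / δ⌋ := Int.floor_le_floor (by
      have : 0 ≤ r / δ := by positivity
      linarith)
    have h4 : (((⌊r / δ⌋ + 1 - ⌊-(r / δ)⌋).toNat : ℤ) : ℝ) =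
        ((⌊r / δ⌋ + 1 - ⌊-(r / δ)⌋ : ℤ) : ℝ) := by
      rw [Int.toNat_of_nonneg (by omega)]
    rw [Int.cast_natCast] at h4
    rw [h4]
    push_cast
    have h5 : 2 * r / δ = r / δ + r / δ := by ring
    rw [h5]
    linarith
  have hmem : ∀ u ∈ T, φ u ∈ cells := by
    intro u hu
    rw [hcells, Fintype.mem_piFinset]
    intro i
    have h1 : |(u - c) i| ≤ r := by
      rw [← Real.norm_eq_abs]
      exact (PiLp.norm_apply_le (u - c) i).trans (hT u hu)
    have h2 := abs_le.1 h1
    rw [Finset.mem_Icc]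
    constructor
    · refine Int.floor_le_floor ?_
      rw [← neg_div]
      gcongr
      exact h2.1
    · refine Int.floor_le_floor ?_
      gcongr
      exact h2.2
  -- One representative from T is chosen per occupied cell. The net thus lies inside T, so that the
  -- net of the sphere consists of unit vectors.
  refine ⟨(cells.filter (· ∈ φ '' T)).image (Function.invFunOn φ T), ?_, ?_, ?_⟩
  · intro f hf
    obtain ⟨k, hk, rfl⟩ := Finset.mem_image.1 hf
    exact Function.invFunOn_mem (Finset.mem_filter.1 hk).2
  · refine le_trans ?_ hcard
    exact_mod_cast Finset.card_image_le.trans (Finset.card_filter_le _ _)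
  · intro u hu
    refine ⟨Function.invFunOn φ T (φ u), Finset.mem_image_of_mem _
      (Finset.mem_filter.2 ⟨hmem u hu, u, hu, rfl⟩), ?_⟩
    set f := Function.invFunOn φ T (φ u) with hf
    have hfu : φ f = φ u := Function.invFunOn_eq ⟨u, hu, rfl⟩
    have h1 : ∀ i, |(u - f) i| ≤ δ := by
      intro i
      have h2 : ⌊(f - c) i / δ⌋ = ⌊(u - c) i / δ⌋ := congrFun hfu i
      have h3 := Int.abs_sub_lt_one_of_floor_eq_floor h2
      rw [← sub_div, abs_div, abs_of_pos hδ, div_lt_one hδ] at h3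
      have e : (u - f) i = -((f - c) i - (u - c) i) := by simp
      rw [e, abs_neg]
      exact h3.le
    rw [EuclideanSpace.norm_eq, ← Real.sqrt_sq hδ.le, ← Real.sqrt_mul (sq_nonneg δ)]
    refine Real.sqrt_le_sqrt ?_
    calc ∑ i, ‖(u - f) i‖ ^ 2 ≤ ∑ _i : Fin d, δ ^ 2 :=
          Finset.sum_le_sum fun i _ => pow_le_pow_left₀ (norm_nonneg _) (h1 i) 2
      _ = δ ^ 2 * d := by simp [mul_comm]

section Concentration

variable {d : ℕ} {𝒳 : Type u} [MeasurableSpace 𝒳] {P : Measure 𝒳}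
  {ρ : 𝒳 → Vec d → ℝ} {Θ : Set (Vec d)} {θ₀ : Vec d} {τ₁ τ₂ W C₁ C₂ : ℝ}

namespace Assumptions

/-- This transfers bounds on the Hessian form from a net to all points and directions: the Lipschitz
condition pays for moving θ, and the operator bound pays twice for moving the unit vector. -/
lemma hess_form_sub_le (hA : Assumptions P ρ Θ τ₁ τ₂ W C₁ C₂) (x : 𝒳) (θ θ' : Vec d)
    {v v' : Vec d} (hv : ‖v‖ = 1) (hv' : ‖v'‖ = 1) :
    inner ℝ v' (hess ρ x θ' v') - inner ℝ v (hess ρ x θ v) ≤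
      W * ‖θ - θ'‖ + 2 * τ₂ * ‖v - v'‖ := by
  have e : inner ℝ v' (hess ρ x θ' v') - inner ℝ v (hess ρ x θ v) =
      inner ℝ v' ((hess ρ x θ' - hess ρ x θ) v') + inner ℝ (v' - v) (hess ρ x θ v') +
        inner ℝ v (hess ρ x θ (v' - v)) := by
    simp only [sub_apply, map_sub, inner_sub_left, inner_sub_right]
    ring
  have h1 : inner ℝ v' ((hess ρ x θ' - hess ρ x θ) v') ≤ W * ‖θ - θ'‖ := by
    calc _ ≤ ‖v'‖ * ‖(hess ρ x θ' - hess ρ x θ) v'‖ := real_inner_le_norm _ _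
      _ ≤ ‖v'‖ * (‖hess ρ x θ' - hess ρ x θ‖ * ‖v'‖) := by
          gcongr
          exact ContinuousLinearMap.le_opNorm _ _
      _ = ‖hess ρ x θ' - hess ρ x θ‖ := by rw [hv']; ring
      _ ≤ W * ‖θ - θ'‖ := by
          rw [norm_sub_rev θ θ']
          exact hA.hess_lipschitz x θ' θ
  have h2 : inner ℝ (v' - v) (hess ρ x θ v') ≤ ‖v - v'‖ * τ₂ := by
    calc _ ≤ ‖v' - v‖ * ‖hess ρ x θ v'‖ := real_inner_le_norm _ _
      _ ≤ ‖v' - v‖ * (τ₂ * ‖v'‖) := by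
          gcongr
          exact (hess ρ x θ).le_of_opNorm_le (hA.hess_bound x θ) _
      _ = _ := by rw [hv', norm_sub_rev]; ring
  have h3 : inner ℝ v (hess ρ x θ (v' - v)) ≤ ‖v - v'‖ * τ₂ := by
    calc _ ≤ ‖v‖ * ‖hess ρ x θ (v' - v)‖ := real_inner_le_norm _ _
      _ ≤ ‖v‖ * (τ₂ * ‖v' - v‖) := by
          gcongr
          exact (hess ρ x θ).le_of_opNorm_le (hA.hess_bound x θ) _
      _ = _ := by rw [hv, norm_sub_rev]; ring
  rw [e]
  linarith

variable [IsProbabilityMeasure P]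

/-- Hoeffding's inequality for the quadratic form of the empirical Hessian. -/
lemma meas_hess_form_le (hA : Assumptions P ρ Θ τ₁ τ₂ W C₁ C₂) (hτ₁ : 0 < τ₁) (hd : 0 < d)
    (n : ℕ) {ε : ℝ} (hε : 0 < ε) (θ : Vec d) {v : Vec d} (hv : ‖v‖ = 1) :
    Measure.pi (fun _ : Fin n => P) {x | n * ε ≤ ∑ j, (-inner ℝ v (hess ρ (x j) θ v) -
        ∫ y, -inner ℝ v (hess ρ y θ v) ∂P)} ≤
      ENNReal.ofReal (Real.exp (-(n * (ε ^ 2 / (2 * τ₂ ^ 2))))) := by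
  have hτ₂ : 0 < τ₂ := hτ₁.trans_le (hA.tau_le hτ₁ hd)
  have hm := (measurable_inner_hess hA.measurable_loss hA.contDiff_loss θ v).neg
  have hb : ∀ y, -inner ℝ v (hess ρ y θ v) ∈ Set.Icc (-τ₂) τ₂ := fun y => by
    have h := abs_le.1 (hA.inner_hess_le y θ v)
    rw [hv, one_pow, mul_one] at h
    exact ⟨by linarith [h.2], by linarith [h.1]⟩
  -- The form takes values in [-τ₂, τ₂] on unit vectors, so Hoeffding's lemma gives variance proxy
  -- τ₂².
  have hs := hasSubgaussianMGF_of_mem_Icc (μ := P) hm.aemeasurable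
    (Filter.Eventually.of_forall hb)
  have hind := iIndepFun_pi (μ := fun _ : Fin n => P)
    (X := fun _ y => -inner ℝ v (hess ρ y θ v) - ∫ y, -inner ℝ v (hess ρ y θ v) ∂P)
    fun _ => (hm.sub_const _).aemeasurable
  have h := HasSubgaussianMGF.measure_sum_ge_le_of_iIndepFun hind (s := Finset.univ)
    (c := fun _ => (‖τ₂ - -τ₂‖₊ / 2) ^ 2) (fun j _ => by
      have hp := measurePreserving_eval (fun _ : Fin n => P) j
      exact HasSubgaussianMGF.of_map (Y := fun x : Fin n → 𝒳 => x j)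
        hp.measurable.aemeasurable (by rw [hp.map_eq]; exact hs))
    (ε := n * ε) (by positivity)
  rw [← ofReal_measureReal]
  refine ENNReal.ofReal_le_ofReal (h.trans (le_of_eq ?_))
  congr 1
  have e : ((‖τ₂ - -τ₂‖₊ : NNReal) : ℝ) = 2 * τ₂ := by
    rw [coe_nnnorm, Real.norm_eq_abs, abs_of_nonneg (by linarith)]; ring
  simp only [Finset.sum_const, Finset.card_univ, Fintype.card_fin, nsmul_eq_mul, NNReal.coe_mul,
    NNReal.coe_natCast, NNReal.coe_pow, NNReal.coe_div, e, NNReal.coe_ofNat]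
  rcases Nat.eq_zero_or_pos n with rfl | hn
  · simp
  · field_simp

/-- Outside an event of exponentially small probability, the empirical Hessian is bounded below on
a ball. -/
lemma exists_hess_lower (hA : Assumptions P ρ Θ τ₁ τ₂ W C₁ C₂) (hτ₁ : 0 < τ₁) (hW : 0 < W)
    (hd : 0 < d) {n : ℕ} (hn : 0 < n) (θ₀ : Vec d) {r ε : ℝ} (hr : 0 ≤ r) (hε : 0 < ε) :
    ∃ B : Set (Fin n → 𝒳), MeasurableSet B ∧
      Measure.pi (fun _ : Fin n => P) B ≤ ENNReal.ofReal
        ((4 * r * W * √d / ε + 2) ^ d * (8 * τ₂ * √d / ε + 2) ^ d *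
          Real.exp (-(n * (ε ^ 2 / (2 * τ₂ ^ 2))))) ∧
      ∀ x ∉ B, ∀ θ, ‖θ - θ₀‖ ≤ r → ∀ v : Vec d,
        (τ₁ - 2 * ε) * ‖v‖ ^ 2 ≤ (n : ℝ)⁻¹ * ∑ j, inner ℝ v (hess ρ (x j) θ v) := by
  have hτ₂ : 0 < τ₂ := hτ₁.trans_le (hA.tau_le hτ₁ hd)
  have hd' : (0 : ℝ) < d := by exact_mod_cast hd
  have hn' : (0 : ℝ) < n := by exact_mod_cast hn
  have hsd : 0 < √(d : ℝ) := Real.sqrt_pos.2 hd'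
  -- The two meshes are chosen so that replacing θ and the unit vector by net points costs ε/2 each.
  -- With the deviation ε allowed on the net, the total loss is 2ε.
  obtain ⟨F, hF, hFc, hFn⟩ := exists_net (Metric.closedBall θ₀ r) θ₀ hr
    (fun u hu => by simpa [dist_eq_norm] using hu) (δ := ε / (2 * W * √d)) (by positivity)
  obtain ⟨V, hV, hVc, hVn⟩ := exists_net (Metric.sphere (0 : Vec d) 1) 0 zero_le_one
    (fun u hu => by simp at hu; simp [hu]) (δ := ε / (4 * τ₂ * √d)) (by positivity)
  set S : Vec d → Vec d → Set (Fin n → 𝒳) := fun θ v =>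
    {x | n * ε ≤ ∑ j, (-inner ℝ v (hess ρ (x j) θ v) - ∫ y, -inner ℝ v (hess ρ y θ v) ∂P)} with hS
  have hSm : ∀ θ v, MeasurableSet (S θ v) := fun θ v => by
    refine measurableSet_le measurable_const (Finset.measurable_sum _ fun j _ => ?_)
    exact ((measurable_inner_hess hA.measurable_loss hA.contDiff_loss θ v).comp
      (measurable_pi_apply j)).neg.sub_const _
  refine ⟨⋃ θ ∈ F, ⋃ v ∈ V, S θ v, ?_, ?_, ?_⟩
  · exact F.measurableSet_biUnion fun θ _ => V.measurableSet_biUnion fun v _ => hSm θ v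
  · have hv1 : ∀ v ∈ V, ‖v‖ = 1 := fun v hv => by simpa using hV v hv
    set e := Real.exp (-(n * (ε ^ 2 / (2 * τ₂ ^ 2)))) with he
    calc _ ≤ ∑ θ ∈ F, ∑ v ∈ V, Measure.pi (fun _ : Fin n => P) (S θ v) :=
          (measure_biUnion_finset_le F _).trans
            (Finset.sum_le_sum fun θ _ => measure_biUnion_finset_le V _)
      _ ≤ ∑ θ ∈ F, ∑ v ∈ V, ENNReal.ofReal e :=
          Finset.sum_le_sum fun θ _ => Finset.sum_le_sum fun v hv =>
            hA.meas_hess_form_le hτ₁ hd n hε θ (hv1 v hv)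
      _ = ENNReal.ofReal (F.card * (V.card * e)) := by
          rw [Finset.sum_const, Finset.sum_const, nsmul_eq_mul, nsmul_eq_mul,
            ENNReal.ofReal_mul (by positivity), ENNReal.ofReal_mul (by positivity),
            ENNReal.ofReal_natCast, ENNReal.ofReal_natCast]
      _ ≤ _ := by
          refine ENNReal.ofReal_le_ofReal ?_
          rw [← mul_assoc]
          have e1 : 2 * r / (ε / (2 * W * √d)) = 4 * r * W * √d / ε := by field_simp; ring
          have e2 : 2 * 1 / (ε / (4 * τ₂ * √d)) = 8 * τ₂ * √d / ε := by field_simp; ring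
          rw [e1] at hFc
          rw [e2] at hVc
          gcongr
  · intro x hx θ hθ v
    have key : ∀ u : Vec d, ‖u‖ = 1 →
        τ₁ - 2 * ε ≤ (n : ℝ)⁻¹ * ∑ j, inner ℝ u (hess ρ (x j) θ u) := by
      intro u hu
      obtain ⟨θ', hθ', hθd⟩ := hFn θ (by simpa [dist_eq_norm] using hθ)
      obtain ⟨u', hu', hud⟩ := hVn u (by simpa using hu)
      have hu1 : ‖u'‖ = 1 := by simpa using hV u' hu'
      have hx' : x ∉ S θ' u' := fun h => hx (by
        simp only [Set.mem_iUnion]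
        exact ⟨θ', hθ', u', hu', h⟩)
      have h1 : ∑ j, (-inner ℝ u' (hess ρ (x j) θ' u') -
          ∫ y, -inner ℝ u' (hess ρ y θ' u') ∂P) < n * ε := not_le.1 hx'
      rw [integral_neg, hA.integral_inner_hess hτ₁ hd, Finset.sum_sub_distrib,
        Finset.sum_neg_distrib, Finset.sum_const, Finset.card_univ, Fintype.card_fin,
        nsmul_eq_mul] at h1
      have h2 := hA.strong_convex θ' u'
      rw [hu1, one_pow, mul_one] at h2
      have h3 : ∀ j, inner ℝ u' (hess ρ (x j) θ' u') - ε ≤ inner ℝ u (hess ρ (x j) θ u) := by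
        intro j
        have h := hA.hess_form_sub_le (x j) θ θ' hu hu1
        have h4 : W * ‖θ - θ'‖ ≤ ε / 2 := by
          calc W * ‖θ - θ'‖ ≤ W * (ε / (2 * W * √d) * √d) := by gcongr
            _ = ε / 2 := by field_simp
        have h5 : 2 * τ₂ * ‖u - u'‖ ≤ ε / 2 := by
          calc 2 * τ₂ * ‖u - u'‖ ≤ 2 * τ₂ * (ε / (4 * τ₂ * √d) * √d) := by gcongr
            _ = ε / 2 := by field_simp; ring
        linarith
      have h4 := Finset.sum_le_sum fun j (_ : j ∈ Finset.univ) => h3 j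
      rw [Finset.sum_sub_distrib, Finset.sum_const, Finset.card_univ, Fintype.card_fin,
        nsmul_eq_mul] at h4
      rw [inv_mul_eq_div, le_div_iff₀ hn']
      have h5 := mul_le_mul_of_nonneg_left h2 hn'.le
      linarith
    rcases eq_or_ne v 0 with rfl | hv
    · simp
    · have hv0 : 0 < ‖v‖ := norm_pos_iff.2 hv
      have h1 := key (‖v‖⁻¹ • v) (by rw [norm_smul, norm_inv, norm_norm, inv_mul_cancel₀ hv0.ne'])
      simp only [map_smul, inner_smul_left, inner_smul_right, conj_trivial, ← Finset.mul_sum] at h1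
      have e : (n : ℝ)⁻¹ * (‖v‖⁻¹ * (‖v‖⁻¹ * ∑ j, inner ℝ v (hess ρ (x j) θ v))) =
          ((n : ℝ)⁻¹ * ∑ j, inner ℝ v (hess ρ (x j) θ v)) / ‖v‖ ^ 2 := by
        field_simp
      rw [e, le_div_iff₀ (by positivity)] at h1
      exact h1

end Assumptions

end Concentration

/-! ### Standard Gaussian vectors -/

section Gaussian

variable {d : ℕ}

lemma measurePreserving_stdGaussian_apply (c : Fin d) :
    MeasurePreserving (fun z : Vec d => z c) (stdGaussian (Vec d)) (gaussianReal 0 1) := by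
  refine ⟨by fun_prop, ?_⟩
  rw [← map_pi_eq_stdGaussian, Measure.map_map (by fun_prop) (by fun_prop)]
  exact (measurePreserving_eval (fun _ : Fin d => gaussianReal 0 1) c).map_eq

lemma hasSubgaussianMGF_stdGaussian_apply (c : Fin d) :
    HasSubgaussianMGF (fun z : Vec d => z c) 1 (stdGaussian (Vec d)) := by
  have h : HasSubgaussianMGF id 1 (gaussianReal 0 1) :=
    ⟨fun t => integrable_exp_mul_gaussianReal t, fun t => by
      rw [mgf_gaussianReal (μ := 0) (v := 1) (by simp)]
      simp⟩
  have hp := measurePreserving_stdGaussian_apply c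
  exact HasSubgaussianMGF.of_map (X := id) hp.measurable.aemeasurable (by rwa [hp.map_eq])

lemma memLp_stdGaussian : MemLp (fun z : Vec d => z) 2 (stdGaussian (Vec d)) :=
  IsGaussian.memLp_two_id

lemma integral_norm_sq_stdGaussian : ∫ z, ‖z‖ ^ 2 ∂stdGaussian (Vec d) = d := by
  have hc : ∀ c : Fin d, MemLp (fun z : Vec d => z c) 2 (stdGaussian (Vec d)) := fun c =>
    (hasSubgaussianMGF_stdGaussian_apply c).memLp 2
  have h1 : ∀ c : Fin d, ∫ z, (z c) ^ 2 ∂stdGaussian (Vec d) = 1 := fun c => by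
    have hp := measurePreserving_stdGaussian_apply c
    have h2 := integral_map (μ := stdGaussian (Vec d)) hp.measurable.aemeasurable
      (f := fun y : ℝ => y ^ 2) (by fun_prop)
    rw [hp.map_eq] at h2
    rw [← h2]
    have h3 := variance_of_integral_eq_zero (X := fun y : ℝ => y) (μ := gaussianReal 0 1)
      aemeasurable_id integral_id_gaussianReal
    rw [← h3]
    simp
  simp only [EuclideanSpace.real_norm_sq_eq]
  rw [integral_finsetSum _ fun c _ => (hc c).integrable_sq]
  simp [h1]

lemma tail_of_hasSubgaussianMGF {Ω : Type*} [MeasurableSpace Ω] {μ : Measure Ω} {Y : Ω → ℝ}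
    {c : NNReal} (h : HasSubgaussianMGF Y c μ) (t : ℝ) (ht : 0 ≤ t) :
    μ.real {x | t ≤ Y x} ≤ Real.exp (-t ^ 2 / (√(2 * c)) ^ 2) ∧
      μ.real {x | t ≤ -Y x} ≤ Real.exp (-t ^ 2 / (√(2 * c)) ^ 2) := by
  rw [Real.sq_sqrt (by positivity)]
  exact ⟨h.measure_ge_le ht, h.neg.measure_ge_le ht⟩

/-- The exponential moment of a vector with sub-Gaussian coordinates of variance proxy `c`. -/
lemma lintegral_exp_norm_sq_le_of_hasSubgaussianMGF {Ω : Type*} [MeasurableSpace Ω]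
    {μ : Measure Ω} [IsProbabilityMeasure μ] (hd : 0 < d) {G : Ω → Vec d} (hG : Measurable G)
    {c : NNReal} (hc : 0 < c) (h : ∀ i, HasSubgaussianMGF (fun x => G x i) c μ) :
    ∫⁻ x, ENNReal.ofReal (Real.exp (‖G x‖ ^ 2 / (√(4 * c * d)) ^ 2)) ∂μ ≤
      ENNReal.ofReal tailConst := by
  have hc' : (0 : ℝ) < c := hc
  have h1 := lintegral_exp_norm_sq_le (μ := μ) hd hG (C := √(2 * c)) (by positivity)
    (fun i t ht => (tail_of_hasSubgaussianMGF (h i) t ht).1)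
    (fun i t ht => (tail_of_hasSubgaussianMGF (h i) t ht).2)
  have e : 2 * (√(2 * (c : ℝ))) ^ 2 * d = (√(4 * c * d)) ^ 2 := by
    rw [Real.sq_sqrt (by positivity), Real.sq_sqrt (by positivity)]; ring
  rwa [e] at h1

lemma lintegral_exp_stdGaussian_le (hd : 0 < d) :
    ∫⁻ z : Vec d, ENNReal.ofReal (Real.exp (‖z‖ ^ 2 / (√(4 * d)) ^ 2)) ∂stdGaussian (Vec d) ≤
      ENNReal.ofReal tailConst := by
  have := lintegral_exp_norm_sq_le_of_hasSubgaussianMGF (μ := stdGaussian (Vec d)) hd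
    (G := fun z => z) measurable_id one_pos hasSubgaussianMGF_stdGaussian_apply
  simpa using this

lemma lpBound_stdGaussian (hd : 0 < d) {k : ℕ} (hk : k ≠ 0) :
    LpBound (stdGaussian (Vec d)) (2 * k : ℕ) (fun z => ‖z‖) (√(4 * d) * momentConst k) :=
  lpBound_of_lintegral_exp_sq measurable_norm (Real.sqrt_nonneg _)
    (lintegral_exp_stdGaussian_le hd) (by positivity) hk

end Gaussian

/-! ### Averaged gradients -/

section Average

variable {E : Type*} [NormedAddCommGroup E] [InnerProductSpace ℝ E]

/-- Closure under convex combinations lets the descent lemmas apply unchanged to the empirical field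
of one client and to the weighted field of the server. -/
lemma RegularField.sum_smul {ι : Type*} {s : Finset ι} {g : ι → E → E} {H : ι → E → E →L[ℝ] E}
    {τ₂ : ℝ} (h : ∀ i ∈ s, RegularField (g i) (H i) τ₂) {w : ι → ℝ} (hw : ∀ i ∈ s, 0 ≤ w i)
    (hw1 : ∑ i ∈ s, w i = 1) :
    RegularField (fun θ => ∑ i ∈ s, w i • g i θ) (fun θ => ∑ i ∈ s, w i • H i θ) τ₂ where
  deriv θ := HasFDerivAt.fun_sum fun i hi => ((h i hi).deriv θ).const_smul (w i)
  symm θ v v' := by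
    simp only [ContinuousLinearMap.coe_coe, sum_apply, smul_apply,
      sum_inner, inner_sum, inner_smul_left, inner_smul_right,
      conj_trivial]
    refine Finset.sum_congr rfl fun i hi => ?_
    have := (h i hi).symm θ v v'
    simp only [ContinuousLinearMap.coe_coe] at this
    rw [this]
  bound θ := by
    calc ‖∑ i ∈ s, w i • H i θ‖ ≤ ∑ i ∈ s, w i * τ₂ := norm_sum_le_of_le s fun i hi => by
          rw [norm_smul, Real.norm_of_nonneg (hw i hi)]
          exact mul_le_mul_of_nonneg_left ((h i hi).bound θ) (hw i hi)
      _ = τ₂ := by rw [← Finset.sum_mul, hw1, one_mul]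

variable {d : ℕ} {𝒳 : Type u} {ρ : 𝒳 → Vec d → ℝ}

/-- The average Hessian `(1/k) ∑ⱼ ∇²ρ(xⱼ, θ)` of a data set of size `k`. -/
noncomputable def avgHess (ρ : 𝒳 → Vec d → ℝ) {k : ℕ} (x : Fin k → 𝒳) (θ : Vec d) :
    Vec d →L[ℝ] Vec d :=
  (k : ℝ)⁻¹ • ∑ j, hess ρ (x j) θ

lemma inner_avgHess {k : ℕ} (x : Fin k → 𝒳) (θ v : Vec d) :
    inner ℝ v (avgHess ρ x θ v) = (k : ℝ)⁻¹ * ∑ j, inner ℝ v (hess ρ (x j) θ v) := by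
  simp [avgHess, inner_smul_right, inner_sum]

lemma norm_avgGrad_le {n : ℕ} (x : Fin n → 𝒳) (θ : Vec d) :
    ‖avgGrad ρ x θ‖ ≤ (n : ℝ)⁻¹ * ∑ j, ‖grad ρ (x j) θ‖ := by
  rw [avgGrad, norm_smul, norm_inv, RCLike.norm_natCast]
  gcongr
  exact norm_sum_le _ _

variable [MeasurableSpace 𝒳] {P : Measure 𝒳} {Θ : Set (Vec d)} {τ₁ τ₂ W C₁ C₂ : ℝ}

lemma Assumptions.regularField_avgGrad (hA : Assumptions P ρ Θ τ₁ τ₂ W C₁ C₂) {k : ℕ}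
    (hk : 0 < k) (x : Fin k → 𝒳) : RegularField (avgGrad ρ x) (avgHess ρ x) τ₂ := by
  have hk' : (k : ℝ) ≠ 0 := by exact_mod_cast hk.ne'
  have h := RegularField.sum_smul (s := Finset.univ) (g := fun j => grad ρ (x j))
    (H := fun j => hess ρ (x j)) (τ₂ := τ₂) (w := fun _ => (k : ℝ)⁻¹)
    (fun j _ => ⟨hasFDerivAt_grad (hA.contDiff_loss _), hess_isSymmetric (hA.contDiff_loss _),
      hA.hess_bound _⟩) (fun _ _ => by positivity) (by simp [hk'])
  simp only [← Finset.smul_sum] at h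
  exact h

lemma Assumptions.measurable_avgGrad (hA : Assumptions P ρ Θ τ₁ τ₂ W C₁ C₂) {k : ℕ} {Ω : Type*}
    [MeasurableSpace Ω] {f : Ω → Fin k → 𝒳} (hf : Measurable f) {g : Ω → Vec d}
    (hg : Measurable g) : Measurable fun ω => avgGrad ρ (f ω) (g ω) := by
  have h1 : ∀ j, Measurable fun ω => grad ρ (f ω j) (g ω) := fun j =>
    (measurable_grad_uncurry hA.measurable_loss hA.contDiff_loss).comp
      ((measurable_pi_iff.1 hf j).prodMk hg)
  exact (Finset.measurable_sum _ fun j _ => h1 j).const_smul (k : ℝ)⁻¹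

lemma Assumptions.measurable_localGD (hA : Assumptions P ρ Θ τ₁ τ₂ W C₁ C₂) {k : ℕ} {Ω : Type*}
    [MeasurableSpace Ω] {f : Ω → Fin k → 𝒳} (hf : Measurable f) {z : Ω → ℕ → Vec d}
    (hz : Measurable z) (η a : ℝ) (K : ℕ) :
    Measurable fun ω => localGD ρ (f ω) η a (z ω) K := by
  induction K with
  | zero => exact measurable_const
  | succ K ih =>
    have h1 : Measurable fun ω => localGD ρ (f ω) η a (z ω) K -
        η • avgGrad ρ (f ω) (localGD ρ (f ω) η a (z ω) K) :=
      ih.sub ((hA.measurable_avgGrad hf ih).const_smul η)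
    have h2 : Measurable fun ω => a • z ω K := (measurable_pi_iff.1 hz K).const_smul a
    have h3 := h1.add h2
    exact h3

lemma Assumptions.measurable_fedSGD (hA : Assumptions P ρ Θ τ₁ τ₂ W C₁ C₂) {m : ℕ} {n : Fin m → ℕ}
    {Ω : Type*} [MeasurableSpace Ω] {f : Ω → ∀ i, Fin (n i) → 𝒳} (hf : Measurable f)
    {z : Ω → Fin m → ℕ → Vec d} (hz : Measurable z) {init : Ω → Vec d} (hi : Measurable init)
    (η : ℝ) (w σ : Fin m → ℝ) (K : ℕ) :
    Measurable fun ω => fedSGD ρ (f ω) η w σ (z ω) (init ω) K := by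
  induction K with
  | zero => exact hi
  | succ K ih =>
    have h1 : ∀ i, Measurable fun ω => avgGrad ρ (f ω i)
        (fedSGD ρ (f ω) η w σ (z ω) (init ω) K) + σ i • z ω i K := fun i =>
      (hA.measurable_avgGrad (measurable_pi_iff.1 hf i) ih).add
        ((measurable_pi_iff.1 (measurable_pi_iff.1 hz i) K).const_smul (σ i))
    have h2 := (Finset.measurable_sum Finset.univ fun i _ => (h1 i).const_smul (w i)).const_smul η
    exact ih.sub h2

end Average

/-! ### The law of one client -/

section Client

variable {d : ℕ} {𝒳 : Type u} [MeasurableSpace 𝒳]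

/-- The law of the data and the noise of one client. -/
noncomputable def clientLaw (P : Measure 𝒳) [IsProbabilityMeasure P] (d n : ℕ) :
    Measure ((Fin n → 𝒳) × (ℕ → Vec d)) :=
  (Measure.pi fun _ : Fin n => P).prod (Measure.infinitePi fun _ : ℕ => stdGaussian (Vec d))

variable (P : Measure 𝒳) [IsProbabilityMeasure P] (d n : ℕ)

instance : IsProbabilityMeasure (clientLaw P d n) := by
  unfold clientLaw; infer_instance

lemma measurePreserving_clientLaw_fst :
    MeasurePreserving (fun ω : (Fin n → 𝒳) × (ℕ → Vec d) => ω.1) (clientLaw P d n)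
      (Measure.pi fun _ : Fin n => P) :=
  measurePreserving_fst

lemma measurePreserving_clientLaw_data (j : Fin n) :
    MeasurePreserving (fun ω : (Fin n → 𝒳) × (ℕ → Vec d) => ω.1 j) (clientLaw P d n) P :=
  (measurePreserving_eval (fun _ : Fin n => P) j).comp (measurePreserving_clientLaw_fst P d n)

lemma measurePreserving_clientLaw_noise (t : ℕ) :
    MeasurePreserving (fun ω : (Fin n → 𝒳) × (ℕ → Vec d) => ω.2 t) (clientLaw P d n)
      (stdGaussian (Vec d)) :=
  (measurePreserving_eval_infinitePi (fun _ : ℕ => stdGaussian (Vec d)) t).comp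
    measurePreserving_snd

variable {P d n} {ρ : 𝒳 → Vec d → ℝ} {Θ : Set (Vec d)} {θ₀ : Vec d} {τ₁ τ₂ W C₁ C₂ : ℝ}

lemma Assumptions.lpBound_avgGrad (hA : Assumptions P ρ Θ τ₁ τ₂ W C₁ C₂)
    (hT : IsTarget P ρ Θ θ₀) (hC₁ : 0 < C₁) (hd : 0 < d) (hn : 0 < n) {k : ℕ} (hk : k ≠ 0) :
    LpBound (clientLaw P d n) (2 * k : ℕ) (fun ω => ‖avgGrad ρ ω.1 θ₀‖)
      (C₁ * √(2 * d) * momentConst k) := by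
  have hn' : (n : ℝ) ≠ 0 := by exact_mod_cast hn.ne'
  have h1 := (LpBound.sum (μ := clientLaw P d n) (p := (2 * k : ℕ))
    (by exact_mod_cast (show 1 ≤ 2 * k by omega)) (Finset.univ : Finset (Fin n))
    (f := fun j ω => ‖grad ρ (ω.1 j) θ₀‖) (a := fun _ => C₁ * √(2 * d) * momentConst k)
    fun j _ => (hA.lpBound_grad hT hC₁ hd hk).comp
      (measurePreserving_clientLaw_data P d n j)).const_mul (c := (n : ℝ)⁻¹) (by positivity)
  have e : (n : ℝ)⁻¹ * ∑ _j : Fin n, C₁ * √(2 * d) * momentConst k =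
      C₁ * √(2 * d) * momentConst k := by
    rw [Finset.sum_const, Finset.card_univ, Fintype.card_fin, nsmul_eq_mul,
      inv_mul_cancel_left₀ hn']
  rw [e] at h1
  refine h1.mono (hA.measurable_avgGrad measurable_fst measurable_const).norm.aestronglyMeasurable
    fun ω => ?_
  rw [abs_norm]
  exact norm_avgGrad_le ω.1 θ₀

/-- The second moment of the averaged gradient at the target. -/
lemma Assumptions.integral_avgGrad_sq (hA : Assumptions P ρ Θ τ₁ τ₂ W C₁ C₂)
    (hT : IsTarget P ρ Θ θ₀) (hC₁ : 0 < C₁) (hd : 0 < d) (hn : 0 < n) :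
    MemLp (fun x : Fin n → 𝒳 => avgGrad ρ x θ₀) 2 (Measure.pi fun _ => P) ∧
      ∫ x : Fin n → 𝒳, avgGrad ρ x θ₀ ∂(Measure.pi fun _ => P) = 0 ∧
      ∫ x : Fin n → 𝒳, ‖avgGrad ρ x θ₀‖ ^ 2 ∂(Measure.pi fun _ => P) =
        (gradCov P ρ θ₀).trace / n := by
  have hL := hA.memLp_grad hT hC₁ hd
  have h0 : ∫ x, grad ρ x θ₀ ∂P = 0 := hA.popGrad_eq_zero hT
  have hn' : (n : ℝ) ≠ 0 := by exact_mod_cast hn.ne'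
  have hj : ∀ j : Fin n, MemLp (fun x : Fin n → 𝒳 => grad ρ (x j) θ₀) 2 (Measure.pi fun _ => P) :=
    fun j => hL.comp_measurePreserving (measurePreserving_eval (fun _ : Fin n => P) j)
  refine ⟨?_, ?_, ?_⟩
  · exact (memLp_finsetSum _ fun j _ => hj j).const_smul (n : ℝ)⁻¹
  · simp only [avgGrad]
    rw [integral_smul, integral_finsetSum _ fun j _ => (hj j).integrable (by norm_num)]
    refine smul_eq_zero_of_right _ (Finset.sum_eq_zero fun j _ => ?_)
    have hp := measurePreserving_eval (fun _ : Fin n => P) j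
    have h1 := integral_map (μ := Measure.pi fun _ : Fin n => P) hp.measurable.aemeasurable
      (f := fun y => grad ρ y θ₀) (by rw [hp.map_eq]; exact hL.aestronglyMeasurable)
    rw [hp.map_eq, h0] at h1
    exact h1.symm
  · have h1 := (pi_integral_norm_sq_sum (κ := fun _ : Fin n => P)
      (f := fun _ x => grad ρ x θ₀) (fun _ => hL) fun _ => h0).2
    simp only [avgGrad, norm_smul, mul_pow, norm_inv, RCLike.norm_natCast]
    rw [integral_const_mul, h1, hA.integral_norm_grad_sq hT hC₁ hd, Finset.sum_const,
      Finset.card_univ, Fintype.card_fin, nsmul_eq_mul]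
    field_simp

end Client

/-! ### Elementary asymptotics -/

/-- Exponential decay beats powers. The bound is asked for all x beyond A because it is later
applied at a sample size, or a sample size per dimension, known only to exceed A. -/
lemma eventually_pow_mul_exp_le (C : ℝ) (k : ℕ) {c : ℝ} (hc : 0 < c) :
    ∀ᶠ A : ℝ in Filter.atTop, ∀ x, A ≤ x → C * x ^ k * Real.exp (-(c * x)) ≤ 1 := by
  refine Filter.eventually_forall_ge_atTop.2 ?_
  have h1 := (Real.tendsto_pow_mul_exp_neg_atTop_nhds_zero k).comp
    (Filter.tendsto_id.const_mul_atTop hc)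
  have h2 := h1.const_mul (C / c ^ k)
  rw [mul_zero] at h2
  filter_upwards [h2.eventually (eventually_le_nhds one_pos)] with x hx
  have e : C * x ^ k * Real.exp (-(c * x)) =
      C / c ^ k * ((fun x : ℝ => x ^ k * Real.exp (-x)) ∘ fun x => c * id x) x := by
    simp only [Function.comp, id, mul_pow]
    field_simp
  rw [e]
  exact hx

/-- The metric entropy of the net is dominated by the sample size. -/
lemma eventually_entropy_le {c₁ c₂ c : ℝ} (hc₁ : 0 ≤ c₁) (hc₂ : 0 ≤ c₂) (hc : 0 < c) :
    ∀ᶠ A : ℝ in Filter.atTop, ∀ (d : ℕ) (n r : ℝ), 1 ≤ d →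
      A * (d * (1 + Real.log d)) ≤ n → 0 ≤ r → r ≤ n →
      (c₁ * r * √d + 2) ^ d * (c₂ * √d + 2) ^ d ≤ Real.exp (c * n) := by
  filter_upwards [eventually_pow_mul_exp_le ((c₁ + 2) * (c₂ + 2)) 3 (half_pos hc),
    Filter.eventually_ge_atTop 1, Filter.eventually_ge_atTop (6 / c)] with A h1 hA1 hA2 d n r hd hn
    hr hrn
  have hd' : (1 : ℝ) ≤ d := by exact_mod_cast hd
  have hl : 0 ≤ Real.log d := Real.log_nonneg hd'
  have hdn : (d : ℝ) ≤ n := by nlinarith [mul_nonneg (by linarith : (0 : ℝ) ≤ d) hl]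
  have hs1 : 1 ≤ √(d : ℝ) := Real.one_le_sqrt.2 hd'
  have hsn : √(d : ℝ) ≤ n := by nlinarith [Real.sq_sqrt (by linarith : (0 : ℝ) ≤ d)]
  have hn1 : 1 ≤ n := hd'.trans hdn
  -- In terms of the sample size per dimension the net has at most (C u³ d³)^d pairs of points. The
  -- factor u³ is absorbed because u ≥ A is large, and d³ because u ≥ A log d.
  set u := n / d with hu
  have hun : u * d = n := by rw [hu]; field_simp
  have hud : A * (1 + Real.log d) ≤ u := by
    rw [hu, le_div_iff₀ (by linarith)]
    linarith
  have huA : A ≤ u := by nlinarith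
  have hu0 : 0 < u := by linarith
  have hul : 3 * Real.log d ≤ c / 2 * u := by
    have h2 : 6 ≤ A * c := by rwa [div_le_iff₀ hc] at hA2
    have h3 : A * Real.log d ≤ u := by nlinarith
    have h4 : 6 * Real.log d ≤ A * c * Real.log d := by gcongr
    nlinarith
  have b1 : c₁ * r * √d + 2 ≤ (c₁ + 2) * n ^ 2 := by
    have h2 : r * √d ≤ n * n := by gcongr
    nlinarith [mul_le_mul_of_nonneg_left h2 hc₁]
  have b2 : c₂ * √d + 2 ≤ (c₂ + 2) * n := by nlinarith [mul_le_mul_of_nonneg_left hsn hc₂]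
  have b3 : (d : ℝ) ^ 3 ≤ Real.exp (c / 2 * u) := by
    calc (d : ℝ) ^ 3 = Real.exp (3 * Real.log d) := by
          rw [← Real.exp_log (by positivity : (0 : ℝ) < (d : ℝ) ^ 3), Real.log_pow]
          norm_num
      _ ≤ _ := Real.exp_le_exp.2 hul
  have b4 : (c₁ + 2) * (c₂ + 2) * u ^ 3 ≤ Real.exp (c / 2 * u) := by
    have := h1 u huA
    rwa [Real.exp_neg, ← div_eq_mul_inv, div_le_one (Real.exp_pos _)] at this
  calc _ = ((c₁ * r * √d + 2) * (c₂ * √d + 2)) ^ d := (mul_pow _ _ _).symm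
    _ ≤ (((c₁ + 2) * n ^ 2) * ((c₂ + 2) * n)) ^ d := by gcongr
    _ = (((c₁ + 2) * (c₂ + 2) * u ^ 3) * (d : ℝ) ^ 3) ^ d := by rw [← hun]; ring
    _ ≤ (Real.exp (c / 2 * u) * Real.exp (c / 2 * u)) ^ d := by gcongr
    _ = Real.exp (c * n) := by
        rw [← Real.exp_add, ← Real.exp_nat_mul, ← hun]
        congr 1
        ring

/-! ### The exceptional event of one client -/

section Client

variable {d : ℕ} {𝒳 : Type u} [MeasurableSpace 𝒳] {P : Measure 𝒳} [IsProbabilityMeasure P]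
  {ρ : 𝒳 → Vec d → ℝ} {Θ : Set (Vec d)} {θ₀ : Vec d} {τ₁ τ₂ W C₁ C₂ : ℝ}

lemma Assumptions.meas_le_norm_avgGrad (hA : Assumptions P ρ Θ τ₁ τ₂ W C₁ C₂)
    (hT : IsTarget P ρ Θ θ₀) (hC₁ : 0 < C₁) (hd : 0 < d) {n : ℕ} (hn : 0 < n) (u : ℝ) :
    Measure.pi (fun _ : Fin n => P) {x | u ≤ ‖avgGrad ρ x θ₀‖} ≤
      ENNReal.ofReal (Real.exp (-(n * (u / (C₁ * √(2 * d)) - 1 - Real.log tailConst)))) := by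
  set s := C₁ * √(2 * d) with hs
  have hs0 : 0 < s := by
    have : (0 : ℝ) < d := by exact_mod_cast hd
    positivity
  have hT1 := one_le_tailConst
  have hn' : (0 : ℝ) < n := by exact_mod_cast hn
  have hm := measurable_grad hA.measurable_loss hA.contDiff_loss θ₀
  have h1 := pi_meas_ge_sum_le (κ := fun _ : Fin n => P) (f := fun _ y => ‖grad ρ y θ₀‖ / s)
    (fun _ => hm.norm.div_const s) (n * (u / s))
  -- From x ≤ 1 + x², the exponential moment of the norm is at most e times that of its square.
  have h2 : ∫⁻ y, ENNReal.ofReal (Real.exp (‖grad ρ y θ₀‖ / s)) ∂P ≤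
      ENNReal.ofReal (Real.exp (1 + Real.log tailConst)) := by
    calc _ ≤ ∫⁻ y, ENNReal.ofReal (Real.exp 1) *
            ENNReal.ofReal (Real.exp (‖grad ρ y θ₀‖ ^ 2 / s ^ 2)) ∂P := by
          refine lintegral_mono fun y => ?_
          simp only
          rw [← ENNReal.ofReal_mul (Real.exp_pos _).le, ← Real.exp_add, ← div_pow]
          refine ENNReal.ofReal_le_ofReal (Real.exp_le_exp.2 ?_)
          nlinarith [sq_nonneg (‖grad ρ y θ₀‖ / s - 1), sq_nonneg (‖grad ρ y θ₀‖ / s)]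
      _ = ENNReal.ofReal (Real.exp 1) *
            ∫⁻ y, ENNReal.ofReal (Real.exp (‖grad ρ y θ₀‖ ^ 2 / s ^ 2)) ∂P :=
          lintegral_const_mul _ (by fun_prop)
      _ ≤ ENNReal.ofReal (Real.exp 1) * ENNReal.ofReal tailConst := by
          gcongr
          exact hA.lintegral_exp_grad_le hT hC₁ hd
      _ = _ := by
          rw [Real.exp_add, Real.exp_log (by linarith), ENNReal.ofReal_mul (Real.exp_pos _).le]
  calc _ ≤ Measure.pi (fun _ : Fin n => P) {x | n * (u / s) ≤ ∑ j, ‖grad ρ (x j) θ₀‖ / s} := by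
        refine measure_mono fun x hx => ?_
        have h3 : u ≤ (n : ℝ)⁻¹ * ∑ j, ‖grad ρ (x j) θ₀‖ := le_trans hx (norm_avgGrad_le x θ₀)
        rw [inv_mul_eq_div, le_div_iff₀ hn'] at h3
        show n * (u / s) ≤ ∑ j, ‖grad ρ (x j) θ₀‖ / s
        rw [← Finset.sum_div, le_div_iff₀ hs0]
        calc n * (u / s) * s = u * n := by field_simp
          _ ≤ _ := h3
    _ ≤ _ := h1
    _ ≤ ENNReal.ofReal (Real.exp (-(n * (u / s)))) *
          ∏ _j : Fin n, ENNReal.ofReal (Real.exp (1 + Real.log tailConst)) := by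
        gcongr
    _ = _ := by
        rw [Finset.prod_const, Finset.card_univ, Fintype.card_fin,
          ← ENNReal.ofReal_pow (Real.exp_pos _).le, ← Real.exp_nat_mul,
          ← ENNReal.ofReal_mul (Real.exp_pos _).le, ← Real.exp_add]
        congr 2
        ring

lemma meas_exists_noise_ge (hd : 0 < d) (n K : ℕ) {a h : ℝ} (ha : 0 < a) (hh : 0 ≤ h) :
    clientLaw P d n {ω | ∃ t < K, h ≤ a * ‖ω.2 t‖} ≤
      ENNReal.ofReal (K * (tailConst * Real.exp (-(h ^ 2 / (4 * (a ^ 2 * d)))))) := by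
  have hd' : (0 : ℝ) < d := by exact_mod_cast hd
  have h1 := meas_ge_le_of_lintegral_exp_sq (μ := stdGaussian (Vec d)) measurable_norm
    (A := √(4 * d)) (by positivity) (lintegral_exp_stdGaussian_le hd) (t := h / a) (by positivity)
  have e : (h / a) ^ 2 / √(4 * (d : ℝ)) ^ 2 = h ^ 2 / (4 * (a ^ 2 * d)) := by
    rw [Real.sq_sqrt (by positivity)]; field_simp
  rw [e] at h1
  have h2 : ∀ t, clientLaw P d n {ω | h ≤ a * ‖ω.2 t‖} ≤
      ENNReal.ofReal (tailConst * Real.exp (-(h ^ 2 / (4 * (a ^ 2 * d))))) := fun t => by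
    have hp := measurePreserving_clientLaw_noise P d n t
    have h3 := hp.measure_preimage (s := {z | h / a ≤ ‖z‖})
      (measurableSet_le measurable_const measurable_norm).nullMeasurableSet
    refine le_trans (le_of_eq ?_) (h3.le.trans h1)
    congr 1
    ext ω
    simp [div_le_iff₀ ha, mul_comm]
  calc _ ≤ clientLaw P d n (⋃ t ∈ Finset.range K, {ω | h ≤ a * ‖ω.2 t‖}) := by
        refine measure_mono fun ω ⟨t, ht, hω⟩ => ?_
        simp only [Set.mem_iUnion, Finset.mem_range]
        exact ⟨t, ht, hω⟩
    _ ≤ ∑ t ∈ Finset.range K, clientLaw P d n {ω | h ≤ a * ‖ω.2 t‖} := measure_biUnion_finset_le _ _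
    _ ≤ ∑ _t ∈ Finset.range K,
          ENNReal.ofReal (tailConst * Real.exp (-(h ^ 2 / (4 * (a ^ 2 * d))))) :=
        Finset.sum_le_sum fun t _ => h2 t
    _ = _ := by
        rw [Finset.sum_const, Finset.card_range, nsmul_eq_mul, ENNReal.ofReal_mul (Nat.cast_nonneg K),
          ENNReal.ofReal_natCast]

end Client

/-! ### Numerical facts about large sample sizes -/

section Client

/-- Consequences of the sample size condition. -/
lemma client_size_bounds {A : ℝ} (hA1 : 1 ≤ A) {d n K : ℕ} (hd : 1 ≤ d)
    (hn : A * (d * (1 + Real.log d) + K) ≤ n) :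
    A * (d * (1 + Real.log d)) ≤ n ∧ A * K ≤ n ∧ A ≤ n ∧ (d : ℝ) ≤ n ∧ (K : ℝ) ≤ n ∧
      1 ≤ √(d : ℝ) ∧ √(d : ℝ) ≤ d := by
  have hd' : (1 : ℝ) ≤ d := by exact_mod_cast hd
  have hl : 0 ≤ Real.log d := Real.log_nonneg hd'
  have hdl : (d : ℝ) ≤ d * (1 + Real.log d) := by nlinarith
  have hK0 : (0 : ℝ) ≤ K := Nat.cast_nonneg K
  have h1 : A * (d * (1 + Real.log d)) ≤ n := by
    have : 0 ≤ A * (K : ℝ) := by positivity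
    linarith
  have h2 : A * (K : ℝ) ≤ n := by
    have : 0 ≤ A * (d * (1 + Real.log d)) := by positivity
    linarith
  have hs1 : 1 ≤ √(d : ℝ) := Real.one_le_sqrt.2 hd'
  have hss : √(d : ℝ) * √d = d := Real.mul_self_sqrt (by linarith)
  have h3 : A * 1 ≤ A * (d * (1 + Real.log d)) := by gcongr; linarith
  have h4 : 1 * (d : ℝ) ≤ A * (d * (1 + Real.log d)) := by gcongr
  exact ⟨h1, h2, by linarith, by linarith, by nlinarith, hs1, by nlinarith⟩

lemma sqrt_two_mul_le (d : ℕ) : √(2 * (d : ℝ)) ≤ 2 * √d := by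
  rw [Real.sqrt_mul (by norm_num)]
  gcongr
  rw [Real.sqrt_le_left (by norm_num)]
  norm_num

/-- The probability of the exceptional event of a client is exponentially small. -/
lemma eventually_client_prob_le {τ₁ τ₂ W C₁ R : ℝ} (hτ₁ : 0 < τ₁) (hτ₂ : 0 < τ₂) (hW : 0 < W)
    (hC₁ : 0 < C₁) {c : ℝ} (hc : c = (3 / 200 * τ₁) ^ 2 / (2 * τ₂ ^ 2)) :
    ∀ᶠ A : ℝ in Filter.atTop, ∀ (d n K : ℕ) (a η r : ℝ), 1 ≤ d → 0 < a → 1 / (2 * τ₂) ≤ η →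
      A * (d * (1 + Real.log d) + K) ≤ n → A * d ≤ r → r ≤ n → a ^ 2 * d ≤ r ^ 2 / (A * n) →
      R * √d ≤ r / 2 ∧
        (4 * r * W * √d / (3 / 200 * τ₁) + 2) ^ d * (8 * τ₂ * √d / (3 / 200 * τ₁) + 2) ^ d *
            Real.exp (-(n * c)) +
          Real.exp (-(n * (19 / 20 * τ₁ * r / 8 / (C₁ * √(2 * d)) - 1 - Real.log tailConst))) +
          K * (tailConst * Real.exp (-((η * (19 / 20 * τ₁) * r / 4) ^ 2 / (4 * (a ^ 2 * d))))) ≤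
            Real.exp (-(c / 4 * n)) := by
  have hc0 : 0 < c := by rw [hc]; positivity
  clear hc
  have hT := one_le_tailConst
  -- The constants κ and γ are such that κAn bounds the exponent of the noise tail from below, and
  -- γA bounds the gradient threshold divided by its sub-Gaussian scale from below.
  set κ : ℝ := (19 / 20 * τ₁ / (2 * τ₂)) ^ 2 / 64 with hκ
  have hκ0 : 0 < κ := by positivity
  set γ : ℝ := 19 / 20 * τ₁ / (16 * C₁) with hγ
  have hγ0 : 0 < γ := by positivity
  filter_upwards [eventually_entropy_le (c₁ := 4 * W / (3 / 200 * τ₁))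
      (c₂ := 8 * τ₂ / (3 / 200 * τ₁)) (by positivity) (by positivity) (half_pos hc0),
    eventually_pow_mul_exp_le tailConst 1 one_pos,
    eventually_pow_mul_exp_le 3 0 (show (0 : ℝ) < c / 4 by positivity),
    Filter.eventually_ge_atTop (1 : ℝ), Filter.eventually_ge_atTop (2 * R),
    Filter.eventually_ge_atTop ((1 + Real.log tailConst + c / 2) / γ),
    Filter.eventually_ge_atTop ((c / 2 + 1) / κ)] with A hent hexp1 hexp2 hA1 hAR hAγ hAκ
    d n K a η r hd ha hη1 hn hr hrn had
  obtain ⟨hn1, hn2, hAn, hdn, hKn, hs1, hsd⟩ := client_size_bounds hA1 hd hn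
  have hd' : (1 : ℝ) ≤ d := by exact_mod_cast hd
  have hA0 : 0 < A := by linarith
  have hn0 : (1 : ℝ) ≤ n := hA1.trans hAn
  have hrp : 0 < r := lt_of_lt_of_le (by positivity) hr
  have hs2' : 0 < √(2 * (d : ℝ)) := by positivity
  have t0 : R * √d ≤ r / 2 := by
    have h1 : 2 * R * √d ≤ A * d := by gcongr
    linarith
  have t1 : (4 * r * W * √d / (3 / 200 * τ₁) + 2) ^ d * (8 * τ₂ * √d / (3 / 200 * τ₁) + 2) ^ d *
      Real.exp (-(n * c)) ≤ Real.exp (-(c / 2 * n)) := by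
    have h1 := hent d n r hd hn1 hrp.le hrn
    have e1 : 4 * r * W * √d / (3 / 200 * τ₁) = 4 * W / (3 / 200 * τ₁) * r * √d := by ring
    have e2 : 8 * τ₂ * √d / (3 / 200 * τ₁) = 8 * τ₂ / (3 / 200 * τ₁) * √d := by ring
    rw [e1, e2]
    refine (mul_le_mul_of_nonneg_right h1 (Real.exp_pos _).le).trans (le_of_eq ?_)
    rw [← Real.exp_add]
    congr 1
    ring
  have t2 : Real.exp (-(n * (19 / 20 * τ₁ * r / 8 / (C₁ * √(2 * d)) - 1 -
      Real.log tailConst))) ≤ Real.exp (-(c / 2 * n)) := by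
    rw [div_le_iff₀ hγ0] at hAγ
    have h1 : A * γ ≤ 19 / 20 * τ₁ * r / 8 / (C₁ * √(2 * d)) := by
      rw [hγ, le_div_iff₀ (by positivity)]
      have h2 : A * √(2 * (d : ℝ)) ≤ 2 * r := by
        calc A * √(2 * (d : ℝ)) ≤ A * (2 * d) := by
              gcongr
              exact (sqrt_two_mul_le d).trans (by linarith)
          _ ≤ 2 * r := by linarith
      calc A * (19 / 20 * τ₁ / (16 * C₁)) * (C₁ * √(2 * d)) =
            19 / 20 * τ₁ / 16 * (A * √(2 * d)) := by field_simp
        _ ≤ 19 / 20 * τ₁ / 16 * (2 * r) := by gcongr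
        _ = _ := by ring
    refine Real.exp_le_exp.2 (neg_le_neg ?_)
    rw [mul_comm]
    refine mul_le_mul_of_nonneg_left ?_ (by linarith)
    linarith
  have t3 : K * (tailConst * Real.exp (-((η * (19 / 20 * τ₁) * r / 4) ^ 2 /
      (4 * (a ^ 2 * d))))) ≤ Real.exp (-(c / 2 * n)) := by
    have h1 : κ * A * n ≤ (η * (19 / 20 * τ₁) * r / 4) ^ 2 / (4 * (a ^ 2 * d)) := by
      rw [le_div_iff₀ (by positivity)]
      have h2 : 19 / 20 * τ₁ / (2 * τ₂) ≤ η * (19 / 20 * τ₁) := by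
        calc 19 / 20 * τ₁ / (2 * τ₂) = 1 / (2 * τ₂) * (19 / 20 * τ₁) := by ring
          _ ≤ _ := by gcongr
      have h3 : a ^ 2 * d * (A * n) ≤ r ^ 2 := by
        rwa [le_div_iff₀ (by positivity)] at had
      calc κ * A * n * (4 * (a ^ 2 * d)) =
            (19 / 20 * τ₁ / (2 * τ₂)) ^ 2 / 16 * (a ^ 2 * d * (A * n)) := by rw [hκ]; ring
        _ ≤ (η * (19 / 20 * τ₁)) ^ 2 / 16 * r ^ 2 := by gcongr
        _ = _ := by ring
    have h4 : (c / 2 + 1) * n ≤ κ * A * n := by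
      rw [div_le_iff₀ hκ0] at hAκ
      rw [mul_comm κ]
      gcongr
    have h5 := hexp1 n hAn
    rw [pow_one, one_mul] at h5
    calc _ ≤ n * (tailConst * Real.exp (-((c / 2 + 1) * n))) := by
          gcongr
          exact h4.trans h1
      _ = (tailConst * n * Real.exp (-n)) * Real.exp (-(c / 2 * n)) := by
          have : -((c / 2 + 1) * (n : ℝ)) = -n + -(c / 2 * n) := by ring
          rw [this, Real.exp_add]; ring
      _ ≤ 1 * Real.exp (-(c / 2 * n)) := by gcongr
      _ = _ := one_mul _
  have h6 := hexp2 n hAn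
  refine ⟨t0, ?_⟩
  -- Hessian, gradient and noise contribute at most exp(-cn/2) each; half of this exponent absorbs
  -- the factor 3.
  calc _ ≤ 3 * Real.exp (-(c / 2 * n)) := by linarith
    _ = (3 * n ^ 0 * Real.exp (-(c / 4 * n))) * Real.exp (-(c / 4 * n)) := by
        have : -(c / 2 * (n : ℝ)) = -(c / 4 * n) + -(c / 4 * n) := by ring
        rw [this, Real.exp_add]; ring
    _ ≤ 1 * Real.exp (-(c / 4 * n)) := by gcongr
    _ = _ := one_mul _

/-- The crude growth of the iterates is beaten by an exponentially small probability. -/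
lemma eventually_client_growth_le {τ₂ C₁ R L c M : ℝ} (hτ₂ : 0 < τ₂) (hC₁ : 0 < C₁) (hR : 0 < R)
    (hL : 0 ≤ L) (hM : 1 ≤ M) (hc : 0 < c) :
    ∀ᶠ A : ℝ in Filter.atTop, ∀ (d n K : ℕ) (a η r : ℝ), 1 ≤ d → 0 < a → 0 < η →
      η ≤ 9 / (10 * τ₂) → A * (d * (1 + Real.log d) + K) ≤ n → 0 ≤ r → r ≤ n →
      a ^ 2 * d ≤ r ^ 2 / (A * n) →
      Real.exp (-(c * n)) * (L * (2 ^ K * ((1 + R * √d) + C₁ * √(2 * d) * M +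
          ∑ _t ∈ Finset.range K, (η * (C₁ * √(2 * d) * M) + a * (√(4 * d) * M))))) ≤
        ((n : ℝ) ^ 4)⁻¹ := by
  set Cc : ℝ := 1 + R + 2 * C₁ * M + 2 * C₁ * M / τ₂ + 2 * M with hCc
  have hCc0 : 0 ≤ Cc := by positivity
  filter_upwards [eventually_pow_mul_exp_le (L * Cc) 6 (half_pos hc),
    Filter.eventually_ge_atTop (1 : ℝ), Filter.eventually_ge_atTop (2 / c)] with A hexp hA1 hAq
    d n K a η r hd ha hη0 hη2 hn hr0 hrn had
  obtain ⟨hn1, hn2, hAn, hdn, hKn, hs1, hsd⟩ := client_size_bounds hA1 hd hn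
  have hd' : (1 : ℝ) ≤ d := by exact_mod_cast hd
  have hA0 : 0 < A := by linarith
  have hn0 : (1 : ℝ) ≤ n := hA1.trans hAn
  have hs4 : √(4 * (d : ℝ)) = 2 * √d := by
    rw [Real.sqrt_mul (by norm_num)]
    congr 1
    rw [show (4 : ℝ) = 2 ^ 2 by norm_num, Real.sqrt_sq (by norm_num)]
  have hsn : √(d : ℝ) ≤ n := hsd.trans hdn
  have hap : a * √d ≤ n := by
    refine (abs_le_of_sq_le_sq' ?_ (by positivity)).2
    rw [mul_pow, Real.sq_sqrt (by linarith)]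
    calc a ^ 2 * d ≤ r ^ 2 / (A * n) := had
      _ ≤ r ^ 2 := div_le_self (sq_nonneg r) (by nlinarith)
      _ ≤ (n : ℝ) ^ 2 := by gcongr
  have hη3 : η ≤ 1 / τ₂ := hη2.trans (by
    rw [div_le_div_iff₀ (by positivity) hτ₂]
    linarith)
  have g1 : C₁ * √(2 * d) * M ≤ 2 * C₁ * M * n := by
    calc C₁ * √(2 * d) * M ≤ C₁ * (2 * n) * M := by
          gcongr
          exact (sqrt_two_mul_le d).trans (by linarith)
      _ = _ := by ring
  have g2 : ∑ _t ∈ Finset.range K, (η * (C₁ * √(2 * d) * M) + a * (√(4 * d) * M)) ≤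
      (2 * C₁ * M / τ₂ + 2 * M) * n ^ 2 := by
    rw [Finset.sum_const, Finset.card_range, nsmul_eq_mul, hs4]
    calc (K : ℝ) * (η * (C₁ * √(2 * d) * M) + a * (2 * √d * M))
        = K * (η * (C₁ * √(2 * d) * M) + 2 * M * (a * √d)) := by ring
      _ ≤ n * (1 / τ₂ * (2 * C₁ * M * n) + 2 * M * n) := by gcongr
      _ = _ := by ring
  have hnn : (n : ℝ) ≤ n ^ 2 := by nlinarith
  have g3 : (1 + R * √d) + C₁ * √(2 * d) * M +
      ∑ _t ∈ Finset.range K, (η * (C₁ * √(2 * d) * M) + a * (√(4 * d) * M)) ≤ Cc * n ^ 2 := by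
    have g4 : R * √d ≤ R * n ^ 2 := by gcongr; exact hsn.trans hnn
    have g5 : 2 * C₁ * M * n ≤ 2 * C₁ * M * n ^ 2 := by gcongr
    have e : Cc * (n : ℝ) ^ 2 = n ^ 2 + R * n ^ 2 + 2 * C₁ * M * n ^ 2 +
        (2 * C₁ * M / τ₂ + 2 * M) * n ^ 2 := by rw [hCc]; ring
    rw [e]
    linarith
  -- The size condition gives K ≤ n/A, so for A ≥ 2/c the growth of the iterates uses only half of
  -- the exponent of the probability.
  have g6 : (2 : ℝ) ^ K ≤ Real.exp (c / 2 * n) := by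
    calc (2 : ℝ) ^ K ≤ Real.exp 1 ^ K := by
          gcongr
          linarith [Real.add_one_le_exp 1]
      _ = Real.exp K := by rw [← Real.exp_nat_mul, mul_one]
      _ ≤ _ := by
          refine Real.exp_le_exp.2 ?_
          rw [div_le_iff₀ hc] at hAq
          have := mul_le_mul_of_nonneg_left hAq (Nat.cast_nonneg (α := ℝ) K)
          have := mul_le_mul_of_nonneg_left hn2 hc.le
          linarith
  have h7 := hexp n hAn
  have hn4 : (0 : ℝ) < (n : ℝ) ^ 4 := by positivity
  have e : Real.exp (-(c * n)) = Real.exp (-(c / 2 * n)) * Real.exp (-(c / 2 * n)) := by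
    rw [← Real.exp_add]; congr 1; ring
  have e1 : Real.exp (-(c / 2 * n)) * Real.exp (c / 2 * n) = 1 := by
    rw [← Real.exp_add, neg_add_cancel, Real.exp_zero]
  rw [← one_div, le_div_iff₀ hn4]
  calc _ ≤ Real.exp (-(c * n)) * (L * (Real.exp (c / 2 * n) * (Cc * n ^ 2))) * n ^ 4 := by
        gcongr
    _ = (Real.exp (-(c / 2 * n)) * Real.exp (c / 2 * n)) *
          (L * Cc * n ^ 6 * Real.exp (-(c / 2 * n))) := by rw [e]; ring
    _ ≤ 1 := by rw [e1, one_mul]; exact h7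

end Client

/-! ### Pathwise behaviour and crude moments of the local descent -/

section Client

variable {d : ℕ} {𝒳 : Type u} [MeasurableSpace 𝒳]

/-- A crude pathwise bound for the local iterates. -/
lemma Assumptions.norm_localGD_sub_le_two_pow {P : Measure 𝒳} {ρ : 𝒳 → Vec d → ℝ}
    {Θ : Set (Vec d)} {τ₁ τ₂ W C₁ C₂ : ℝ}
    (hA : Assumptions P ρ Θ τ₁ τ₂ W C₁ C₂) {n : ℕ} (hn : 0 < n) {η a : ℝ} (hη : 0 ≤ η)
    (hη₂ : η * τ₂ ≤ 1) (ha : 0 ≤ a) (θ₀ : Vec d) (x : Fin n → 𝒳) (z : ℕ → Vec d) (K : ℕ) :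
    ‖localGD ρ x η a z K - θ₀‖ ≤ 2 ^ K * (‖θ₀‖ +
      ∑ t ∈ Finset.range K, (η * ‖avgGrad ρ x θ₀‖ + a * ‖z t‖)) := by
  have h := (hA.regularField_avgGrad hn x).norm_iterate_sub_le_two_pow hη hη₂
    (x := localGD ρ x η a z) (ν := fun t => a • z t) (K := K) (fun t _ => rfl) θ₀
  simpa [localGD, norm_smul, abs_of_nonneg ha] using h

/-- The linear convergence of the local iterates where the empirical Hessian is bounded below. -/
lemma Assumptions.norm_localGD_sub_le {P : Measure 𝒳} {ρ : 𝒳 → Vec d → ℝ}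
    {Θ : Set (Vec d)} {τ₁ τ₂ W C₁ C₂ : ℝ}
    (hA : Assumptions P ρ Θ τ₁ τ₂ W C₁ C₂) {n : ℕ} (hn : 0 < n) {η a τ r : ℝ} (hη : 0 ≤ η)
    (hη₂ : η * τ₂ ≤ 1) (ha : 0 ≤ a) (hτ : τ ≤ τ₂) {θ₀ : Vec d} {x : Fin n → 𝒳} {z : ℕ → Vec d}
    {K : ℕ} (hlow : ∀ θ, ‖θ - θ₀‖ ≤ r → ∀ v, τ * ‖v‖ ^ 2 ≤ inner ℝ v (avgHess ρ x θ v))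
    (h0 : ‖θ₀‖ ≤ r) (hν : ∀ t < K, η * ‖avgGrad ρ x θ₀‖ + a * ‖z t‖ ≤ η * τ * r) :
    ‖localGD ρ x η a z K - θ₀‖ ≤ r ∧ ‖localGD ρ x η a z K - θ₀‖ ≤ (1 - η * τ) ^ K * ‖θ₀‖ +
      ∑ t ∈ Finset.range K, (1 - η * τ) ^ (K - 1 - t) *
        (η * ‖avgGrad ρ x θ₀‖ + a * ‖z t‖) := by
  have h := (hA.regularField_avgGrad hn x).norm_iterate_sub_le hη hη₂ hτ hlow
    (x := localGD ρ x η a z) (ν := fun t => a • z t) (K := K) (fun t _ => rfl)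
    (by simpa [localGD] using h0)
    (fun t ht => by simpa [norm_smul, abs_of_nonneg ha] using hν t ht)
  simpa [localGD, norm_smul, abs_of_nonneg ha] using h

/-- The favourable behaviour of one client: the empirical Hessian is bounded below on the ball of
radius `r`, the gradient at the target is moderate, and the local iterates converge linearly. -/
structure ClientGood (ρ : 𝒳 → Vec d → ℝ) {n : ℕ} (θ₀ : Vec d) (τ₁ η a r : ℝ) (K : ℕ)
    (x : Fin n → 𝒳) (z : ℕ → Vec d) : Prop where
  hess_low : ∀ θ, ‖θ - θ₀‖ ≤ r → ∀ v : Vec d,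
    97 / 100 * τ₁ * ‖v‖ ^ 2 ≤ inner ℝ v (avgHess ρ x θ v)
  grad_le : ‖avgGrad ρ x θ₀‖ ≤ 19 / 20 * τ₁ * r / 8
  dist_le : ‖localGD ρ x η a z K - θ₀‖ ≤ r / 2
  dist_le_sum : ‖localGD ρ x η a z K - θ₀‖ ≤ (1 - η * (19 / 20 * τ₁)) ^ K * ‖θ₀‖ +
    ∑ t ∈ Finset.range K, (1 - η * (19 / 20 * τ₁)) ^ (K - 1 - t) *
      (η * ‖avgGrad ρ x θ₀‖ + a * ‖z t‖)

/-- A crude moment bound for a client. -/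
lemma Assumptions.lpBound_client {P : Measure 𝒳} [IsProbabilityMeasure P] {ρ : 𝒳 → Vec d → ℝ}
    {Θ : Set (Vec d)} {θ₀ : Vec d} {τ₁ τ₂ W C₁ C₂ R L : ℝ}
    (hA : Assumptions P ρ Θ τ₁ τ₂ W C₁ C₂) (hT : IsTarget P ρ Θ θ₀) (hC₁ : 0 < C₁) (hR : 0 ≤ R)
    (hL : 0 ≤ L) (hd : 0 < d) {n : ℕ} (hn : 0 < n) {η a : ℝ} (hη : 0 ≤ η)
    (hη₂ : η * τ₂ ≤ 1) (ha : 0 ≤ a) (hθ₀ : ‖θ₀‖ ≤ R * √d) (K : ℕ) {q : ℕ} (hq : q ≠ 0) :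
    LpBound (clientLaw P d n) (2 * q : ℕ)
      (fun ω => L * (1 + ‖avgGrad ρ ω.1 θ₀‖ + ‖localGD ρ ω.1 η a ω.2 K - θ₀‖))
      (L * (2 ^ K * (1 + R * √d + C₁ * √(2 * d) * momentConst q +
        ∑ _t ∈ Finset.range K, (η * (C₁ * √(2 * d) * momentConst q) +
          a * (√(4 * d) * momentConst q))))) := by
  have h1q : (1 : ENNReal) ≤ ((2 * q : ℕ) : ENNReal) := by
    exact_mod_cast (show 1 ≤ 2 * q by omega)
  have h0q : ((2 * q : ℕ) : ENNReal) ≠ 0 := by exact_mod_cast (show 2 * q ≠ 0 by omega)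
  have hU := hA.lpBound_avgGrad (n := n) hT hC₁ hd hn hq
  have hZ : ∀ t, LpBound (clientLaw P d n) (2 * q : ℕ) (fun ω => ‖ω.2 t‖)
      (√(4 * d) * momentConst q) := fun t =>
    (lpBound_stdGaussian hd hq).comp (measurePreserving_clientLaw_noise P d n t)
  have hc := LpBound.const (μ := clientLaw P d n) h0q (c := 1 + R * √d) (by positivity)
  have hs := LpBound.sum (μ := clientLaw P d n) h1q (Finset.range K)
    (f := fun t ω => η * ‖avgGrad ρ ω.1 θ₀‖ + a * ‖ω.2 t‖)
    (a := fun _ => η * (C₁ * √(2 * d) * momentConst q) + a * (√(4 * d) * momentConst q))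
    fun t _ => (hU.const_mul hη).add h1q ((hZ t).const_mul ha)
  have hS := ((((hc.add h1q hU).add h1q hs).const_mul (c := 2 ^ K) (by positivity)).const_mul hL)
  have hmU : Measurable fun ω : (Fin n → 𝒳) × (ℕ → Vec d) => ‖avgGrad ρ ω.1 θ₀‖ :=
    (hA.measurable_avgGrad measurable_fst measurable_const).norm
  have hmY : Measurable fun ω : (Fin n → 𝒳) × (ℕ → Vec d) =>
      ‖localGD ρ ω.1 η a ω.2 K - θ₀‖ :=
    ((hA.measurable_localGD measurable_fst measurable_snd η a K).sub_const θ₀).norm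
  refine hS.mono (((measurable_const.add hmU).add hmY).const_mul L).aestronglyMeasurable
    fun ω => ?_
  have h4 : 0 ≤ ‖avgGrad ρ ω.1 θ₀‖ := norm_nonneg _
  have h5 : 0 ≤ ‖localGD ρ ω.1 η a ω.2 K - θ₀‖ := norm_nonneg _
  rw [abs_of_nonneg (mul_nonneg hL (by linarith))]
  refine mul_le_mul_of_nonneg_left ?_ hL
  have h1 := hA.norm_localGD_sub_le_two_pow hn hη hη₂ ha θ₀ ω.1 ω.2 K
  have h2 : (1 : ℝ) ≤ 2 ^ K := one_le_pow₀ one_le_two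
  have h3 : 2 ^ K * ‖θ₀‖ ≤ 2 ^ K * (R * √d) := mul_le_mul_of_nonneg_left hθ₀ (by positivity)
  have h6 := mul_le_mul_of_nonneg_right h2 h4
  rw [mul_add] at h1
  rw [mul_add, mul_add, mul_add]
  linarith

end Client

/-- The bad event is the union of three: a degenerate Hessian on the ball, a large gradient at θ₀,
and a large noise vector at some step. Off it the descent contracts inside the ball. On it the
growth 2^K is beaten by the exponentially small probability through Hölder's inequality, whatever
the moment order q. -/
theorem eventually_exists_client_event {τ₁ τ₂ W C₁ C₂ R L : ℝ} (hτ₁ : 0 < τ₁) (hτ₂ : 0 < τ₂)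
    (hW : 0 < W) (hC₁ : 0 < C₁) (hR : 0 < R) (hL : 0 ≤ L) {q : ℕ} (hq : q ≠ 0) :
    ∀ᶠ A : ℝ in Filter.atTop, ∀ (d n K : ℕ) (a η r : ℝ) (𝒳 : Type u) [MeasurableSpace 𝒳]
      (P : Measure 𝒳) [IsProbabilityMeasure P] (ρ : 𝒳 → Vec d → ℝ) (Θ : Set (Vec d))
      (θ₀ : Vec d), 1 ≤ d → 0 < a → 1 / (2 * τ₂) ≤ η → η ≤ 9 / (10 * τ₂) →
      A * (d * (1 + Real.log d) + K) ≤ n → A * d ≤ r → r ≤ n → a ^ 2 * d ≤ r ^ 2 / (A * n) →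
      Assumptions P ρ Θ τ₁ τ₂ W C₁ C₂ → IsTarget P ρ Θ θ₀ → ‖θ₀‖ ≤ R * √d →
      ∃ B : Set ((Fin n → 𝒳) × (ℕ → Vec d)), MeasurableSet B ∧
        (∀ ω ∉ B, ClientGood ρ θ₀ τ₁ η a r K ω.1 ω.2) ∧
        LpBound (clientLaw P d n) q (B.indicator fun ω =>
          L * (1 + ‖avgGrad ρ ω.1 θ₀‖ + ‖localGD ρ ω.1 η a ω.2 K - θ₀‖)) ((n : ℝ) ^ 4)⁻¹ := by
  set c : ℝ := (3 / 200 * τ₁) ^ 2 / (2 * τ₂ ^ 2) with hc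
  have hc0 : 0 < c := by positivity
  have hq' : (0 : ℝ) < q := by exact_mod_cast Nat.pos_of_ne_zero hq
  filter_upwards [eventually_client_prob_le (R := R) hτ₁ hτ₂ hW hC₁ hc,
    eventually_client_growth_le hτ₂ hC₁ hR hL (one_le_momentConst q)
      (show 0 < c / (8 * q) by positivity),
    Filter.eventually_ge_atTop 1] with A hprob hgrow hA1
    d n K a η r 𝒳 _ P _ ρ Θ θ₀ hd ha hη1 hη2 hn hr hrn had hA hT hθ₀
  obtain ⟨hn1, hn2, hAn, hdn, hKn, hs1, hsd⟩ := client_size_bounds hA1 hd hn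
  have hη0 : 0 < η := lt_of_lt_of_le (by positivity) hη1
  have hd' : (1 : ℝ) ≤ d := by exact_mod_cast hd
  have hr0 : 0 ≤ r := le_trans (by positivity) hr
  have hnpos : 0 < n := by
    have : (0 : ℝ) < n := by linarith
    exact_mod_cast this
  obtain ⟨hRr, hp⟩ := hprob d n K a η r hd ha hη1 hn hr hrn had
  have hgr := hgrow d n K a η r hd ha hη0 hη2 hn hr0 hrn had
  have hη₂ : η * τ₂ ≤ 1 := by
    calc η * τ₂ ≤ 9 / (10 * τ₂) * τ₂ := by gcongr
      _ = 9 / 10 := by field_simp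
      _ ≤ 1 := by norm_num
  have hττ : τ₁ ≤ τ₂ := hA.tau_le hτ₁ hd
  -- The tolerance ε = (3/200)τ₁ costs 2ε, which leaves the lower bound (97/100)τ₁; the surplus over
  -- 19/20 is reserved for the server.
  obtain ⟨BH, hBm, hBp, hBg⟩ := hA.exists_hess_lower hτ₁ hW hd hnpos θ₀ hr0
    (ε := 3 / 200 * τ₁) (by positivity)
  set Bu : Set ((Fin n → 𝒳) × (ℕ → Vec d)) :=
    {ω | 19 / 20 * τ₁ * r / 8 ≤ ‖avgGrad ρ ω.1 θ₀‖} with hBu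
  set Bz : Set ((Fin n → 𝒳) × (ℕ → Vec d)) :=
    {ω | ∃ t < K, η * (19 / 20 * τ₁) * r / 4 ≤ a * ‖ω.2 t‖} with hBz
  have hmG : Measurable fun x : Fin n → 𝒳 => avgGrad ρ x θ₀ :=
    hA.measurable_avgGrad measurable_id measurable_const
  have hBum : MeasurableSet Bu :=
    measurableSet_le measurable_const (hmG.comp measurable_fst).norm
  have hBzm : MeasurableSet Bz := by
    have e : Bz = ⋃ t ∈ Finset.range K, {ω | η * (19 / 20 * τ₁) * r / 4 ≤ a * ‖ω.2 t‖} := by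
      ext ω; simp [hBz]
    rw [e]
    refine Finset.measurableSet_biUnion _ fun t _ => measurableSet_le measurable_const ?_
    exact ((measurable_pi_iff.1 measurable_snd t).norm).const_mul a
  set B : Set ((Fin n → 𝒳) × (ℕ → Vec d)) := ((fun ω => ω.1) ⁻¹' BH) ∪ Bu ∪ Bz with hB
  have hBmeas : MeasurableSet B := ((measurable_fst hBm).union hBum).union hBzm
  -- The probability is written as a power `2 * q`, the form required by the Hölder step.
  have hμB : clientLaw P d n B ≤ ENNReal.ofReal (Real.exp (-(c / (8 * q) * n)) ^ (2 * q)) := by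
    have e3 : Real.exp (-(c / (8 * q) * n)) ^ (2 * q) = Real.exp (-(c / 4 * n)) := by
      rw [← Real.exp_nat_mul]
      congr 1
      push_cast
      field_simp
      norm_num
    rw [e3]
    have p1 : clientLaw P d n ((fun ω => ω.1) ⁻¹' BH) ≤ _ :=
      ((measurePreserving_clientLaw_fst P d n).measure_preimage
        hBm.nullMeasurableSet).le.trans hBp
    have p2 : clientLaw P d n Bu ≤ _ :=
      ((measurePreserving_clientLaw_fst P d n).measure_preimage
        (s := {x | 19 / 20 * τ₁ * r / 8 ≤ ‖avgGrad ρ x θ₀‖})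
        (measurableSet_le measurable_const hmG.norm).nullMeasurableSet).le.trans
        (hA.meas_le_norm_avgGrad hT hC₁ hd hnpos (19 / 20 * τ₁ * r / 8))
    have p3 : clientLaw P d n Bz ≤ _ := meas_exists_noise_ge hd n K ha
      (h := η * (19 / 20 * τ₁) * r / 4) (by positivity)
    refine le_trans ?_ (ENNReal.ofReal_le_ofReal hp)
    have hT1 := one_le_tailConst
    rw [ENNReal.ofReal_add (by positivity) (by positivity),
      ENNReal.ofReal_add (by positivity) (by positivity)]
    exact (measure_union_le _ _).trans (add_le_add ((measure_union_le _ _).trans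
      (add_le_add p1 p2)) p3)
  refine ⟨B, hBmeas, ?_, ?_⟩
  · intro ω hω
    simp only [hB, Set.mem_union, not_or] at hω
    obtain ⟨⟨h1, h2⟩, h3⟩ := hω
    have h2' : ‖avgGrad ρ ω.1 θ₀‖ ≤ 19 / 20 * τ₁ * r / 8 := (not_le.1 h2).le
    have h3' : ∀ t < K, a * ‖ω.2 t‖ ≤ η * (19 / 20 * τ₁) * r / 4 := fun t ht =>
      (not_le.1 fun h => h3 ⟨t, ht, h⟩).le
    have hH : ∀ θ, ‖θ - θ₀‖ ≤ r → ∀ v : Vec d,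
        97 / 100 * τ₁ * ‖v‖ ^ 2 ≤ inner ℝ v (avgHess ρ ω.1 θ v) := fun θ hθ v => by
      have := hBg ω.1 h1 θ hθ v
      rw [inner_avgHess]
      have e : 97 / 100 * τ₁ = τ₁ - 2 * (3 / 200 * τ₁) := by ring
      rw [e]
      exact this
    -- The descent is confined to radius r/2. Gradient and noise use 1/8 and 1/4 of η(19/20)τ₁r,
    -- below the allowed half. The other half of the ball is left for the server.
    obtain ⟨h4, h5⟩ := hA.norm_localGD_sub_le hnpos (τ := 19 / 20 * τ₁) (r := r / 2) hη0.le hη₂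
      ha.le (by linarith) (x := ω.1) (z := ω.2) (K := K) (θ₀ := θ₀)
      (fun θ hθ v => le_trans (by
        have : 0 ≤ τ₁ * ‖v‖ ^ 2 := by positivity
        linarith) (hH θ (by linarith) v)) (hθ₀.trans hRr)
      (fun t ht => by
        have h6 := mul_le_mul_of_nonneg_left h2' hη0.le
        have h7 := h3' t ht
        have h8 : 0 ≤ η * τ₁ * r := by positivity
        linarith)
    exact ⟨hH, h2', h4, h5⟩
  · have hX := hA.lpBound_client hT hC₁ hR.le hL hd hnpos hη0.le hη₂ ha.le hθ₀ K hq
    exact (hX.indicator hq hBmeas (Real.exp_pos _).le hμB).weaken hgr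

/-! ### The rate of convergence -/

section Rate

variable {τ₁ τ₂ : ℝ}

lemma rateLog_pos (hτ₁ : 0 < τ₁) (hτ : τ₁ ≤ τ₂) : 0 < rateLog τ₁ τ₂ := by
  refine Real.log_pos ?_
  rw [lt_div_iff₀ (by linarith)]
  linarith

/-- The ratio in the logarithm is at most 3/2, and (3/2)⁵ ≤ 2³. For m ≥ 2 this gives 2 log m/ℓ ≥
10/3, so rounding K₂ up costs at most 30 percent. -/
lemma rateLog_le (hτ₁ : 0 < τ₁) (hτ : τ₁ ≤ τ₂) : rateLog τ₁ τ₂ ≤ 3 / 5 * Real.log 2 := by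
  have h1 : rateLog τ₁ τ₂ ≤ Real.log (3 / 2) := by
    refine Real.log_le_log (div_pos (by linarith) (by linarith)) ?_
    rw [div_le_div_iff₀ (by linarith) (by norm_num)]
    linarith
  have h2 : 5 * Real.log (3 / 2) ≤ 3 * Real.log 2 := by
    have h3 : Real.log ((3 / 2) ^ 5) ≤ Real.log (2 ^ 3) :=
      Real.log_le_log (by norm_num) (by norm_num)
    simpa [Real.log_pow] using h3
  linarith

lemma exp_neg_rateLog (hτ₁ : 0 < τ₁) (hτ : τ₁ ≤ τ₂) :
    Real.exp (-rateLog τ₁ τ₂) = 1 - τ₁ / (3 * τ₂) := by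
  have h2 : 0 < 3 * τ₂ := by linarith
  have h3 : 0 < 3 * τ₂ - τ₁ := by linarith
  rw [rateLog, Real.exp_neg, Real.exp_log (div_pos h2 h3), inv_div, sub_div, div_self h2.ne']

/-- The number of steps after which the contraction has beaten a given power. -/
lemma one_sub_pow_le_inv_pow (hτ₁ : 0 < τ₁) (hτ : τ₁ ≤ τ₂) {η : ℝ} (hη : 1 / (2 * τ₂) ≤ η)
    (hη₂ : η * τ₂ ≤ 1) {x : ℝ} (hx : 0 < x) {c K : ℕ}
    (hK : c * Real.log x / rateLog τ₁ τ₂ ≤ K) :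
    0 ≤ 1 - η * (19 / 20 * τ₁) ∧ (1 - η * (19 / 20 * τ₁)) ^ K ≤ (x ^ c)⁻¹ := by
  have hτ₂ : 0 < τ₂ := by linarith
  have hη0 : 0 < η := lt_of_lt_of_le (by positivity) hη
  have hl := rateLog_pos hτ₁ hτ
  have h0 : 0 ≤ 1 - η * (19 / 20 * τ₁) := by
    have : η * (19 / 20 * τ₁) ≤ η * τ₂ := by gcongr; linarith
    linarith
  refine ⟨h0, ?_⟩
  have h1 : 1 - η * (19 / 20 * τ₁) ≤ Real.exp (-rateLog τ₁ τ₂) := by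
    rw [exp_neg_rateLog hτ₁ hτ]
    have h2 : 1 / (2 * τ₂) * (19 / 20 * τ₁) ≤ η * (19 / 20 * τ₁) := by gcongr
    have h3 : 1 / (2 * τ₂) * (19 / 20 * τ₁) = 57 / 40 * (τ₁ / (3 * τ₂)) := by field_simp; norm_num
    have h4 : 0 ≤ τ₁ / (3 * τ₂) := by positivity
    linarith
  calc (1 - η * (19 / 20 * τ₁)) ^ K ≤ Real.exp (-rateLog τ₁ τ₂) ^ K := by gcongr
    _ = Real.exp (-(K * rateLog τ₁ τ₂)) := by rw [← Real.exp_nat_mul]; congr 1; ring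
    _ ≤ Real.exp (-(c * Real.log x)) := by
        rw [div_le_iff₀ hl] at hK
        gcongr
    _ = (x ^ c)⁻¹ := by rw [Real.exp_neg, Real.exp_nat_mul, Real.exp_log hx]

/-- The number of server steps is of the order of `log m`. -/
lemma four_mul_ceil_le (hτ₁ : 0 < τ₁) (hτ : τ₁ ≤ τ₂) {m K : ℕ} (hm : 0 < m)
    (hK : K = ⌈2 * Real.log (m : ℝ) / rateLog τ₁ τ₂⌉₊) :
    8 * (K : ℝ) ≤ 104 / 10 * (2 * Real.log m / rateLog τ₁ τ₂) := by
  have hl := rateLog_pos hτ₁ hτ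
  rcases Nat.lt_or_ge 1 m with h | h
  · have h1 : (K : ℝ) < 2 * Real.log m / rateLog τ₁ τ₂ + 1 := by
      rw [hK]
      refine Nat.ceil_lt_add_one (div_nonneg (mul_nonneg zero_le_two (Real.log_nonneg ?_)) hl.le)
      exact_mod_cast hm
    have h2 : Real.log 2 ≤ Real.log m := Real.log_le_log (by norm_num) (by exact_mod_cast h)
    have h3 : 10 / 3 ≤ 2 * Real.log m / rateLog τ₁ τ₂ := by
      rw [le_div_iff₀ hl]
      linarith [rateLog_le hτ₁ hτ]
    linarith
  -- With a single client log m = 0 and the server makes no step.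
  · have : m = 1 := by omega
    subst this
    simp [hK]

end Rate

/-! ### Inverse variance weights -/

section Weights

variable {m : ℕ} {n v w : Fin m → ℝ} {t b S N : ℝ}

/-- The properties of the inverse variance weights `w i = (v i)⁻¹ / S` for the variances
`v i = t / n i + b / n i ^ 2`. -/
structure IsWeight (n : Fin m → ℝ) (t b S N : ℝ) (w : Fin m → ℝ) : Prop where
  S_pos : 0 < S
  N_pos : 0 < N
  nonneg : ∀ i, 0 ≤ w i
  sum_eq : ∑ i, w i = 1
  sum_sq : t * ∑ i, w i ^ 2 / n i + b * ∑ i, w i ^ 2 / n i ^ 2 = S⁻¹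
  div_le : t / N ≤ t * ∑ i, w i ^ 2 / n i
  S_le : S ≤ N / t
  le_div : ∀ i, w i ≤ n i / (t * S)

lemma isWeight (hm : 0 < m) (hn : ∀ i, 0 < n i) (ht : 0 < t) (hb : 0 ≤ b)
    (hv : ∀ i, v i = t / n i + b / n i ^ 2) (hS : S = ∑ i, (v i)⁻¹) (hN : N = ∑ i, n i)
    (hw : ∀ i, w i = (v i)⁻¹ / S) : IsWeight n t b S N w := by
  have : Nonempty (Fin m) := ⟨⟨0, hm⟩⟩
  have hv0 : ∀ i, t / n i ≤ v i := fun i => by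
    rw [hv i]
    have : 0 ≤ b / n i ^ 2 := div_nonneg hb (sq_nonneg _)
    linarith
  have htn : ∀ i, 0 < t / n i := fun i => div_pos ht (hn i)
  have hvp : ∀ i, 0 < v i := fun i => (htn i).trans_le (hv0 i)
  have hvi : ∀ i, (v i)⁻¹ ≤ n i / t := fun i => by
    rw [← inv_div]
    exact inv_anti₀ (htn i) (hv0 i)
  have hSp : 0 < S := by
    rw [hS]
    exact Finset.sum_pos (fun i _ => inv_pos.2 (hvp i)) Finset.univ_nonempty
  have hNp : 0 < N := by
    rw [hN]
    exact Finset.sum_pos (fun i _ => hn i) Finset.univ_nonempty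
  have hsum : ∑ i, w i = 1 := by
    simp only [hw]
    rw [← Finset.sum_div, ← hS, div_self hSp.ne']
  refine ⟨hSp, hNp, fun i => ?_, hsum, ?_, ?_, ?_, fun i => ?_⟩
  · rw [hw]
    exact div_nonneg (inv_pos.2 (hvp i)).le hSp.le
  · rw [Finset.mul_sum, Finset.mul_sum, ← Finset.sum_add_distrib]
    have h1 : ∀ i, t * (w i ^ 2 / n i) + b * (w i ^ 2 / n i ^ 2) = (v i)⁻¹ / S ^ 2 := fun i => by
      have h2 : t * (w i ^ 2 / n i) + b * (w i ^ 2 / n i ^ 2) = w i ^ 2 * v i := by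
        rw [hv i]; ring
      rw [h2, hw i]
      have := (hvp i).ne'
      field_simp
    simp only [h1]
    rw [← Finset.sum_div, ← hS]
    field_simp
  · rw [div_eq_mul_inv]
    refine mul_le_mul_of_nonneg_left ?_ ht.le
    -- Cauchy–Schwarz: 1 = (∑ wᵢ)² ≤ N ∑ wᵢ²/nᵢ.
    have h1 := Finset.sum_sq_le_sum_mul_sum_of_sq_le_mul Finset.univ (r := w) (f := n)
      (g := fun i => w i ^ 2 / n i) (fun i _ => (hn i).le)
      (fun i _ => div_nonneg (sq_nonneg _) (hn i).le)
      (fun i _ => le_of_eq (by have := (hn i).ne'; field_simp))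
    rw [hsum, ← hN] at h1
    rw [inv_le_iff_one_le_mul₀ hNp]
    linarith
  · rw [hS, hN, Finset.sum_div]
    exact Finset.sum_le_sum fun i _ => hvi i
  · rw [hw i, ← div_div]
    gcongr
    exact hvi i

/-- Remainders of order 1/√N become fractions of √V, at the price of the lower bound s on the trace.
-/
lemma IsWeight.one_div_le (h : IsWeight n t b S N w) {s : ℝ} (hs : 0 < s) (hst : s ≤ t) :
    1 / N ≤ S⁻¹ / s := by
  have h1 := h.S_le
  have hS := h.S_pos
  have hN := h.N_pos
  have ht : 0 < t := hs.trans_le hst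
  rw [le_div_iff₀ ht] at h1
  rw [div_le_div_iff₀ hN hs, one_mul, inv_mul_eq_div, le_div_iff₀ hS]
  nlinarith

/-- A lower bound for the total precision in terms of the smallest sample size. -/
lemma sqrt_le_sq_mul_sum_inv (hn1 : ∀ i, 1 ≤ n i) {r : ℝ} (hr : 1 ≤ r) (hm : 0 < m) (ht : 0 < t) (htr : t ≤ r) (hb : 0 ≤ b) (hbr : b ≤ r ^ 2 * Real.log m)
    (hv : ∀ i, v i = t / n i + b / n i ^ 2) (hS : S = ∑ i, (v i)⁻¹) (hN : N = ∑ i, n i) :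
    √N / 2 ≤ r ^ 2 * S := by
  have hm1 : (1 : ℝ) ≤ m := by exact_mod_cast hm
  have hlm : 0 ≤ Real.log m := Real.log_nonneg hm1
  have hmN : (m : ℝ) ≤ N := by
    rw [hN]
    calc (m : ℝ) = ∑ _i : Fin m, (1 : ℝ) := by simp
      _ ≤ _ := Finset.sum_le_sum fun i _ => hn1 i
  have hN1 : 1 ≤ N := hm1.trans hmN
  -- Each variance is at most r²(1 + log m)/nᵢ; summing the inverses produces N in the numerator.
  have h1 : ∀ i, n i / (1 + Real.log m) ≤ r ^ 2 * (v i)⁻¹ := fun i => by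
    have hni : 0 < n i := by linarith [hn1 i]
    have h2 : v i ≤ r ^ 2 * (1 + Real.log m) / n i := by
      rw [hv i, mul_add, add_div]
      have h3 : t / n i ≤ r ^ 2 * 1 / n i := by
        gcongr; nlinarith
      have h4 : b / n i ^ 2 ≤ r ^ 2 * Real.log m / n i := by
        rw [pow_two, ← div_div]
        refine (div_le_self (by positivity) (hn1 i)).trans ?_
        gcongr
      linarith
    have h5 : 0 < v i := by
      rw [hv i]
      positivity
    rw [div_le_iff₀ (by positivity)]
    rw [le_div_iff₀ hni] at h2
    have h6 : r ^ 2 * (v i)⁻¹ * (1 + Real.log m) = r ^ 2 * (1 + Real.log m) / v i := by ring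
    rw [h6, le_div_iff₀ h5]
    linarith
  have h7 : N / (1 + Real.log m) ≤ r ^ 2 * S := by
    rw [hS, hN, Finset.mul_sum, Finset.sum_div]
    exact Finset.sum_le_sum fun i _ => h1 i
  refine le_trans ?_ h7
  have h8 : 0 < √N := Real.sqrt_pos.2 (by linarith)
  -- From m ≤ N and log √N ≤ √N - 1.
  have h9 : 1 + Real.log m ≤ 2 * √N := by
    have e1 : Real.log m ≤ Real.log N := Real.log_le_log (by linarith) hmN
    have e2 : Real.log N = 2 * Real.log √N := by rw [Real.log_sqrt (by linarith)]; ring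
    have e3 := Real.log_le_sub_one_of_pos h8
    linarith
  rw [div_le_div_iff₀ (by norm_num) (by positivity)]
  have h10 : √N * √N = N := Real.mul_self_sqrt (by linarith)
  nlinarith

end Weights

/-! ### The law of all clients -/

section Split

/-- Splitting a product of product measures coordinatewise. -/
lemma measurePreserving_pi_prod {ι : Type*} [Fintype ι] {α β : ι → Type*}
    [∀ i, MeasurableSpace (α i)] [∀ i, MeasurableSpace (β i)] (μ : ∀ i, Measure (α i))
    (ν : ∀ i, Measure (β i)) [∀ i, IsProbabilityMeasure (μ i)]
    [∀ i, IsProbabilityMeasure (ν i)] :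
    MeasurePreserving (fun (ω : (∀ i, α i) × (∀ i, β i)) i => (ω.1 i, ω.2 i))
      ((Measure.pi μ).prod (Measure.pi ν)) (Measure.pi fun i => (μ i).prod (ν i)) := by
  have hm : Measurable fun (ω : (∀ i, α i) × (∀ i, β i)) i => (ω.1 i, ω.2 i) :=
    measurable_pi_iff.2 fun i => ((measurable_pi_apply i).comp measurable_fst).prodMk
      ((measurable_pi_apply i).comp measurable_snd)
  -- The two measures are compared on products of measurable rectangles, a generating π-system on
  -- which both factorize.
  refine ⟨hm, (Measure.pi_eq_generateFrom (C := fun i =>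
    Set.image2 (· ×ˢ ·) {s : Set (α i) | MeasurableSet s} {t : Set (β i) | MeasurableSet t})
    (fun i => generateFrom_prod) (fun i => isPiSystem_prod)
    (fun i => ?_) ?_).symm⟩
  · exact {
      set := fun _ => Set.univ
      set_mem := fun _ => ⟨Set.univ, MeasurableSet.univ, Set.univ, MeasurableSet.univ, by simp⟩
      finite := fun _ => by simp
      spanning := Set.iUnion_const _ }
  · intro s hs
    choose A hA B hB e using hs
    simp only at e
    have hs' : ∀ i, s i = A i ×ˢ B i := fun i => (e i).symm
    obtain rfl : s = fun i => A i ×ˢ B i := funext hs'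
    rw [Measure.map_apply hm (MeasurableSet.univ_pi fun i => (hA i).prod (hB i))]
    have e2 : (fun (ω : (∀ i, α i) × (∀ i, β i)) i => (ω.1 i, ω.2 i)) ⁻¹'
        Set.univ.pi (fun i => A i ×ˢ B i) = Set.univ.pi A ×ˢ Set.univ.pi B := by
      ext ω
      simp only [Set.mem_preimage, Set.mem_univ_pi, Set.mem_prod]
      exact forall_and
    rw [e2, Measure.prod_prod, Measure.pi_pi, Measure.pi_pi, ← Finset.prod_mul_distrib]
    simp

variable {d m : ℕ} {𝒳 : Type u} [MeasurableSpace 𝒳] (P : Measure 𝒳) [IsProbabilityMeasure P]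

instance (d : ℕ) (n : Fin m → ℕ) : IsProbabilityMeasure (sampleLaw P d n) := by
  unfold sampleLaw; infer_instance

variable (d) (n : Fin m → ℕ)

lemma measurePreserving_clients :
    MeasurePreserving (fun (ω : Sample 𝒳 d n) i => (ω.1 i, ω.2.1 i)) (sampleLaw P d n)
      (Measure.pi fun i => clientLaw P d (n i)) := by
  have h1 := measurePreserving_pi_prod (fun i : Fin m => Measure.pi fun _ : Fin (n i) => P)
    (fun _ : Fin m => Measure.infinitePi fun _ : ℕ => stdGaussian (Vec d))
  have h2 : MeasurePreserving (fun ω : Sample 𝒳 d n => (ω.1, ω.2.1)) (sampleLaw P d n)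
      ((Measure.pi fun i => Measure.pi fun _ : Fin (n i) => P).prod
        (Measure.pi fun _ : Fin m => Measure.infinitePi fun _ : ℕ => stdGaussian (Vec d))) :=
    (MeasurePreserving.id _).prod measurePreserving_fst
  exact h1.comp h2

lemma measurePreserving_data :
    MeasurePreserving (fun ω : Sample 𝒳 d n => ω.1) (sampleLaw P d n)
      (Measure.pi fun i => Measure.pi fun _ : Fin (n i) => P) :=
  measurePreserving_fst

lemma measurePreserving_serverNoise (k : ℕ) :
    MeasurePreserving (fun (ω : Sample 𝒳 d n) i => ω.2.2 i k) (sampleLaw P d n)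
      (Measure.pi fun _ => stdGaussian (Vec d)) := by
  have h1 : MeasurePreserving (fun ω : Sample 𝒳 d n => ω.2.2) (sampleLaw P d n)
      (Measure.pi fun _ : Fin m => Measure.infinitePi fun _ : ℕ => stdGaussian (Vec d)) :=
    measurePreserving_snd.comp measurePreserving_snd
  exact (measurePreserving_pi _ _ fun _ : Fin m =>
    measurePreserving_eval_infinitePi (fun _ : ℕ => stdGaussian (Vec d)) k).comp h1

end Split

/-! ### Weighted averages over the clients -/

section Server

variable {d m : ℕ} {𝒳 : Type u} [MeasurableSpace 𝒳] {P : Measure 𝒳} [IsProbabilityMeasure P]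
  {n : Fin m → ℕ} {ρ : 𝒳 → Vec d → ℝ} {Θ : Set (Vec d)} {θ₀ : Vec d} {τ₁ τ₂ W C₁ C₂ : ℝ}

/-- The second moment of a weighted average of the client gradients. -/
lemma Assumptions.lpBound_sum_avgGrad (hA : Assumptions P ρ Θ τ₁ τ₂ W C₁ C₂)
    (hT : IsTarget P ρ Θ θ₀) (hC₁ : 0 < C₁) (hd : 0 < d) (hn : ∀ i, 0 < n i) {w : Fin m → ℝ} {a : ℝ}
    (ha : 0 ≤ a) (hw : (gradCov P ρ θ₀).trace * ∑ i, w i ^ 2 / n i ≤ a ^ 2) :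
    LpBound (sampleLaw P d n) 2 (fun ω => ‖∑ i, w i • avgGrad ρ (ω.1 i) θ₀‖) a := by
  have hi := fun i => hA.integral_avgGrad_sq hT hC₁ hd (hn i)
  have h := pi_integral_norm_sq_sum (κ := fun i : Fin m => Measure.pi fun _ : Fin (n i) => P)
    (f := fun i x => w i • avgGrad ρ x θ₀) (fun i => (hi i).1.const_smul (w i))
    (fun i => by rw [integral_smul, (hi i).2.1, smul_zero])
  have hm : Measurable fun x : ∀ i, Fin (n i) → 𝒳 => ‖∑ i, w i • avgGrad ρ (x i) θ₀‖ :=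
    (Finset.measurable_sum _ fun i _ => (hA.measurable_avgGrad (measurable_pi_apply i)
      measurable_const).const_smul (w i)).norm
  refine (LpBound.of_integral_sq hm.aestronglyMeasurable ha h.1 ?_).comp
    (measurePreserving_data d P n)
  rw [h.2]
  refine le_trans (le_of_eq ?_) hw
  rw [Finset.mul_sum]
  refine Finset.sum_congr rfl fun i _ => ?_
  simp only [norm_smul, mul_pow, Real.norm_eq_abs, sq_abs]
  rw [integral_const_mul, (hi i).2.2]
  ring

/-- The second moment of the aggregated server noise. -/
lemma lpBound_sum_noise (c : Fin m → ℝ) {a : ℝ} (ha : 0 ≤ a) (hc : d * ∑ i, c i ^ 2 ≤ a ^ 2) :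
    LpBound (Measure.pi fun _ : Fin m => stdGaussian (Vec d)) 2 (fun z => ‖∑ i, c i • z i‖) a := by
  have h0 : ∫ z : Vec d, z ∂stdGaussian (Vec d) = 0 := integral_id_stdGaussian
  have h := pi_integral_norm_sq_sum (κ := fun _ : Fin m => stdGaussian (Vec d))
    (f := fun i z => c i • z) (fun i => memLp_stdGaussian.const_smul (c i))
    (fun i => by rw [integral_smul, h0, smul_zero])
  have hm : Measurable fun z : Fin m → Vec d => ‖∑ i, c i • z i‖ :=
    (Finset.measurable_sum _ fun i _ => (measurable_pi_apply i).const_smul (c i)).norm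
  refine LpBound.of_integral_sq hm.aestronglyMeasurable ha h.1 ?_
  rw [h.2]
  refine le_trans (le_of_eq ?_) hc
  simp only [norm_smul, mul_pow, Real.norm_eq_abs, sq_abs]
  simp only [integral_const_mul, integral_norm_sq_stdGaussian]
  rw [← Finset.sum_mul, mul_comm]

/-- The exponential moment of the aggregated server noise. -/
lemma lintegral_exp_sum_noise_le (hd : 0 < d) {c : Fin m → ℝ} {a : ℝ} (ha : 0 < a)
    (hc : d * ∑ i, c i ^ 2 ≤ a ^ 2) :
    ∫⁻ z : Fin m → Vec d, ENNReal.ofReal (Real.exp (‖∑ i, c i • z i‖ ^ 2 / (2 * a) ^ 2))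
      ∂(Measure.pi fun _ => stdGaussian (Vec d)) ≤ ENNReal.ofReal tailConst := by
  have hd' : (0 : ℝ) < d := by exact_mod_cast hd
  have hm : Measurable fun z : Fin m → Vec d => ∑ i, c i • z i :=
    Finset.measurable_sum _ fun i _ => (measurable_pi_apply i).const_smul (c i)
  -- The proxy a²/d dominates the true variance ∑ cᵢ² of each coordinate and stays positive even if
  -- all coefficients vanish.
  set C : NNReal := ⟨a ^ 2 / d, by positivity⟩ with hC
  have hCe : (C : ℝ) = a ^ 2 / d := rfl
  have hC0 : 0 < C := by
    have : (0 : ℝ) < a ^ 2 / d := by positivity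
    exact this
  have hle : ∑ i, c i ^ 2 ≤ a ^ 2 / d := by
    rw [le_div_iff₀ hd']
    linarith
  have hsub : ∀ j : Fin d, HasSubgaussianMGF (fun z : Fin m → Vec d => (∑ i, c i • z i) j) C
      (Measure.pi fun _ => stdGaussian (Vec d)) := fun j => by
    have h1 : ∀ i : Fin m, HasSubgaussianMGF (fun z : Fin m → Vec d => c i * z i j)
        (⟨c i ^ 2, sq_nonneg _⟩ * 1) (Measure.pi fun _ => stdGaussian (Vec d)) := fun i => by
      have h2 := (hasSubgaussianMGF_stdGaussian_apply (d := d) j).const_mul (c i)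
      have hp := measurePreserving_eval (fun _ : Fin m => stdGaussian (Vec d)) i
      exact HasSubgaussianMGF.of_map (X := fun z : Vec d => c i * z j)
        hp.measurable.aemeasurable (by rwa [hp.map_eq])
    have hind : iIndepFun (fun i (z : Fin m → Vec d) => c i * z i j)
        (Measure.pi fun _ => stdGaussian (Vec d)) :=
      iIndepFun_pi (X := fun i (z : Vec d) => c i * z j) fun i => by fun_prop
    have h3 := HasSubgaussianMGF.sum_of_iIndepFun hind (s := Finset.univ) fun i _ => h1 i
    have e : (fun z : Fin m → Vec d => (∑ i, c i • z i) j) = fun z => ∑ i, c i * z i j := by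
      funext z; simp
    rw [e]
    have hle' : ((∑ i, (⟨c i ^ 2, sq_nonneg _⟩ * 1 : NNReal) : NNReal) : ℝ) ≤ (C : ℝ) := by
      rw [hCe]
      refine le_trans (le_of_eq ?_) hle
      rw [NNReal.coe_sum]
      exact Finset.sum_congr rfl fun i _ => mul_one (c i ^ 2)
    refine ⟨h3.integrable_exp_mul, fun t => (h3.mgf_le t).trans (Real.exp_le_exp.2 ?_)⟩
    have := mul_le_mul_of_nonneg_right hle' (sq_nonneg t)
    linarith
  have h := lintegral_exp_norm_sq_le_of_hasSubgaussianMGF hd hm hC0 hsub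
  have e : √(4 * (C : ℝ) * d) = 2 * a := by
    rw [show (4 * (C : ℝ) * d) = (2 * a) ^ 2 by rw [hCe]; field_simp; norm_num]
    exact Real.sqrt_sq (by positivity)
  rwa [e] at h

end Server

/-! ### The server iterates -/

/-- This exhibits the server step as a perturbed gradient step for the weighted field, with all
client noises collected into one perturbation. -/
lemma fedSGD_succ {d m : ℕ} {𝒳 : Type u} {ρ : 𝒳 → Vec d → ℝ} {n : Fin m → ℕ} {η : ℝ}
    {w σ : Fin m → ℝ} {x : ∀ i, Fin (n i) → 𝒳} {z : Fin m → ℕ → Vec d} {init : Vec d} (k : ℕ) :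
    fedSGD ρ x η w σ z init (k + 1) = fedSGD ρ x η w σ z init k -
    η • ∑ i, w i • avgGrad ρ (x i) (fedSGD ρ x η w σ z init k) +
      -(η • ∑ i, (w i * σ i) • z i k) := by
  simp only [fedSGD, smul_add, Finset.sum_add_distrib, smul_smul]
  abel

section ServerPath

variable {d m : ℕ} {𝒳 : Type u} [MeasurableSpace 𝒳] {P : Measure 𝒳} {ρ : 𝒳 → Vec d → ℝ}
  {Θ : Set (Vec d)} {θ₀ : Vec d} {τ₁ τ₂ W C₁ C₂ : ℝ} {n : Fin m → ℕ}

/-- The aggregated Hessian is bounded below if the clients with a bad Hessian have little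
weight. -/
lemma Assumptions.inner_sum_avgHess_ge (hA : Assumptions P ρ Θ τ₁ τ₂ W C₁ C₂) (hτ₁ : 0 < τ₁)
    (hττ : τ₁ ≤ τ₂) (hn : ∀ i, 0 < n i) {w X : Fin m → ℝ} (hw : ∀ i, 0 ≤ w i)
    (hw1 : ∑ i, w i = 1) {L : ℝ} (hL : 100 * τ₂ / τ₁ ≤ L) (hX : ∀ i, 0 ≤ X i)
    (hwX : ∑ i, w i * X i ≤ 1) {x : ∀ i, Fin (n i) → 𝒳} {θ v : Vec d}
    (hlow : ∀ i, 97 / 100 * τ₁ * ‖v‖ ^ 2 ≤ inner ℝ v (avgHess ρ (x i) θ v) ∨ L ≤ X i) :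
    19 / 20 * τ₁ * ‖v‖ ^ 2 ≤ inner ℝ v ((∑ i, w i • avgHess ρ (x i) θ) v) := by
  have hτ₂ : 0 < τ₂ := hτ₁.trans_le hττ
  have hL0 : 0 < L := lt_of_lt_of_le (by positivity) hL
  have hc : 0 ≤ 97 / 100 * τ₁ + τ₂ := by positivity
  -- One inequality covers both cases: a good client satisfies it because the correction is
  -- nonnegative, and a bad one because `L ≤ X i` pushes the left side down to -τ₂. It is linear in
  -- `X i` and can be averaged.
  have h1 : ∀ i, (97 / 100 * τ₁ - (97 / 100 * τ₁ + τ₂) / L * X i) * ‖v‖ ^ 2 ≤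
      inner ℝ v (avgHess ρ (x i) θ v) := fun i => by
    rcases hlow i with h | h
    · refine le_trans (mul_le_mul_of_nonneg_right ?_ (sq_nonneg _)) h
      have : 0 ≤ (97 / 100 * τ₁ + τ₂) / L * X i := mul_nonneg (div_nonneg hc hL0.le) (hX i)
      linarith
    · have h2 : (97 / 100 * τ₁ + τ₂) ≤ (97 / 100 * τ₁ + τ₂) / L * X i := by
        have e : (97 / 100 * τ₁ + τ₂) / L * X i = (97 / 100 * τ₁ + τ₂) * X i / L := by ring
        rw [e, le_div_iff₀ hL0]
        exact mul_le_mul_of_nonneg_left h hc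
      have h3 : -(τ₂ * ‖v‖ ^ 2) ≤ inner ℝ v (avgHess ρ (x i) θ v) := by
        refine neg_le_of_abs_le ((abs_real_inner_le_norm _ _).trans ?_)
        have h4 := (avgHess ρ (x i) θ).le_opNorm v
        have h5 := (hA.regularField_avgGrad (hn i) (x i)).bound θ
        calc ‖v‖ * ‖avgHess ρ (x i) θ v‖ ≤ ‖v‖ * (τ₂ * ‖v‖) := by
              gcongr
              exact h4.trans (by gcongr)
          _ = τ₂ * ‖v‖ ^ 2 := by ring
      refine le_trans ?_ h3
      rw [← neg_mul]
      exact mul_le_mul_of_nonneg_right (by linarith) (sq_nonneg _)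
  have h6 : inner ℝ v ((∑ i, w i • avgHess ρ (x i) θ) v) =
      ∑ i, w i * inner ℝ v (avgHess ρ (x i) θ v) := by
    simp [inner_sum, inner_smul_right]
  rw [h6]
  refine le_trans ?_ (Finset.sum_le_sum fun i _ => mul_le_mul_of_nonneg_left (h1 i) (hw i))
  have h7 : ∑ i, w i * ((97 / 100 * τ₁ - (97 / 100 * τ₁ + τ₂) / L * X i) * ‖v‖ ^ 2) =
      (97 / 100 * τ₁ - (97 / 100 * τ₁ + τ₂) / L * ∑ i, w i * X i) * ‖v‖ ^ 2 := by
    have e : ∀ i, w i * ((97 / 100 * τ₁ - (97 / 100 * τ₁ + τ₂) / L * X i) * ‖v‖ ^ 2) =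
        97 / 100 * τ₁ * ‖v‖ ^ 2 * w i -
          (97 / 100 * τ₁ + τ₂) / L * ‖v‖ ^ 2 * (w i * X i) := fun i => by ring
    simp only [e]
    rw [Finset.sum_sub_distrib, ← Finset.mul_sum, ← Finset.mul_sum, hw1]
    ring
  rw [h7]
  refine mul_le_mul_of_nonneg_right ?_ (sq_nonneg _)
  -- The numerator is at most 2τ₂ and L ≥ 100τ₂/τ₁; the loss 2/100 takes 97/100 down to 19/20.
  have h8 : (97 / 100 * τ₁ + τ₂) / L ≤ τ₁ / 50 := by
    rw [div_le_iff₀ hL0]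
    rw [div_le_iff₀ hτ₁] at hL
    linarith
  have h9 := mul_le_mul_of_nonneg_left hwX (div_nonneg hc hL0.le)
  linarith

variable {η : ℝ} {w σ : Fin m → ℝ} {x : ∀ i, Fin (n i) → 𝒳} {z : Fin m → ℕ → Vec d}
  {init : Vec d} {K : ℕ}

lemma Assumptions.norm_fedSGD_sub_le_two_pow (hA : Assumptions P ρ Θ τ₁ τ₂ W C₁ C₂)
    (hn : ∀ i, 0 < n i) (hw : ∀ i, 0 ≤ w i) (hw1 : ∑ i, w i = 1) (hη : 0 ≤ η)
    (hη₂ : η * τ₂ ≤ 1) (θ₀ : Vec d) :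
    ‖fedSGD ρ x η w σ z init K - θ₀‖ ≤ 2 ^ K * (‖init - θ₀‖ + ∑ k ∈ Finset.range K,
      η * (‖∑ i, w i • avgGrad ρ (x i) θ₀‖ + ‖∑ i, (w i * σ i) • z i k‖)) := by
  have h := (RegularField.sum_smul (s := Finset.univ)
    (fun i _ => hA.regularField_avgGrad (hn i) (x i)) (fun i _ => hw i)
    hw1).norm_iterate_sub_le_two_pow hη hη₂ (x := fedSGD ρ x η w σ z init)
    (ν := fun k => -(η • ∑ i, (w i * σ i) • z i k)) (K := K) (fun k _ => fedSGD_succ k) θ₀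
  simpa [fedSGD, norm_smul, abs_of_nonneg hη, mul_add] using h

lemma Assumptions.norm_fedSGD_sub_le (hA : Assumptions P ρ Θ τ₁ τ₂ W C₁ C₂)
    (hn : ∀ i, 0 < n i) (hw : ∀ i, 0 ≤ w i) (hw1 : ∑ i, w i = 1) (hη : 0 ≤ η)
    (hη₂ : η * τ₂ ≤ 1) {τ r : ℝ} (hτ : τ ≤ τ₂)
    (hlow : ∀ θ, ‖θ - θ₀‖ ≤ r → ∀ v : Vec d,
      τ * ‖v‖ ^ 2 ≤ inner ℝ v ((∑ i, w i • avgHess ρ (x i) θ) v))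
    (h0 : ‖init - θ₀‖ ≤ r) (hν : ∀ k < K, ‖∑ i, w i • avgGrad ρ (x i) θ₀‖ +
      ‖∑ i, (w i * σ i) • z i k‖ ≤ τ * r) :
    ‖fedSGD ρ x η w σ z init K - θ₀‖ ≤ (1 - η * τ) ^ K * ‖init - θ₀‖ +
      ∑ k ∈ Finset.range K, (1 - η * τ) ^ (K - 1 - k) *
        (η * (‖∑ i, w i • avgGrad ρ (x i) θ₀‖ + ‖∑ i, (w i * σ i) • z i k‖)) := by
  have h := ((RegularField.sum_smul (s := Finset.univ)
    (fun i _ => hA.regularField_avgGrad (hn i) (x i)) (fun i _ => hw i)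
    hw1).norm_iterate_sub_le hη hη₂ hτ hlow (x := fedSGD ρ x η w σ z init)
    (ν := fun k => -(η • ∑ i, (w i * σ i) • z i k)) (K := K) (fun k _ => fedSGD_succ k)
    (by simpa [fedSGD] using h0) fun k hk => by
      rw [norm_neg, norm_smul, Real.norm_of_nonneg hη, ← mul_add, mul_assoc]
      exact mul_le_mul_of_nonneg_left (hν k hk) hη).2
  simpa [fedSGD, norm_smul, abs_of_nonneg hη, mul_add] using h

lemma norm_sum_smul_sub_le {p : Fin m → ℝ} (hp : ∀ i, 0 ≤ p i) (hp1 : ∑ i, p i = 1)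
    (y : Fin m → Vec d) (θ₀ : Vec d) : ‖∑ i, p i • y i - θ₀‖ ≤ ∑ i, p i * ‖y i - θ₀‖ := by
  have e : ∑ i, p i • y i - θ₀ = ∑ i, p i • (y i - θ₀) := by
    simp only [smul_sub, Finset.sum_sub_distrib]
    rw [← Finset.sum_smul, hp1, one_smul]
  rw [e]
  refine norm_sum_le_of_le _ fun i _ => ?_
  rw [norm_smul, Real.norm_of_nonneg (hp i)]

lemma sum_mul_le_add {p Y X : Fin m → ℝ} (hp : ∀ i, 0 ≤ p i) (hp1 : ∑ i, p i = 1) {c : ℝ}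
    (h : ∀ i, Y i ≤ c + X i) : ∑ i, p i * Y i ≤ c + ∑ i, p i * X i := by
  calc ∑ i, p i * Y i ≤ ∑ i, p i * (c + X i) :=
        Finset.sum_le_sum fun i _ => mul_le_mul_of_nonneg_left (h i) (hp i)
    _ = c + ∑ i, p i * X i := by
        simp only [mul_add, Finset.sum_add_distrib, ← Finset.sum_mul, hp1, one_mul]

/-- The deterministic part of the analysis. -/
lemma Assumptions.norm_hybrid_sub_le (hA : Assumptions P ρ Θ τ₁ τ₂ W C₁ C₂) (hτ₁ : 0 < τ₁)
    (hττ : τ₁ ≤ τ₂) (hn : ∀ i, 0 < n i) {p X a : Fin m → ℝ} {Kl : Fin m → ℕ} {ηl r L : ℝ}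
    {zl : Fin m → ℕ → Vec d} (hw : ∀ i, 0 ≤ w i) (hw1 : ∑ i, w i = 1) (hp : ∀ i, 0 ≤ p i)
    (hp1 : ∑ i, p i = 1) (hη : 0 ≤ η) (hη₂ : η * τ₂ ≤ 1) (hL : 100 * τ₂ / τ₁ ≤ L)
    (hr : 0 ≤ r) (hX : ∀ i, 0 ≤ X i)
    (hcl : ∀ i, ClientGood ρ θ₀ τ₁ ηl (a i) r (Kl i) (x i) (zl i) ∨
      L * (1 + ‖avgGrad ρ (x i) θ₀‖ + ‖localGD ρ (x i) ηl (a i) (zl i) (Kl i) - θ₀‖) ≤ X i)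
    (hinit : init = ∑ i, p i • localGD ρ (x i) ηl (a i) (zl i) (Kl i)) :
    ‖fedSGD ρ x η w σ z init K - θ₀‖ ≤ 2 ^ K * (r / 2 + ∑ i, p i * X i +
        ∑ k ∈ Finset.range K, η * (19 / 20 * τ₁ * r / 8 + ∑ i, w i * X i +
          ‖∑ i, (w i * σ i) • z i k‖)) ∧
      (2 ≤ r → 8 ≤ 19 / 20 * τ₁ * r → ∑ i, p i * X i ≤ 1 → ∑ i, w i * X i ≤ 1 →
        (∀ k < K, ‖∑ i, (w i * σ i) • z i k‖ ≤ 19 / 20 * τ₁ * r / 4) →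
        ‖fedSGD ρ x η w σ z init K - θ₀‖ ≤ (1 - η * (19 / 20 * τ₁)) ^ K *
            ∑ i, p i * ‖localGD ρ (x i) ηl (a i) (zl i) (Kl i) - θ₀‖ +
          ∑ k ∈ Finset.range K, (1 - η * (19 / 20 * τ₁)) ^ (K - 1 - k) *
            (η * (‖∑ i, w i • avgGrad ρ (x i) θ₀‖ + ‖∑ i, (w i * σ i) • z i k‖))) := by
  have hτ₂ : 0 < τ₂ := hτ₁.trans_le hττ
  have hL1 : 1 ≤ L := by
    rw [div_le_iff₀ hτ₁] at hL
    by_contra! h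
    nlinarith
  have hU : ∀ i, ‖avgGrad ρ (x i) θ₀‖ ≤ 19 / 20 * τ₁ * r / 8 + X i := fun i => by
    rcases hcl i with h | h
    · linarith [h.grad_le, hX i]
    · have h1 : 0 ≤ ‖avgGrad ρ (x i) θ₀‖ := norm_nonneg _
      have h2 : 0 ≤ ‖localGD ρ (x i) ηl (a i) (zl i) (Kl i) - θ₀‖ := norm_nonneg _
      have h3 : 0 ≤ 19 / 20 * τ₁ * r / 8 := by positivity
      nlinarith
  have hY : ∀ i, ‖localGD ρ (x i) ηl (a i) (zl i) (Kl i) - θ₀‖ ≤ r / 2 + X i := fun i => by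
    rcases hcl i with h | h
    · linarith [h.dist_le, hX i]
    · have h1 : 0 ≤ ‖avgGrad ρ (x i) θ₀‖ := norm_nonneg _
      have h2 : 0 ≤ ‖localGD ρ (x i) ηl (a i) (zl i) (Kl i) - θ₀‖ := norm_nonneg _
      nlinarith
  have hE : ‖init - θ₀‖ ≤ ∑ i, p i * ‖localGD ρ (x i) ηl (a i) (zl i) (Kl i) - θ₀‖ := by
    rw [hinit]
    exact norm_sum_smul_sub_le hp hp1 _ θ₀
  have hE' := hE.trans (sum_mul_le_add hp hp1 hY)
  have hG : ‖∑ i, w i • avgGrad ρ (x i) θ₀‖ ≤ 19 / 20 * τ₁ * r / 8 + ∑ i, w i * X i := by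
    refine le_trans (norm_sum_le_of_le (f := fun i => w i • avgGrad ρ (x i) θ₀) _
      fun i _ => ?_) (sum_mul_le_add hw hw1 hU)
    rw [norm_smul, Real.norm_of_nonneg (hw i)]
  refine ⟨?_, fun hr2 hr8 hpX hwX hξ => ?_⟩
  · refine (hA.norm_fedSGD_sub_le_two_pow hn hw hw1 hη hη₂ θ₀).trans ?_
    gcongr with k _
  -- Invariance of the ball: the start is within r/2 + 1 ≤ r. The gradient is at most τr/8 + 1 ≤
  -- τr/4 and the noise at most τr/4, which is within the allowed τr.
  · have h := hA.norm_fedSGD_sub_le (z := z) (K := K) (σ := σ) (init := init) hn hw hw1 hη hη₂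
      (τ := 19 / 20 * τ₁) (r := r) (by linarith)
      (fun θ hθ v => hA.inner_sum_avgHess_ge hτ₁ hττ hn hw hw1 hL hX hwX fun i => by
        rcases hcl i with h | h
        · exact Or.inl (h.hess_low θ hθ v)
        · refine Or.inr (le_trans ?_ h)
          have h1 : 0 ≤ ‖avgGrad ρ (x i) θ₀‖ := norm_nonneg _
          have h2 : 0 ≤ ‖localGD ρ (x i) ηl (a i) (zl i) (Kl i) - θ₀‖ := norm_nonneg _
          nlinarith)
      (by linarith) (fun k hk => by linarith [hξ k hk])
    refine h.trans (add_le_add (mul_le_mul_of_nonneg_left hE (pow_nonneg ?_ K)) le_rfl)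
    have : η * (19 / 20 * τ₁) ≤ η * τ₂ := by gcongr; linarith
    linarith

end ServerPath

lemma sum_one_sub_pow_le {x : ℝ} (hx : 0 < x) (hx1 : 0 ≤ 1 - x) (K : ℕ) :
    ∑ k ∈ Finset.range K, (1 - x) ^ (K - 1 - k) ≤ 1 / x := by
  rw [Finset.sum_range_reflect (fun k => (1 - x) ^ k) K, le_div_iff₀ hx]
  have h := geom_sum_mul_neg (1 - x) K
  rw [show 1 - (1 - x) = x by ring] at h
  rw [h]
  linarith [pow_nonneg hx1 K]

/-! ### Mean square error of a client -/

section ClientError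

variable {d n : ℕ} {𝒳 : Type u} [MeasurableSpace 𝒳] {P : Measure 𝒳} [IsProbabilityMeasure P]
  {ρ : 𝒳 → Vec d → ℝ} {Θ : Set (Vec d)} {θ₀ : Vec d} {τ₁ τ₂ W C₁ C₂ : ℝ}

lemma Assumptions.lpBound_two_avgGrad (hA : Assumptions P ρ Θ τ₁ τ₂ W C₁ C₂)
    (hT : IsTarget P ρ Θ θ₀) (hC₁ : 0 < C₁) (hd : 0 < d) (hn : 0 < n) {a : ℝ} (ha : 0 ≤ a)
    (h : (gradCov P ρ θ₀).trace / n ≤ a ^ 2) :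
    LpBound (clientLaw P d n) 2 (fun ω => ‖avgGrad ρ ω.1 θ₀‖) a := by
  obtain ⟨h1, -, h2⟩ := hA.integral_avgGrad_sq hT hC₁ hd hn
  exact (LpBound.of_integral_sq h1.aestronglyMeasurable.norm ha
    (h1.integrable_norm_pow two_ne_zero) (h2.trans_le h)).comp
    (measurePreserving_clientLaw_fst P d n)

lemma lpBound_two_noise (t : ℕ) : LpBound (clientLaw P d n) 2 (fun ω => ‖ω.2 t‖) √d :=
  (LpBound.of_integral_sq memLp_stdGaussian.aestronglyMeasurable.norm (Real.sqrt_nonneg _)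
    (memLp_stdGaussian.integrable_norm_pow two_ne_zero) (by
      rw [integral_norm_sq_stdGaussian, Real.sq_sqrt (by positivity)])).comp
    (measurePreserving_clientLaw_noise P d n t)

/-- On good paths the linear convergence estimate applies, and elsewhere the excess `X` dominates
the error. Minkowski and the geometric series then give contracted start, stationary error and
excess as three separate terms. -/
lemma Assumptions.lpBound_localGD (hA : Assumptions P ρ Θ τ₁ τ₂ W C₁ C₂)
    (hT : IsTarget P ρ Θ θ₀) (hC₁ : 0 < C₁) (hd : 0 < d) (hn : 0 < n) (hτ₁ : 0 < τ₁)
    (hττ : τ₁ ≤ τ₂) {η a r L e g : ℝ} {K : ℕ} (hη : 0 < η) (hη₂ : η * τ₂ ≤ 1) (ha : 0 ≤ a)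
    (hL : 1 ≤ L) {X : (Fin n → 𝒳) × (ℕ → Vec d) → ℝ} (hX0 : ∀ ω, 0 ≤ X ω)
    (hX : LpBound (clientLaw P d n) 2 X e)
    (hcl : ∀ ω, ClientGood ρ θ₀ τ₁ η a r K ω.1 ω.2 ∨
      L * (1 + ‖avgGrad ρ ω.1 θ₀‖ + ‖localGD ρ ω.1 η a ω.2 K - θ₀‖) ≤ X ω)
    (hg : 0 ≤ g) (h : (gradCov P ρ θ₀).trace / n ≤ g ^ 2) :
    LpBound (clientLaw P d n) 2 (fun ω => ‖localGD ρ ω.1 η a ω.2 K - θ₀‖)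
      ((1 - η * (19 / 20 * τ₁)) ^ K * ‖θ₀‖ + (g + a * √d / η) / (19 / 20 * τ₁) + e) := by
  have h12 : (1 : ENNReal) ≤ 2 := one_le_two
  have hx : 0 < η * (19 / 20 * τ₁) := by positivity
  have hq : 0 ≤ 1 - η * (19 / 20 * τ₁) := by
    have : η * (19 / 20 * τ₁) ≤ η * τ₂ := by gcongr; linarith
    linarith
  have hU := hA.lpBound_two_avgGrad hT hC₁ hd hn hg h
  have hs := LpBound.sum (μ := clientLaw P d n) h12 (Finset.range K)
    (f := fun t ω => (1 - η * (19 / 20 * τ₁)) ^ (K - 1 - t) *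
      (η * ‖avgGrad ρ ω.1 θ₀‖ + a * ‖ω.2 t‖))
    (a := fun t => (1 - η * (19 / 20 * τ₁)) ^ (K - 1 - t) * (η * g + a * √d))
    fun t _ => ((hU.const_mul hη.le).add h12 ((lpBound_two_noise t).const_mul ha)).const_mul
      (pow_nonneg hq _)
  have hc := LpBound.const (μ := clientLaw P d n) (p := 2) two_ne_zero
    (c := (1 - η * (19 / 20 * τ₁)) ^ K * ‖θ₀‖) (mul_nonneg (pow_nonneg hq _) (norm_nonneg _))
  have hS := (hc.add h12 hs).add h12 hX
  have hm : Measurable fun ω : (Fin n → 𝒳) × (ℕ → Vec d) => ‖localGD ρ ω.1 η a ω.2 K - θ₀‖ :=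
    ((hA.measurable_localGD measurable_fst measurable_snd η a K).sub_const θ₀).norm
  refine (hS.mono hm.aestronglyMeasurable fun ω => ?_).weaken ?_
  · rw [abs_norm]
    rcases hcl ω with h | h
    · exact h.dist_le_sum.trans (le_add_of_nonneg_right (hX0 ω))
    · have h1 : 0 ≤ ‖avgGrad ρ ω.1 θ₀‖ := norm_nonneg _
      have h2 : 0 ≤ ‖localGD ρ ω.1 η a ω.2 K - θ₀‖ := norm_nonneg _
      have h3 : 1 + ‖avgGrad ρ ω.1 θ₀‖ + ‖localGD ρ ω.1 η a ω.2 K - θ₀‖ ≤ X ω :=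
        le_trans (le_mul_of_one_le_left (by positivity) hL) h
      have h4 : 0 ≤ (1 - η * (19 / 20 * τ₁)) ^ K * ‖θ₀‖ +
          ∑ t ∈ Finset.range K, (1 - η * (19 / 20 * τ₁)) ^ (K - 1 - t) *
            (η * ‖avgGrad ρ ω.1 θ₀‖ + a * ‖ω.2 t‖) :=
        add_nonneg (mul_nonneg (pow_nonneg hq _) (norm_nonneg _))
          (Finset.sum_nonneg fun t _ => mul_nonneg (pow_nonneg hq _) (by positivity))
      linarith
  · rw [← Finset.sum_mul]
    have h5 : (∑ t ∈ Finset.range K, (1 - η * (19 / 20 * τ₁)) ^ (K - 1 - t)) *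
        (η * g + a * √d) ≤ 1 / (η * (19 / 20 * τ₁)) * (η * g + a * √d) := by
      gcongr
      exact sum_one_sub_pow_le hx hq K
    have h6 : 1 / (η * (19 / 20 * τ₁)) * (η * g + a * √d) =
        (g + a * √d / η) / (19 / 20 * τ₁) := by
      field_simp
    linarith

end ClientError

/-! ### Mean square error of the server -/

section ServerError

variable {d m : ℕ} {n : Fin m → ℕ} {𝒳 : Type u} [MeasurableSpace 𝒳] {P : Measure 𝒳}
  [IsProbabilityMeasure P] {ρ : 𝒳 → Vec d → ℝ} {Θ : Set (Vec d)} {θ₀ : Vec d}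
  {τ₁ τ₂ W C₁ C₂ : ℝ} {w p c : Fin m → ℝ} {X : ∀ i, (Fin (n i) → 𝒳) × (ℕ → Vec d) → ℝ}
  {q K : ℕ}

/-- The event that a weighted average of client excesses is large. -/
lemma meas_one_lt_sum_excess_le (hX : ∀ i, Measurable (X i)) (hX0 : ∀ i ω, 0 ≤ X i ω)
    (hXb : ∀ i, LpBound (clientLaw P d (n i)) q (X i) ((n i : ℝ) ^ 4)⁻¹) (hq : q ≠ 0)
    (hn2 : ∀ i, 2 ≤ n i) (hp : ∀ i, 0 ≤ p i) (hp1 : ∑ i, p i = 1) {Λ : ℝ} (hΛ : 0 < Λ)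
    (hpΛ : ∀ i, p i ≤ (n i : ℝ) ^ 3 / Λ) :
    sampleLaw P d n {ω | 1 < ∑ i, p i * X i (ω.1 i, ω.2.1 i)} ≤
      ENNReal.ofReal (m * (1 / √Λ) ^ q + Real.exp (-(√Λ / 2))) := by
  have hn2' : ∀ i, (2 : ℝ) ≤ n i := fun i => by exact_mod_cast hn2 i
  have h := pi_meas_one_lt_sum_le (κ := fun i => clientLaw P d (n i)) hX hX0 hp hΛ hq hXb
    (fun i => by
      have h1 : (0 : ℝ) < n i := by linarith [hn2' i]
      calc p i * ((n i : ℝ) ^ 4)⁻¹ ≤ (n i : ℝ) ^ 3 / Λ * ((n i : ℝ) ^ 4)⁻¹ := by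
            gcongr
            exact hpΛ i
        _ = 1 / Λ * (1 / n i) := by field_simp
        _ ≤ 1 / Λ * 1 := by
            gcongr
            rw [div_le_one h1]
            linarith [hn2' i]
        _ = 1 / Λ := mul_one _)
    (by
      calc ∑ i, p i * ((n i : ℝ) ^ 4)⁻¹ ≤ ∑ i, p i * (1 / 4) := by
            refine Finset.sum_le_sum fun i _ => mul_le_mul_of_nonneg_left ?_ (hp i)
            rw [one_div]
            refine inv_anti₀ (by norm_num) ?_
            calc (4 : ℝ) ≤ 2 ^ 4 := by norm_num
              _ ≤ (n i : ℝ) ^ 4 := pow_le_pow_left₀ (by norm_num) (hn2' i) 4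
        _ = 1 / 4 := by rw [← Finset.sum_mul, hp1, one_mul])
  rw [Fintype.card_fin] at h
  have hm : MeasurableSet {x : ∀ i, (Fin (n i) → 𝒳) × (ℕ → Vec d) | 1 < ∑ i, p i * X i (x i)} :=
    measurableSet_lt measurable_const (Finset.measurable_sum _ fun i _ =>
      ((hX i).comp (measurable_pi_apply i)).const_mul (p i))
  exact ((measurePreserving_clients d P n).measure_preimage hm.nullMeasurableSet).le.trans h

/-- The event that the server noise is large at some step. -/
lemma meas_exists_serverNoise_ge (hd : 0 < d) {b : ℝ} (hb : 0 < b)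
    (hc : d * ∑ i, c i ^ 2 ≤ b ^ 2) {h : ℝ} (hh : 0 ≤ h) (K : ℕ) :
    sampleLaw P d n {ω | ∃ k < K, h ≤ ‖∑ i, c i • ω.2.2 i k‖} ≤
      ENNReal.ofReal (K * (tailConst * Real.exp (-(h ^ 2 / (2 * b) ^ 2)))) := by
  have hT := one_le_tailConst
  have hm : Measurable fun z : Fin m → Vec d => ‖∑ i, c i • z i‖ :=
    (Finset.measurable_sum _ fun i _ => (measurable_pi_apply i).const_smul (c i)).norm
  have h1 : ∀ k, sampleLaw P d n {ω | h ≤ ‖∑ i, c i • ω.2.2 i k‖} ≤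
      ENNReal.ofReal (tailConst * Real.exp (-(h ^ 2 / (2 * b) ^ 2))) := fun k =>
    ((measurePreserving_serverNoise d P n k).measure_preimage
      (s := {z : Fin m → Vec d | h ≤ ‖∑ i, c i • z i‖})
      (measurableSet_le measurable_const hm).nullMeasurableSet).le.trans
      (meas_ge_le_of_lintegral_exp_sq hm (by positivity) (lintegral_exp_sum_noise_le hd hb hc) hh)
  have e : {ω : Sample 𝒳 d n | ∃ k < K, h ≤ ‖∑ i, c i • ω.2.2 i k‖} =
      ⋃ k ∈ Finset.range K, {ω | h ≤ ‖∑ i, c i • ω.2.2 i k‖} := by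
    ext ω; simp
  rw [e]
  refine (measure_biUnion_finset_le _ _).trans ((Finset.sum_le_sum fun k _ => h1 k).trans ?_)
  rw [Finset.sum_const, Finset.card_range, ENNReal.ofReal_mul (p := (K : ℝ)) (by positivity), nsmul_eq_mul,
    ENNReal.ofReal_natCast]

/-- A weighted average of client excesses has bounded moments. -/
lemma lpBound_sum_excess (hXb : ∀ i, LpBound (clientLaw P d (n i)) q (X i) ((n i : ℝ) ^ 4)⁻¹)
    (hq : 4 ≤ q) (hn : ∀ i, 0 < n i) (hp : ∀ i, 0 ≤ p i) (hp1 : ∑ i, p i = 1) :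
    LpBound (sampleLaw P d n) 4 (fun ω => ∑ i, p i * X i (ω.1 i, ω.2.1 i)) 1 := by
  have h4q : (4 : ENNReal) ≤ q := by exact_mod_cast hq
  have h14 : (1 : ENNReal) ≤ 4 := by norm_num
  have h := LpBound.sum (μ := sampleLaw P d n) h14 Finset.univ
    (f := fun i ω => p i * X i (ω.1 i, ω.2.1 i)) (a := fun i => p i * ((n i : ℝ) ^ 4)⁻¹)
    fun i _ => ((((hXb i).exponent_le h4q).comp
      (measurePreserving_eval (fun i => clientLaw P d (n i)) i)).comp
      (measurePreserving_clients d P n)).const_mul (hp i)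
  refine h.weaken ?_
  rw [← hp1]
  refine Finset.sum_le_sum fun i _ => mul_le_of_le_one_right (hp i) (inv_le_one_of_one_le₀ ?_)
  exact one_le_pow₀ (by exact_mod_cast hn i)

lemma lpBound_four_serverNoise (hd : 0 < d) {b : ℝ} (hb : 0 < b)
    (hc : d * ∑ i, c i ^ 2 ≤ b ^ 2) (k : ℕ) :
    LpBound (sampleLaw P d n) 4 (fun ω => ‖∑ i, c i • ω.2.2 i k‖) (2 * b * momentConst 2) := by
  have hm : Measurable fun z : Fin m → Vec d => ‖∑ i, c i • z i‖ :=
    (Finset.measurable_sum _ fun i _ => (measurable_pi_apply i).const_smul (c i)).norm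
  have h := (lpBound_of_lintegral_exp_sq hm (by positivity)
    (lintegral_exp_sum_noise_le hd hb hc) (by positivity) two_ne_zero).comp
    (measurePreserving_serverNoise d P n k)
  exact_mod_cast h

end ServerError

/-! ### The exceptional event of the server and the mean square error of the output -/

section ServerError

variable {d m : ℕ} {n : Fin m → ℕ} {𝒳 : Type u} [MeasurableSpace 𝒳] {P : Measure 𝒳}
  [IsProbabilityMeasure P] {ρ : 𝒳 → Vec d → ℝ} {Θ : Set (Vec d)} {θ₀ : Vec d}
  {τ₁ τ₂ W C₁ C₂ : ℝ} {w p σ : Fin m → ℝ} {X : ∀ i, (Fin (n i) → 𝒳) × (ℕ → Vec d) → ℝ}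
  {q K : ℕ}

/-- The exceptional event: a weighted average of client excesses exceeds `1`, or the server noise
exceeds `h` at some step. -/
def badEvent (d : ℕ) {n : Fin m → ℕ} (X : ∀ i, (Fin (n i) → 𝒳) × (ℕ → Vec d) → ℝ)
    (p w c : Fin m → ℝ) (h : ℝ) (K : ℕ) : Set (Sample 𝒳 d n) :=
  {ω | 1 < ∑ i, p i * X i (ω.1 i, ω.2.1 i)} ∪ {ω | 1 < ∑ i, w i * X i (ω.1 i, ω.2.1 i)} ∪
    {ω | ∃ k < K, h ≤ ‖∑ i, c i • ω.2.2 i k‖}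

lemma measurable_serverNoise (c : Fin m → ℝ) (k : ℕ) :
    Measurable fun ω : Sample 𝒳 d n => ‖∑ i, c i • ω.2.2 i k‖ :=
  (Finset.measurable_sum _ fun i _ => ((measurable_pi_apply k).comp ((measurable_pi_apply i).comp
    (measurable_snd.comp measurable_snd))).const_smul (c i)).norm

lemma measurable_sum_excess (hX : ∀ i, Measurable (X i)) (p : Fin m → ℝ) :
    Measurable fun ω : Sample 𝒳 d n => ∑ i, p i * X i (ω.1 i, ω.2.1 i) :=
  Finset.measurable_sum _ fun i _ => ((hX i).comp (((measurable_pi_apply i).comp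
    measurable_fst).prodMk ((measurable_pi_apply i).comp
      (measurable_fst.comp measurable_snd)))).const_mul (p i)

lemma measurableSet_badEvent (hX : ∀ i, Measurable (X i)) (c : Fin m → ℝ) (h : ℝ) :
    MeasurableSet (badEvent d X p w c h K) := by
  refine ((measurableSet_lt measurable_const (measurable_sum_excess hX p)).union
    (measurableSet_lt measurable_const (measurable_sum_excess hX w))).union ?_
  have e : {ω : Sample 𝒳 d n | ∃ k < K, h ≤ ‖∑ i, c i • ω.2.2 i k‖} =
      ⋃ k ∈ Finset.range K, {ω | h ≤ ‖∑ i, c i • ω.2.2 i k‖} := by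
    ext ω; simp
  rw [e]
  exact Finset.measurableSet_biUnion _ fun k _ =>
    measurableSet_le measurable_const (measurable_serverNoise c k)

/-- The conditions on the weights `w` of the server, the weights `p` of the initial average and
the noise scales `σ` under which the exceptional event is unlikely. -/
structure ServerRegime (n : Fin m → ℕ) (d : ℕ) (w p σ : Fin m → ℝ) (Λ b : ℝ) : Prop where
  two_le : ∀ i, 2 ≤ n i
  w_nonneg : ∀ i, 0 ≤ w i
  w_sum : ∑ i, w i = 1
  p_nonneg : ∀ i, 0 ≤ p i
  p_sum : ∑ i, p i = 1
  Λ_pos : 0 < Λ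
  w_le : ∀ i, w i ≤ (n i : ℝ) ^ 3 / Λ
  p_le : ∀ i, p i ≤ (n i : ℝ) ^ 3 / Λ
  b_pos : 0 < b
  noise_le : d * ∑ i, (w i * σ i) ^ 2 ≤ b ^ 2

lemma ServerRegime.pos {Λ b : ℝ} (h : ServerRegime n d w p σ Λ b) (i : Fin m) : 0 < n i :=
  lt_of_lt_of_le two_pos (h.two_le i)

lemma meas_badEvent_le {Λ b : ℝ} (hR : ServerRegime n d w p σ Λ b) (hd : 0 < d)
    (hX : ∀ i, Measurable (X i)) (hX0 : ∀ i ω, 0 ≤ X i ω)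
    (hXb : ∀ i, LpBound (clientLaw P d (n i)) q (X i) ((n i : ℝ) ^ 4)⁻¹) (hq : q ≠ 0)
    {h : ℝ} (hh : 0 ≤ h) :
    sampleLaw P d n (badEvent d X p w (fun i => w i * σ i) h K) ≤
      ENNReal.ofReal (2 * (m * (1 / √Λ) ^ q + Real.exp (-(√Λ / 2))) +
        K * (tailConst * Real.exp (-(h ^ 2 / (2 * b) ^ 2)))) := by
  have hT := one_le_tailConst
  have hΛ := hR.Λ_pos
  have h1 := meas_one_lt_sum_excess_le hX hX0 hXb hq hR.two_le hR.p_nonneg hR.p_sum hΛ hR.p_le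
  have h2 := meas_one_lt_sum_excess_le hX hX0 hXb hq hR.two_le hR.w_nonneg hR.w_sum hΛ hR.w_le
  have h3 := meas_exists_serverNoise_ge (n := n) (P := P) hd hR.b_pos hR.noise_le hh K
  rw [two_mul, ENNReal.ofReal_add (by positivity) (by positivity),
    ENNReal.ofReal_add (by positivity) (by positivity)]
  exact (measure_union_le _ _).trans (add_le_add ((measure_union_le _ _).trans
    (add_le_add h1 h2)) h3)

/-- The crude bound for the error on the exceptional event. -/
noncomputable def crudeBound (X : ∀ i, (Fin (n i) → 𝒳) × (ℕ → Vec d) → ℝ) (p w c : Fin m → ℝ)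
    (η h r : ℝ) (K : ℕ) (ω : Sample 𝒳 d n) : ℝ :=
  2 ^ K * (r / 2 + ∑ i, p i * X i (ω.1 i, ω.2.1 i) + ∑ k ∈ Finset.range K,
    η * (h / 2 + ∑ i, w i * X i (ω.1 i, ω.2.1 i) + ‖∑ i, c i • ω.2.2 i k‖))

lemma lpBound_crudeBound {Λ b : ℝ} (hR : ServerRegime n d w p σ Λ b) (hd : 0 < d)
    (hXb : ∀ i, LpBound (clientLaw P d (n i)) q (X i) ((n i : ℝ) ^ 4)⁻¹) (hq : 4 ≤ q)
    {η h r : ℝ} (hη : 0 ≤ η) (hh : 0 ≤ h) (hr : 0 ≤ r) :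
    LpBound (sampleLaw P d n) (2 * 2 : ℕ) (crudeBound X p w (fun i => w i * σ i) η h r K)
      (2 ^ K * (r / 2 + 1 + K * (η * (h / 2 + 1 + 2 * b * momentConst 2)))) := by
  have h14 : (1 : ENNReal) ≤ 4 := by norm_num
  have h04 : (4 : ENNReal) ≠ 0 := by norm_num
  have hp := lpBound_sum_excess hXb hq hR.pos hR.p_nonneg hR.p_sum
  have hw := lpBound_sum_excess hXb hq hR.pos hR.w_nonneg hR.w_sum
  have hs := LpBound.sum (μ := sampleLaw P d n) h14 (Finset.range K)
    (f := fun k ω => η * (h / 2 + ∑ i, w i * X i (ω.1 i, ω.2.1 i) +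
      ‖∑ i, (w i * σ i) • ω.2.2 i k‖))
    (a := fun _ => η * (h / 2 + 1 + 2 * b * momentConst 2)) fun k _ =>
      ((((LpBound.const h04 (c := h / 2) (by positivity)).add h14 hw).add h14
        (lpBound_four_serverNoise hd hR.b_pos hR.noise_le k)).const_mul hη)
  have hS := (((LpBound.const (μ := sampleLaw P d n) h04 (c := r / 2) (by positivity)).add h14
    hp).add h14 hs).const_mul (c := 2 ^ K) (by positivity)
  rw [Finset.sum_const, Finset.card_range, nsmul_eq_mul] at hS
  have e : ((2 * 2 : ℕ) : ENNReal) = 4 := by norm_num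
  rw [e]
  exact hS

/-- Hölder between L⁴ and L²: the probability enters with the power 1/4, which is why it is compared
with β⁴ and why fourth moments of the crude bound are needed. -/
lemma lpBound_indicator_crudeBound {Λ b β : ℝ} (hR : ServerRegime n d w p σ Λ b) (hd : 0 < d)
    (hX : ∀ i, Measurable (X i)) (hX0 : ∀ i ω, 0 ≤ X i ω)
    (hXb : ∀ i, LpBound (clientLaw P d (n i)) q (X i) ((n i : ℝ) ^ 4)⁻¹) (hq : 4 ≤ q)
    {η h r : ℝ} (hη : 0 ≤ η) (hh : 0 ≤ h) (hr : 0 ≤ r) (hβ : 0 ≤ β)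
    (hβ4 : 2 * (m * (1 / √Λ) ^ q + Real.exp (-(√Λ / 2))) +
        K * (tailConst * Real.exp (-(h ^ 2 / (2 * b) ^ 2))) ≤ β ^ 4) :
    LpBound (sampleLaw P d n) 2 ((badEvent d X p w (fun i => w i * σ i) h K).indicator
      (crudeBound X p w (fun i => w i * σ i) η h r K))
      (β * (2 ^ K * (r / 2 + 1 + K * (η * (h / 2 + 1 + 2 * b * momentConst 2))))) := by
  have h1 := (lpBound_crudeBound (K := K) hR hd hXb hq hη hh hr).indicator two_ne_zero
    (measurableSet_badEvent (p := p) (w := w) (K := K) hX (fun i => w i * σ i) h) hβ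
    ((meas_badEvent_le hR hd hX hX0 hXb (by omega) hh).trans (ENNReal.ofReal_le_ofReal hβ4))
  exact_mod_cast h1

lemma lpBound_two_serverNoise {b : ℝ} (hb : 0 ≤ b) {c : Fin m → ℝ} (hc : d * ∑ i, c i ^ 2 ≤ b ^ 2)
    (k : ℕ) : LpBound (sampleLaw P d n) 2 (fun ω => ‖∑ i, c i • ω.2.2 i k‖) b :=
  (lpBound_sum_noise c hb hc).comp (measurePreserving_serverNoise d P n k)

/-- The mean square error of the server iterates. -/
theorem Assumptions.lpBound_hybrid (hA : Assumptions P ρ Θ τ₁ τ₂ W C₁ C₂)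
    (hT : IsTarget P ρ Θ θ₀) (hC₁ : 0 < C₁) (hd : 0 < d) (hτ₁ : 0 < τ₁) (hττ : τ₁ ≤ τ₂)
    {Λ b β η ηl r L b₁ b₂ : ℝ} {a y : Fin m → ℝ} {Kl : Fin m → ℕ}
    (hR : ServerRegime n d w p σ Λ b) (hη : 0 < η) (hη₂ : η * τ₂ ≤ 1)
    (hL : 100 * τ₂ / τ₁ ≤ L) (hr : 2 ≤ r) (hr8 : 8 ≤ 19 / 20 * τ₁ * r)
    (hX : ∀ i, Measurable (X i)) (hX0 : ∀ i ω, 0 ≤ X i ω)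
    (hXb : ∀ i, LpBound (clientLaw P d (n i)) q (X i) ((n i : ℝ) ^ 4)⁻¹) (hq : 4 ≤ q)
    (hcl : ∀ i (ω : (Fin (n i) → 𝒳) × (ℕ → Vec d)),
      ClientGood ρ θ₀ τ₁ ηl (a i) r (Kl i) ω.1 ω.2 ∨
      L * (1 + ‖avgGrad ρ ω.1 θ₀‖ + ‖localGD ρ ω.1 ηl (a i) ω.2 (Kl i) - θ₀‖) ≤ X i ω)
    (hY : ∀ i, LpBound (clientLaw P d (n i)) 2
      (fun ω => ‖localGD ρ ω.1 ηl (a i) ω.2 (Kl i) - θ₀‖) (y i))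
    (hb₁ : 0 ≤ b₁) (hg : (gradCov P ρ θ₀).trace * ∑ i, w i ^ 2 / n i ≤ b₁ ^ 2)
    (hb₂ : 0 ≤ b₂) (hξ : d * ∑ i, (w i * σ i) ^ 2 ≤ b₂ ^ 2) (hβ : 0 ≤ β)
    (hβ4 : 2 * (m * (1 / √Λ) ^ q + Real.exp (-(√Λ / 2))) +
      K * (tailConst * Real.exp (-((19 / 20 * τ₁ * r / 4) ^ 2 / (2 * b) ^ 2))) ≤ β ^ 4) :
    LpBound (sampleLaw P d n) 2 (fun ω => ‖fedSGD ρ ω.1 η w σ ω.2.2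
      (∑ i, p i • localGD ρ (ω.1 i) ηl (a i) (ω.2.1 i) (Kl i)) K - θ₀‖)
      ((1 - η * (19 / 20 * τ₁)) ^ K * ∑ i, p i * y i + (b₁ + b₂) / (19 / 20 * τ₁) +
        β * (2 ^ K * (r / 2 + 1 + K * (η * (19 / 20 * τ₁ * r / 4 / 2 + 1 +
          2 * b * momentConst 2))))) := by
  have h12 : (1 : ENNReal) ≤ 2 := one_le_two
  have hx : 0 < η * (19 / 20 * τ₁) := by positivity
  have hr0 : 0 ≤ r := by linarith
  have hq0 : 0 ≤ 1 - η * (19 / 20 * τ₁) := by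
    have : η * (19 / 20 * τ₁) ≤ η * τ₂ := by gcongr; linarith
    linarith
  have hB := lpBound_indicator_crudeBound (K := K) hR hd hX hX0 hXb hq hη.le
    (h := 19 / 20 * τ₁ * r / 4) (r := r) (by positivity) hr0 hβ hβ4
  have hE := (LpBound.sum (μ := sampleLaw P d n) h12 Finset.univ
    (f := fun i ω => p i * ‖localGD ρ (ω.1 i) ηl (a i) (ω.2.1 i) (Kl i) - θ₀‖)
    (a := fun i => p i * y i) fun i _ => (((hY i).comp
      (measurePreserving_eval (fun i => clientLaw P d (n i)) i)).comp
      (measurePreserving_clients d P n)).const_mul (hR.p_nonneg i)).const_mul (pow_nonneg hq0 K)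
  have hG := hA.lpBound_sum_avgGrad hT hC₁ hd hR.pos hb₁ hg
  have hs := LpBound.sum (μ := sampleLaw P d n) h12 (Finset.range K)
    (f := fun k ω => (1 - η * (19 / 20 * τ₁)) ^ (K - 1 - k) *
      (η * (‖∑ i, w i • avgGrad ρ (ω.1 i) θ₀‖ + ‖∑ i, (w i * σ i) • ω.2.2 i k‖)))
    (a := fun k => (1 - η * (19 / 20 * τ₁)) ^ (K - 1 - k) * (η * (b₁ + b₂)))
    fun k _ => ((hG.add h12 (lpBound_two_serverNoise hb₂ hξ k)).const_mul hη.le).const_mul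
      (pow_nonneg hq0 _)
  have hS := (hE.add h12 hs).add h12 hB
  have hm : Measurable fun ω : Sample 𝒳 d n => ‖fedSGD ρ ω.1 η w σ ω.2.2
      (∑ i, p i • localGD ρ (ω.1 i) ηl (a i) (ω.2.1 i) (Kl i)) K - θ₀‖ := by
    refine ((hA.measurable_fedSGD measurable_fst (measurable_snd.comp measurable_snd)
      (Finset.measurable_sum _ fun i _ => ?_) η w σ K).sub_const θ₀).norm
    exact (hA.measurable_localGD ((measurable_pi_apply i).comp measurable_fst)
      ((measurable_pi_apply i).comp (measurable_fst.comp measurable_snd)) ηl (a i)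
      (Kl i)).const_smul (p i)
  refine (hS.mono hm.aestronglyMeasurable fun ω => ?_).weaken ?_
  · rw [abs_norm]
    obtain ⟨h1, h2⟩ := hA.norm_hybrid_sub_le (θ₀ := θ₀) (K := K) (z := ω.2.2) (σ := σ) hτ₁ hττ
      hR.pos (x := ω.1) (zl := ω.2.1) (X := fun i => X i (ω.1 i, ω.2.1 i)) hR.w_nonneg hR.w_sum
      hR.p_nonneg hR.p_sum hη.le hη₂ hL hr0 (fun i => hX0 i _)
      (fun i => hcl i (ω.1 i, ω.2.1 i)) rfl
    by_cases hω : ω ∈ badEvent d X p w (fun i => w i * σ i) (19 / 20 * τ₁ * r / 4) K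
    · rw [Set.indicator_of_mem hω]
      have e : 19 / 20 * τ₁ * r / 8 = 19 / 20 * τ₁ * r / 4 / 2 := by ring
      rw [e] at h1
      refine h1.trans (le_add_of_nonneg_left (add_nonneg (mul_nonneg (pow_nonneg hq0 _)
        (Finset.sum_nonneg fun i _ => mul_nonneg (hR.p_nonneg i) (norm_nonneg _)))
        (Finset.sum_nonneg fun k _ => mul_nonneg (pow_nonneg hq0 _) (by positivity))))
    · rw [Set.indicator_of_notMem hω, add_zero]
      simp only [badEvent, Set.mem_union, Set.mem_ofPred_eq, not_or, not_exists, not_and,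
        not_lt, not_le] at hω
      exact h2 hr hr8 hω.1.1 hω.1.2 fun k hk => (hω.2 k hk).le
  · rw [← Finset.sum_mul]
    have h5 : (∑ k ∈ Finset.range K, (1 - η * (19 / 20 * τ₁)) ^ (K - 1 - k)) *
        (η * (b₁ + b₂)) ≤ 1 / (η * (19 / 20 * τ₁)) * (η * (b₁ + b₂)) := by
      gcongr
      exact sum_one_sub_pow_le hx hq0 K
    have h6 : 1 / (η * (19 / 20 * τ₁)) * (η * (b₁ + b₂)) = (b₁ + b₂) / (19 / 20 * τ₁) := by
      field_simp
    linarith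

end ServerError

/-! ### The probability of the exceptional event -/

section Exceptional

/-- The fourth power of 1/√(κ√N) is 1/(κ²N). Raised to 4e + 2 and multiplied by m ≤ N it leaves
N^(-4e) with one spare factor 1/N, which absorbs the constants. -/
lemma one_div_sqrt_pow_le {κ N m : ℝ} (hκ : 0 < κ) (hN : 1 ≤ N) (hmN : m ≤ N) (e : ℕ)
    (hA : 12 * (1 / κ ^ 2) ^ (4 * e + 2) ≤ N) :
    2 * (m * (1 / √(κ * √N)) ^ (4 * (4 * e + 2))) ≤ (N ^ (4 * e))⁻¹ / 6 := by
  have hN0 : 0 < N := by linarith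
  have h1 : (1 / √(κ * √N)) ^ 4 = 1 / κ ^ 2 / N := by
    rw [one_div, inv_pow, show (√(κ * √N)) ^ 4 = ((√(κ * √N)) ^ 2) ^ 2 by ring,
      Real.sq_sqrt (by positivity), mul_pow, Real.sq_sqrt hN0.le]
    field_simp
  rw [pow_mul, h1, div_pow]
  have h2 : m * ((1 / κ ^ 2) ^ (4 * e + 2) / N ^ (4 * e + 2)) ≤
      N * ((1 / κ ^ 2) ^ (4 * e + 2) / N ^ (4 * e + 2)) := by gcongr
  have h3 : N * ((1 / κ ^ 2) ^ (4 * e + 2) / N ^ (4 * e + 2)) =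
      (1 / κ ^ 2) ^ (4 * e + 2) / N * (N ^ (4 * e))⁻¹ := by
    rw [pow_add N]
    field_simp
  have h4 : (1 / κ ^ 2) ^ (4 * e + 2) / N ≤ 1 / 12 := by
    rw [div_le_iff₀ hN0]
    linarith
  have h5 := mul_le_mul_of_nonneg_right h4 (show 0 ≤ (N ^ (4 * e))⁻¹ by positivity)
  linarith

/-- The exceptional event has a probability smaller than any given power of the sample size. -/
lemma eventually_meas_bad_le {κ c C T : ℝ} (hκ : 0 < κ) (hc : 0 < c) (hC : 0 ≤ C) (hT : 0 ≤ T)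
    (e : ℕ) : ∀ᶠ A : ℝ in Filter.atTop, ∀ N m K x : ℝ, A ≤ N → m ≤ N → K ≤ C * N →
      c * √N ≤ x → 2 * (m * (1 / √(κ * √N)) ^ (4 * (4 * e + 2)) + Real.exp (-(√(κ * √N) / 2))) +
        K * (T * Real.exp (-x)) ≤ ((N ^ e)⁻¹) ^ 4 := by
  obtain ⟨U, hU⟩ := Filter.eventually_atTop.1
    ((eventually_pow_mul_exp_le 6 (16 * e) (c := √κ / 2) (by positivity)).and
      ((eventually_pow_mul_exp_le (3 * (C * T)) (16 * e + 4) hc).and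
        (Filter.eventually_ge_atTop (1 : ℝ))))
  filter_upwards [Filter.eventually_ge_atTop (U ^ 4), Filter.eventually_ge_atTop 1,
    Filter.eventually_ge_atTop (12 * (1 / κ ^ 2) ^ (4 * e + 2)),
    Filter.eventually_ge_atTop (0 : ℝ)] with A hAU hA1 hA2 hA0 N m K x hAN hmN hK hx
  have hN1 : 1 ≤ N := by linarith
  have hN0 : 0 < N := by linarith
  -- The weakest decay is exp(-√κ N^(1/4)/2), so everything is expressed through u = N^(1/4).
  set u : ℝ := √√N with hu
  have hu2 : u ^ 2 = √N := Real.sq_sqrt (Real.sqrt_nonneg N)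
  have hu4 : u ^ 4 = N := by
    rw [show u ^ 4 = (u ^ 2) ^ 2 by ring, hu2, Real.sq_sqrt hN0.le]
  have hu0 : 0 ≤ u := Real.sqrt_nonneg _
  have hUu : U ≤ u := by
    by_contra! h
    have := pow_lt_pow_left₀ h hu0 (n := 4) (by norm_num)
    linarith
  obtain ⟨h1, -, -⟩ := hU U le_rfl
  have h1 := h1 u hUu
  obtain ⟨-, h2, hU1⟩ := hU U le_rfl
  have h2 := h2 u hUu
  have hu1 : 1 ≤ u := hU1.trans hUu
  have hNe : N ^ (4 * e) = u ^ (16 * e) := by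
    rw [← hu4, ← pow_mul]
    congr 1; ring
  have hNe0 : 0 < N ^ (4 * e) := by positivity
  have e1 : ((N ^ e)⁻¹) ^ 4 = (N ^ (4 * e))⁻¹ := by
    rw [inv_pow, ← pow_mul, mul_comm]
  have b1 := one_div_sqrt_pow_le hκ hN1 hmN e (hA2.trans hAN)
  have b2 : Real.exp (-(√(κ * √N) / 2)) ≤ (N ^ (4 * e))⁻¹ / 6 := by
    rw [Real.sqrt_mul hκ.le, ← hu, hNe, show √κ * u / 2 = √κ / 2 * u by ring]
    rw [inv_eq_one_div, div_div, le_div_iff₀ (by positivity)]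
    linarith
  have b3 : K * (T * Real.exp (-x)) ≤ (N ^ (4 * e))⁻¹ / 3 := by
    have h3 : Real.exp (-x) ≤ Real.exp (-(c * u)) := by
      have : c * u ≤ c * √N := by
        rw [← hu2]
        gcongr
        nlinarith
      gcongr
      linarith
    calc K * (T * Real.exp (-x)) ≤ C * N * (T * Real.exp (-(c * u))) := by gcongr
      _ ≤ (N ^ (4 * e))⁻¹ / 3 := by
        rw [inv_eq_one_div, div_div, le_div_iff₀ (by positivity), hNe, ← hu4]
        have : C * u ^ 4 * (T * Real.exp (-(c * u))) * (u ^ (16 * e) * 3) =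
            3 * (C * T) * u ^ (16 * e + 4) * Real.exp (-(c * u)) := by
          rw [pow_add]; ring
        linarith
  rw [e1]
  have : 0 < (N ^ (4 * e))⁻¹ := by positivity
  linarith

end Exceptional

/-! ### Bounds for the terms of the mean square error -/

section Terms

/-- The contribution of the exceptional event. -/
lemma eventually_crude_le {C ε : ℝ} (hε : 0 < ε) (p : ℕ) :
    ∀ᶠ A : ℝ in Filter.atTop, ∀ N F : ℝ, A ≤ N → F ≤ C * N ^ (p + 2) →
      (N ^ (p + 4))⁻¹ * F ≤ ε * √(1 / N) := by
  filter_upwards [Filter.eventually_ge_atTop (C / ε), Filter.eventually_ge_atTop 1] with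
    A hA hA1 N F hN hF
  have hN1 : 1 ≤ N := hA1.trans hN
  have hN0 : 0 < N := by linarith
  have h1 : 1 / N ≤ √(1 / N) := by
    refine Real.le_sqrt_of_sq_le ?_
    rw [pow_two]
    exact mul_le_of_le_one_right (by positivity) ((div_le_one hN0).2 hN1)
  calc (N ^ (p + 4))⁻¹ * F ≤ (N ^ (p + 4))⁻¹ * (C * N ^ (p + 2)) := by gcongr
    _ = C / N * (1 / N) := by
        rw [pow_add, pow_add]
        field_simp
    _ ≤ ε * (1 / N) := by
        gcongr
        rw [div_le_iff₀ hN0]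
        rw [div_le_iff₀ hε] at hA
        nlinarith
    _ ≤ ε * √(1 / N) := by gcongr

/-- Since 2^(2 log m/ℓ) = m^(2 log 2/ℓ), the crude growth factor of the server is polynomial in m,
rounding up costing one factor 2. -/
lemma two_pow_ceil_le {l : ℝ} (hl : 0 < l) {m K p : ℕ} (hm : 0 < m)
    (hK : K = ⌈2 * Real.log (m : ℝ) / l⌉₊) (hp : 2 * Real.log 2 / l ≤ p) :
    (K : ℝ) ≤ (2 / l + 1) * m ∧ (2 : ℝ) ^ K ≤ 2 * (m : ℝ) ^ p := by
  have hm1 : (1 : ℝ) ≤ m := by exact_mod_cast hm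
  have hlm : 0 ≤ Real.log m := Real.log_nonneg hm1
  have h1 : (K : ℝ) ≤ 2 * Real.log m / l + 1 := by
    rw [hK]
    exact (Nat.ceil_lt_add_one (by positivity)).le
  constructor
  · have h2 : Real.log m ≤ m := (Real.log_le_sub_one_of_pos (by linarith)).trans (by linarith)
    have h3 : 2 * Real.log m / l ≤ 2 / l * m := by
      rw [mul_div_right_comm]
      gcongr
    linarith
  · have h4 : Real.log 2 * K ≤ Real.log 2 + p * Real.log m := by
      have h5 : Real.log 2 * (2 * Real.log m / l) = 2 * Real.log 2 / l * Real.log m := by ring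
      have h6 := mul_le_mul_of_nonneg_right hp hlm
      have h7 := mul_le_mul_of_nonneg_left h1 (Real.log_nonneg one_le_two)
      rw [mul_add, h5] at h7
      linarith
    have h8 := Real.exp_le_exp.2 h4
    rw [Real.exp_add, mul_comm (Real.log 2), Real.exp_nat_mul, Real.exp_nat_mul,
      Real.exp_log two_pos, Real.exp_log (by linarith)] at h8
    exact h8

/-- The crude error bound grows polynomially in the total sample size. -/
lemma crude_le_pow {N r η τ τ₂ b M P2 K CK : ℝ} {p : ℕ} (hN : 1 ≤ N) (hr : 2 ≤ r) (hrN : r ≤ N)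
    (hτ : 0 ≤ τ) (hτ₂ : 0 < τ₂) (hττ : τ ≤ τ₂) (hη : 0 ≤ η) (hη₂ : η * τ₂ ≤ 1) (hb : b ≤ 5 * r)
    (hM : 0 ≤ M) (hP : P2 ≤ 2 * N ^ p) (hP0 : 0 ≤ P2) (hK0 : 0 ≤ K) (hK : K ≤ CK * N) :
    P2 * (r / 2 + 1 + K * (η * (τ * r / 4 / 2 + 1 + 2 * b * M))) ≤
      2 * (1 + CK * (1 + 1 / τ₂ * (1 + 10 * M))) * N ^ (p + 2) := by
  have hN0 : 0 < N := by linarith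
  have hr0 : 0 ≤ r := by linarith
  have hη1 : η ≤ 1 / τ₂ := by rwa [le_div_iff₀ hτ₂]
  have hCK : 0 ≤ CK * N := hK0.trans hK
  have h1 : η * (τ * r / 4 / 2 + 1 + 2 * b * M) ≤ (1 + 1 / τ₂ * (1 + 10 * M)) * N := by
    have h2 : η * (τ * r) ≤ N := by
      calc η * (τ * r) ≤ η * (τ₂ * r) := by gcongr
        _ = η * τ₂ * r := by ring
        _ ≤ 1 * r := by gcongr
        _ ≤ N := by linarith
    have h3 : η * (1 + 2 * b * M) ≤ 1 / τ₂ * ((1 + 10 * M) * N) := by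
      calc η * (1 + 2 * b * M) ≤ η * ((1 + 10 * M) * N) := by
            gcongr
            have h5 : b * M ≤ 5 * N * M := by
              gcongr
              linarith
            nlinarith
        _ ≤ _ := by gcongr
    have h6 : 0 ≤ η * (τ * r) := by positivity
    nlinarith
  have h7 : 0 ≤ (1 + 1 / τ₂ * (1 + 10 * M)) * N := by positivity
  have h8 : K * (η * (τ * r / 4 / 2 + 1 + 2 * b * M)) ≤
      CK * N * ((1 + 1 / τ₂ * (1 + 10 * M)) * N) :=
    (mul_le_mul_of_nonneg_left h1 hK0).trans (mul_le_mul_of_nonneg_right hK h7)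
  have h9 : r / 2 + 1 ≤ N ^ 2 := by nlinarith
  calc P2 * (r / 2 + 1 + K * (η * (τ * r / 4 / 2 + 1 + 2 * b * M)))
      ≤ P2 * (N ^ 2 + CK * N * ((1 + 1 / τ₂ * (1 + 10 * M)) * N)) := by gcongr
    _ ≤ 2 * N ^ p * (N ^ 2 + CK * N * ((1 + 1 / τ₂ * (1 + 10 * M)) * N)) := by
        gcongr
    _ = _ := by rw [pow_add]; ring

end Terms

/-! ### The configuration of the algorithm -/

/-- The numerical assumptions of the error bound; `t` stands for the trace of the covariance. -/
structure Config (τ₁ τ₂ s c A : ℝ) (d m : ℕ) (n K₁ : Fin m → ℕ) (K₂ : ℕ) (CB μ t : ℝ) :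
    Prop where
  one_le_dim : 1 ≤ d
  clients_pos : 0 < m
  CB_pos : 0 < CB
  μ_pos : 0 < μ
  le_trace : s ≤ t
  trace_le : t ≤ c * d
  local_steps : ∀ i, 4 * Real.log (n i : ℝ) / rateLog τ₁ τ₂ ≤ (K₁ i : ℝ)
  server_steps : K₂ = ⌈2 * Real.log (m : ℝ) / rateLog τ₁ τ₂⌉₊
  size_le : ∀ i, A * ((d : ℝ) * (1 + Real.log (d : ℝ)) + (K₁ i : ℝ)) ≤ (n i : ℝ)
  noise_le : ∀ i, A * (CB ^ 2 * (d : ℝ) * dimLog d n * (K₁ i : ℝ)) ≤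
    μ ^ 2 * (n i : ℝ) * min ((m : ℝ) ^ 3) (n i : ℝ)

namespace Config

variable {τ₁ τ₂ s c A : ℝ} {d m : ℕ} {n K₁ : Fin m → ℕ} {K₂ : ℕ} {CB μ t : ℝ}

lemma le_size (h : Config τ₁ τ₂ s c A d m n K₁ K₂ CB μ t) (hA : 2 ≤ A) (i : Fin m) :
    A ≤ n i ∧ A * d ≤ n i ∧ A * K₁ i ≤ n i := by
  have hd : (1 : ℝ) ≤ d := by exact_mod_cast h.one_le_dim
  have hl : 0 ≤ Real.log d := Real.log_nonneg hd
  have hK : (0 : ℝ) ≤ K₁ i := Nat.cast_nonneg _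
  have h1 := h.size_le i
  have h2 : A * (d * Real.log d) ≥ 0 := by positivity
  have h3 : A * K₁ i ≥ 0 := by positivity
  have h4 : A * 1 ≤ A * d := by gcongr
  refine ⟨?_, ?_, ?_⟩ <;> nlinarith

lemma one_le_steps (h : Config τ₁ τ₂ s c A d m n K₁ K₂ CB μ t) (hA : 2 ≤ A) (hτ₁ : 0 < τ₁)
    (hτ : τ₁ ≤ τ₂) (i : Fin m) : (1 : ℝ) ≤ K₁ i := by
  have h1 : (2 : ℝ) ≤ n i := hA.trans (h.le_size hA i).1
  have h2 : 0 < 4 * Real.log (n i : ℝ) / rateLog τ₁ τ₂ :=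
    div_pos (mul_pos (by norm_num) (Real.log_pos (by linarith))) (rateLog_pos hτ₁ hτ)
  have h3 : 0 < (K₁ i : ℝ) := h2.trans_le (h.local_steps i)
  exact_mod_cast h3

/-- The variance scale of the privacy noise. -/
noncomputable def noiseScale (CB μ : ℝ) (d : ℕ) (n : Fin m → ℕ) : ℝ :=
  CB ^ 2 * d * dimLog d n / μ ^ 2

lemma dimLog_nonneg : 0 ≤ dimLog d n := le_max_of_le_left (Nat.cast_nonneg d)

lemma noiseScale_nonneg : 0 ≤ noiseScale CB μ d n :=
  div_nonneg (mul_nonneg (by positivity) dimLog_nonneg) (sq_nonneg _)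

lemma noiseScale_le (h : Config τ₁ τ₂ s c A d m n K₁ K₂ CB μ t) (i : Fin m) :
    A * noiseScale CB μ d n * K₁ i ≤ n i * min ((m : ℝ) ^ 3) (n i : ℝ) := by
  have h1 := h.noise_le i
  have hμ := h.μ_pos
  have e : A * noiseScale CB μ d n * K₁ i =
      A * (CB ^ 2 * (d : ℝ) * dimLog d n * (K₁ i : ℝ)) / μ ^ 2 := by
    rw [noiseScale]; ring
  rw [e, div_le_iff₀ (by positivity)]
  linarith

/-- The noise scale does not depend on the client, so every client, in particular the smallest,
bounds it by its own squared size. This is what allows sample sizes to be compared across clients.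
-/
lemma noiseScale_le_sq (h : Config τ₁ τ₂ s c A d m n K₁ K₂ CB μ t) (hA : 2 ≤ A) (hτ₁ : 0 < τ₁)
    (hτ : τ₁ ≤ τ₂) (i : Fin m) : A * noiseScale CB μ d n ≤ (n i : ℝ) ^ 2 := by
  have h1 := h.noiseScale_le i
  have h2 := h.one_le_steps hA hτ₁ hτ i
  have h3 : 0 ≤ A * noiseScale CB μ d n := mul_nonneg (by linarith) noiseScale_nonneg
  have h4 : (n i : ℝ) * min ((m : ℝ) ^ 3) (n i : ℝ) ≤ n i * n i := by
    gcongr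
    exact min_le_right _ _
  nlinarith

lemma clientErr_eq (i : Fin m) : clientErr d n t CB μ τ₁ τ₂ i = t / n i +
    (noiseScale CB μ d n * (2 * Real.log m / rateLog τ₁ τ₂)) / (n i : ℝ) ^ 2 := by
  rw [clientErr, noiseScale]
  congr 1
  simp only [div_eq_mul_inv, mul_inv]
  ring

lemma totalSize_eq : (totalSize n : ℝ) = ∑ i, (n i : ℝ) := by
  rw [totalSize]; push_cast; rfl

lemma isWeight (h : Config τ₁ τ₂ s c A d m n K₁ K₂ CB μ t) (hA : 2 ≤ A) (hs : 0 < s)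
    (hτ₁ : 0 < τ₁) (hτ : τ₁ ≤ τ₂) :
    IsWeight (fun i => (n i : ℝ)) t (noiseScale CB μ d n * (2 * Real.log m / rateLog τ₁ τ₂))
      (∑ i, (clientErr d n t CB μ τ₁ τ₂ i)⁻¹) (totalSize n)
      (serverWeight d n t CB μ τ₁ τ₂) := by
  have hm : (1 : ℝ) ≤ m := by exact_mod_cast h.clients_pos
  exact FedHybrid.isWeight h.clients_pos (fun i => by linarith [(h.le_size hA i).1])
    (hs.trans_le h.le_trace) (mul_nonneg noiseScale_nonneg (div_nonneg (mul_nonneg zero_le_two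
      (Real.log_nonneg hm)) (rateLog_pos hτ₁ hτ).le)) clientErr_eq rfl totalSize_eq
    fun i => rfl

/-- Any client's size can play the role of r in `sqrt_le_sq_mul_sum_inv`. Applied to each client it
controls the server weights; applied to the smallest it makes the server noise exceed a multiple of
r only with probability exponentially small in √N. -/
lemma sqrt_le (h : Config τ₁ τ₂ s c A d m n K₁ K₂ CB μ t) (hA : 2 ≤ A) (hs : 0 < s)
    (hτ₁ : 0 < τ₁) (hτ : τ₁ ≤ τ₂) (hAc : c ≤ A) (hAl : 2 / rateLog τ₁ τ₂ ≤ A) (i : Fin m) :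
    √(totalSize n) / 2 ≤ (n i : ℝ) ^ 2 * ∑ i, (clientErr d n t CB μ τ₁ τ₂ i)⁻¹ := by
  have hm : (1 : ℝ) ≤ m := by exact_mod_cast h.clients_pos
  have hl := rateLog_pos hτ₁ hτ
  have hlm := Real.log_nonneg hm
  have hn : ∀ i, (1 : ℝ) ≤ n i := fun i => by linarith [(h.le_size hA i).1]
  refine sqrt_le_sq_mul_sum_inv (n := fun i => (n i : ℝ)) hn (hn i) h.clients_pos
    (hs.trans_le h.le_trace) ?_ ?_ ?_ clientErr_eq rfl totalSize_eq
  · refine h.trace_le.trans ((mul_le_mul_of_nonneg_right hAc (Nat.cast_nonneg d)).trans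
      (h.le_size hA i).2.1)
  · exact mul_nonneg noiseScale_nonneg (by positivity)
  · have h1 := h.noiseScale_le_sq hA hτ₁ hτ i
    have h2 : 0 ≤ noiseScale CB μ d n := noiseScale_nonneg
    calc noiseScale CB μ d n * (2 * Real.log m / rateLog τ₁ τ₂)
        = (2 / rateLog τ₁ τ₂) * noiseScale CB μ d n * Real.log m := by ring
      _ ≤ A * noiseScale CB μ d n * Real.log m := by gcongr
      _ ≤ (n i : ℝ) ^ 2 * Real.log m := by gcongr

/-- The noise of the local iterations. -/
lemma local_noise_sq (K k : ℕ) (η : ℝ) :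
    (2 * (CB * √(dimLog d n)) * η * √(2 * (K : ℝ)) / (μ * (k : ℝ))) ^ 2 * d =
      8 * η ^ 2 * (noiseScale CB μ d n * K) / (k : ℝ) ^ 2 := by
  rw [div_pow, mul_pow, mul_pow, mul_pow, mul_pow, Real.sq_sqrt dimLog_nonneg,
    Real.sq_sqrt (by positivity), noiseScale]
  simp only [div_eq_mul_inv, mul_inv, mul_pow]
  ring

/-- The two entries of the minimum in the noise condition serve different ends. The entry nᵢ keeps
the local noise small against the common radius, taken as the size of client `j`; the entry m³
bounds its variance by what the server contraction can remove. -/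
lemma local_noise_le (h : Config τ₁ τ₂ s c A d m n K₁ K₂ CB μ t) (hA : 2 ≤ A)
    (hτ₁ : 0 < τ₁) (hτ : τ₁ ≤ τ₂) {η : ℝ} (hη : 0 ≤ η) (hη₂ : η * τ₂ ≤ 1)
    (hAτ : 8 / τ₂ ^ 2 ≤ A) {a : ℝ} (i j : Fin m)
    (ha : a = 2 * (CB * √(dimLog d n)) * η * √(2 * (K₁ i : ℝ)) / (μ * (n i : ℝ))) :
    a ^ 2 * d ≤ (n j : ℝ) ^ 2 / (A * n i) ∧ a ^ 2 * d ≤ 8 * η ^ 2 * (m ^ 3 / (A * n i)) := by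
  have hτ₂ : 0 < τ₂ := by linarith
  have hA0 : 0 < A := by linarith
  have hn0 : (0 : ℝ) < n i := by linarith [(h.le_size hA i).1]
  have hG : 0 ≤ noiseScale CB μ d n := noiseScale_nonneg
  rw [ha, local_noise_sq]
  constructor
  · have h1 := (h.le_size hA i).2.2
    have h2 := h.noiseScale_le_sq hA hτ₁ hτ j
    have h3 : 8 * η ^ 2 ≤ A := by
      refine le_trans ?_ hAτ
      rw [le_div_iff₀ (by positivity)]
      have : (η * τ₂) ^ 2 ≤ 1 := pow_le_one₀ (by positivity) hη₂
      nlinarith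
    rw [div_le_div_iff₀ (by positivity) (by positivity)]
    calc 8 * η ^ 2 * (noiseScale CB μ d n * K₁ i) * (A * n i)
        ≤ A * (noiseScale CB μ d n * K₁ i) * (A * n i) := by gcongr
      _ = (A * noiseScale CB μ d n) * (A * K₁ i) * n i := by ring
      _ ≤ (n j : ℝ) ^ 2 * n i * n i := by gcongr
      _ = (n j : ℝ) ^ 2 * (n i : ℝ) ^ 2 := by ring
  · have h1 := h.noiseScale_le i
    have h4 : (n i : ℝ) * min ((m : ℝ) ^ 3) (n i : ℝ) ≤ n i * m ^ 3 := by
      gcongr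
      exact min_le_left _ _
    rw [mul_div_assoc]
    refine mul_le_mul_of_nonneg_left ?_ (by positivity)
    rw [div_le_div_iff₀ (by positivity) (by positivity)]
    have h5 := mul_le_mul_of_nonneg_right (h1.trans h4) hn0.le
    linarith

/-- The variance of the aggregated server noise. -/
lemma server_noise_le (h : Config τ₁ τ₂ s c A d m n K₁ K₂ CB μ t)
    (hτ₁ : 0 < τ₁) (hτ : τ₁ ≤ τ₂) (w : Fin m → ℝ) :
    d * ∑ i, (w i * (2 * (CB * √(dimLog d n)) * √(2 * (K₂ : ℝ)) / (μ * (n i : ℝ)))) ^ 2 ≤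
      104 / 10 * (noiseScale CB μ d n * (2 * Real.log m / rateLog τ₁ τ₂) *
        ∑ i, w i ^ 2 / (n i : ℝ) ^ 2) := by
  have e : d * ∑ i, (w i * (2 * (CB * √(dimLog d n)) * √(2 * (K₂ : ℝ)) /
      (μ * (n i : ℝ)))) ^ 2 = 8 * K₂ * (noiseScale CB μ d n *
        ∑ i, w i ^ 2 / (n i : ℝ) ^ 2) := by
    rw [Finset.mul_sum, Finset.mul_sum, Finset.mul_sum]
    refine Finset.sum_congr rfl fun i _ => ?_
    have h1 := local_noise_sq (CB := CB) (μ := μ) (d := d) (n := n) K₂ (n i) 1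
    rw [mul_one, one_pow] at h1
    rw [mul_pow, mul_left_comm, mul_comm (d : ℝ), h1]
    ring
  rw [e]
  have h2 := four_mul_ceil_le hτ₁ hτ h.clients_pos h.server_steps
  have h3 : 0 ≤ noiseScale CB μ d n * ∑ i, w i ^ 2 / (n i : ℝ) ^ 2 :=
    mul_nonneg noiseScale_nonneg (Finset.sum_nonneg fun i _ => by positivity)
  have h4 := mul_le_mul_of_nonneg_right h2 h3
  linarith

/-- For the server weights, wᵢ ≤ nᵢ/(tS) and nᵢ²S ≥ √N/2 give wᵢ ≤ nᵢ³/Λ with Λ of order s√N/2; the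
minimum with 1 makes the same Λ work for nᵢ/N. The noise scale b comes from y ≤ V. -/
lemma serverRegime (h : Config τ₁ τ₂ s c A d m n K₁ K₂ CB μ t) (hA : 2 ≤ A) (hs : 0 < s)
    (hτ₁ : 0 < τ₁) (hτ : τ₁ ≤ τ₂) (hAc : c ≤ A) (hAl : 2 / rateLog τ₁ τ₂ ≤ A) :
    ServerRegime n d (serverWeight d n t CB μ τ₁ τ₂) (fun i => (n i : ℝ) / totalSize n)
      (fun i => 2 * (CB * √(dimLog d n)) * √(2 * (K₂ : ℝ)) / (μ * (n i : ℝ)))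
      (min 1 (s / 2) * √(totalSize n))
      √(104 / 10 * (∑ i, (clientErr d n t CB μ τ₁ τ₂ i)⁻¹)⁻¹) := by
  have hw := h.isWeight hA hs hτ₁ hτ
  set S := ∑ i, (clientErr d n t CB μ τ₁ τ₂ i)⁻¹ with hS
  set N : ℝ := (totalSize n : ℝ) with hN
  have hS0 := hw.S_pos
  have hN0 := hw.N_pos
  have hn : ∀ i, (2 : ℝ) ≤ n i := fun i => hA.trans (h.le_size hA i).1
  have hm : (1 : ℝ) ≤ m := by exact_mod_cast h.clients_pos
  have hlm := Real.log_nonneg hm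
  have ht : 0 < t := hs.trans_le h.le_trace
  have hnN : ∀ i, (n i : ℝ) ≤ N := fun i => by
    rw [hN, totalSize_eq]
    exact Finset.single_le_sum (f := fun i => (n i : ℝ)) (fun j _ => Nat.cast_nonneg _)
      (Finset.mem_univ i)
  have hκ : 0 < min 1 (s / 2) := lt_min one_pos (by positivity)
  have hsN : 0 < √N := Real.sqrt_pos.2 hN0
  have hΛ : 0 < min 1 (s / 2) * √N := by positivity
  refine ⟨fun i => by exact_mod_cast hn i, hw.nonneg, hw.sum_eq, fun i => by positivity, ?_, hΛ,
    fun i => (hw.le_div i).trans ?_, fun i => ?_, Real.sqrt_pos.2 (by positivity), ?_⟩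
  · rw [← Finset.sum_div, ← totalSize_eq, div_self hN0.ne']
  · have h1 := h.sqrt_le hA hs hτ₁ hτ hAc hAl i
    rw [← hS] at h1
    rw [div_le_div_iff₀ (by positivity) hΛ]
    have h2 : min 1 (s / 2) * √N ≤ (n i : ℝ) ^ 2 * (t * S) := by
      calc min 1 (s / 2) * √N ≤ s / 2 * √N := by gcongr; exact min_le_right _ _
        _ = s * (√N / 2) := by ring
        _ ≤ t * ((n i : ℝ) ^ 2 * S) := by
            gcongr
            exact h.le_trace
        _ = _ := by ring
    have h3 := mul_le_mul_of_nonneg_left h2 (show (0 : ℝ) ≤ n i by linarith [hn i])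
    calc (n i : ℝ) * (min 1 (s / 2) * √N) ≤ _ := h3
      _ = _ := by ring
  · rw [div_le_div_iff₀ hN0 hΛ]
    have h4 : √N ≤ N := by
      refine Real.sqrt_le_iff.2 ⟨hN0.le, ?_⟩
      have : (2 : ℝ) ≤ N := (hn i).trans (hnN i)
      nlinarith
    have h5 : min 1 (s / 2) * √N ≤ N := by
      calc min 1 (s / 2) * √N ≤ 1 * √N := by gcongr; exact min_le_left _ _
        _ ≤ N := by rwa [one_mul]
    have h6 : (n i : ℝ) ≤ (n i : ℝ) ^ 3 := le_self_pow₀ (by linarith [hn i]) (by norm_num)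
    gcongr
  · rw [Real.sq_sqrt (by positivity)]
    refine (h.server_noise_le hτ₁ hτ _).trans ?_
    refine mul_le_mul_of_nonneg_left ?_ (by norm_num)
    rw [← hw.sum_sq]
    refine le_add_of_nonneg_left (mul_nonneg ht.le (Finset.sum_nonneg fun i _ => ?_))
    positivity

end Config

/-! ### Summation of the error terms -/

section Summation

/-- The mean square error of one client, in units of `1 / √n`. -/
lemma client_error_le {A n d R θ m t τ η a Q : ℝ} (hA : 1 ≤ A) (hAn : A ≤ n) (hd : 1 ≤ d)
    (hdn : d ≤ n) (hθ : θ ≤ R * √d) (hR : 0 ≤ R) (hm : 1 ≤ m) (hτ : 0 < τ) (hη : 0 < η)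
    (had : a ^ 2 * d ≤ 8 * η ^ 2 * (m ^ 3 / (A * n))) (hQ0 : 0 ≤ Q)
    (hQ : Q ≤ (n ^ 4)⁻¹) :
    Q * θ + (√(t / n) + a * √d / η) / τ + (n ^ 4)⁻¹ ≤
      (√t / τ + (√8 / (√A * τ) + (R + 1) / A) * √(m ^ 3)) / √n := by
  have hn : 0 < n := by linarith
  have hsn : 0 < √n := Real.sqrt_pos.2 hn
  have hA0 : 0 < A := by linarith
  have h1 : a * √d / η ≤ √8 * √(m ^ 3) / (√A * √n) := by
    have e : √8 * √(m ^ 3) / (√A * √n) = √(8 * (m ^ 3 / (A * n))) := by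
      rw [← Real.sqrt_mul (by norm_num), ← Real.sqrt_mul hA0.le, ← Real.sqrt_div (by positivity),
        mul_div_assoc]
    rw [e]
    refine Real.le_sqrt_of_sq_le ?_
    rw [div_pow, mul_pow, Real.sq_sqrt (by linarith), div_le_iff₀ (by positivity)]
    linarith
  have hsd : 1 ≤ √d := Real.one_le_sqrt.2 hd
  have hm3 : 1 ≤ √(m ^ 3) := Real.one_le_sqrt.2 (one_le_pow₀ hm)
  have h2 : Q * θ + (n ^ 4)⁻¹ ≤ (R + 1) / A * √(m ^ 3) / √n := by
    have h3 : Q * θ + (n ^ 4)⁻¹ ≤ (n ^ 4)⁻¹ * ((R + 1) * √n) := by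
      have h4 : Q * θ ≤ Q * (R * √d) := by gcongr
      have h5 : Q * (R * √d) ≤ (n ^ 4)⁻¹ * (R * √d) := by gcongr
      have h6 : (n ^ 4)⁻¹ * (R * √d + 1) ≤ (n ^ 4)⁻¹ * ((R + 1) * √n) := by
        have h7 : √d ≤ √n := Real.sqrt_le_sqrt hdn
        gcongr
        nlinarith
      linarith
    have h8 : (n ^ 4)⁻¹ * ((R + 1) * √n) = (R + 1) / n ^ 3 / √n := by
      have : √n * √n = n := Real.mul_self_sqrt hn.le
      field_simp
      rw [pow_two, this]
    have h9 : (R + 1) / n ^ 3 ≤ (R + 1) / A := by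
      gcongr
      exact hAn.trans (le_self_pow₀ (by linarith) (by norm_num))
    have h10 : (R + 1) / A ≤ (R + 1) / A * √(m ^ 3) := le_mul_of_one_le_right (by positivity) hm3
    refine h3.trans ?_
    rw [h8]
    gcongr
    linarith
  have h11 : √(t / n) = √t / √n := Real.sqrt_div' t hn.le
  rw [h11]
  have h12 : a * √d / η / τ ≤ √8 * √(m ^ 3) / (√A * √n) / τ := by gcongr
  have e : (√t / τ + (√8 / (√A * τ) + (R + 1) / A) * √(m ^ 3)) / √n =
      √t / √n / τ + √8 * √(m ^ 3) / (√A * √n) / τ + (R + 1) / A * √(m ^ 3) / √n := by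
    have : 0 < √A := Real.sqrt_pos.2 hA0
    field_simp
    ring
  rw [e, add_div]
  linarith

/-- Averaging errors of order `1 / √n i` with weights proportional to `n i`. -/
lemma sum_client_error_le {m : ℕ} {n y : Fin m → ℝ} {N Y : ℝ} (hn : ∀ i, 0 < n i)
    (hN : ∑ i, n i = N) (hN0 : 0 < N) (hY : 0 ≤ Y) (hy : ∀ i, y i ≤ Y / √(n i)) :
    ∑ i, n i / N * y i ≤ Y * √m / √N := by
  -- Cauchy–Schwarz; this is the factor √m lost by averaging the errors through the triangle
  -- inequality.
  have h1 : ∑ i, √(n i) ≤ √m * √N := by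
    rw [← Real.sqrt_mul (Nat.cast_nonneg m)]
    refine Real.le_sqrt_of_sq_le ?_
    have h2 := sq_sum_le_card_mul_sum_sq (s := (Finset.univ : Finset (Fin m)))
      (f := fun i => √(n i))
    simp only [Real.sq_sqrt (hn _).le, hN, Finset.card_univ, Fintype.card_fin] at h2
    exact h2
  calc ∑ i, n i / N * y i ≤ ∑ i, Y / N * √(n i) := by
        refine Finset.sum_le_sum fun i _ => ?_
        have h3 : 0 < √(n i) := Real.sqrt_pos.2 (hn i)
        have h4 : √(n i) * √(n i) = n i := Real.mul_self_sqrt (hn i).le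
        calc n i / N * y i ≤ n i / N * (Y / √(n i)) := by
              have := (hn i).le
              gcongr
              exact hy i
          _ = Y / N * √(n i) := by
              nth_rewrite 1 [← h4]
              field_simp
    _ = Y / N * ∑ i, √(n i) := by rw [← Finset.mul_sum]
    _ ≤ Y / N * (√m * √N) := by gcongr
    _ = Y * √m / √N := by
        have h5 : √N * √N = N := Real.mul_self_sqrt hN0.le
        have h6 : 0 < √N := Real.sqrt_pos.2 hN0
        nth_rewrite 1 [← h5]
        field_simp

/-- The initial error of the server after the contraction. -/
lemma init_error_le {m t N τ ε : ℝ} (hm : 1 ≤ m) (hN : 0 < N) (hτ : 0 < τ) :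
    (m ^ 2)⁻¹ * ((√t / τ + ε * √(m ^ 3)) * √m / √N) ≤ √(t / N) / τ + ε * √(1 / N) := by
  have hm0 : 0 ≤ m := by linarith
  -- The privacy part of the initial error is cancelled exactly by the m⁻² of the server
  -- contraction; the statistical part even keeps a factor √m/m² ≤ 1.
  have h1 : √(m ^ 3) * √m = m ^ 2 := by
    rw [← Real.sqrt_mul (by positivity), show m ^ 3 * m = (m ^ 2) ^ 2 by ring,
      Real.sqrt_sq (by positivity)]
  have h2 : √m ≤ m ^ 2 := by
    refine Real.sqrt_le_iff.2 ⟨by positivity, ?_⟩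
    rw [← pow_mul]
    exact le_self_pow₀ hm (by norm_num)
  have h3 : 0 < √N := Real.sqrt_pos.2 hN
  have e : (m ^ 2)⁻¹ * ((√t / τ + ε * √(m ^ 3)) * √m / √N) =
      √t / √N / τ * (√m / m ^ 2) + ε * (1 / √N) * ((√(m ^ 3) * √m) / m ^ 2) := by
    field_simp
  rw [e, h1, Real.sqrt_div' t hN.le, Real.sqrt_div' 1 hN.le, Real.sqrt_one,
    div_self (by positivity), mul_one]
  gcongr
  refine mul_le_of_le_one_right (by positivity) (div_le_one_of_le₀ h2 (by positivity))

/-- The sum of all error terms. -/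
lemma total_error_le {x y V s u ε₁ ε₂ τ₁ z : ℝ} (hx : 0 ≤ x) (hy : 0 ≤ y) (hxy : x + y = V)
    (hs : 0 < s) (hτ₁ : 0 < τ₁) (hz : z ≤ x) (hu : u ≤ V / s) (hε₁ : 0 ≤ ε₁) (hε₂ : 0 ≤ ε₂)
    (hε₁' : ε₁ ≤ √s / (20 * τ₁)) (hε₂' : ε₂ ≤ √s / (20 * τ₁)) :
    √z / (19 / 20 * τ₁) + ε₁ * √u + (√x + √(104 / 10 * y)) / (19 / 20 * τ₁) + ε₂ * √u ≤
      41 / 10 / τ₁ * √V := by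
  have hV : 0 ≤ V := by linarith
  have hss : 0 < √s := Real.sqrt_pos.2 hs
  have h1 : √z ≤ √x := Real.sqrt_le_sqrt hz
  have h2 : √u ≤ √V / √s := by
    rw [← Real.sqrt_div' V hs.le]
    exact Real.sqrt_le_sqrt hu
  have h3 : 2 * √x + √(104 / 10 * y) ≤ 3795 / 1000 * √V := by
    -- Cauchy–Schwarz with 14.4 = 4 + 10.4. One √x comes from the initial value, the other from the
    -- gradient noise of the second stage.
    have h4 : 2 * √x + √(104 / 10 * y) ≤ √(144 / 10 * V) := by
      refine Real.le_sqrt_of_sq_le ?_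
      set p := √x
      set q := √(104 / 10 * y) with hq
      have hp2 : p ^ 2 = x := Real.sq_sqrt hx
      have hq2 : q ^ 2 = 104 / 10 * y := Real.sq_sqrt (by positivity)
      nlinarith [sq_nonneg (104 / 10 * p - 2 * q)]
    refine h4.trans ?_
    rw [Real.sqrt_mul (by norm_num)]
    gcongr
    rw [Real.sqrt_le_left (by norm_num)]
    norm_num
  have h5 : ∀ ε : ℝ, 0 ≤ ε → ε ≤ √s / (20 * τ₁) → ε * √u ≤ 1 / (20 * τ₁) * √V :=
    fun ε h0 h => by
      calc ε * √u ≤ √s / (20 * τ₁) * (√V / √s) := by gcongr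
        _ = 1 / (20 * τ₁) * √V := by field_simp
  have h6 := h5 ε₁ hε₁ hε₁'
  have h7 := h5 ε₂ hε₂ hε₂'
  have h8 : √z / (19 / 20 * τ₁) + (√x + √(104 / 10 * y)) / (19 / 20 * τ₁) ≤
      3795 / 1000 * √V / (19 / 20 * τ₁) := by
    rw [← add_div]
    gcongr
    linarith
  -- Numerically 3.795/0.95 + 1/20 + 1/20 is below 4.1.
  have h9 : 3795 / 1000 * √V / (19 / 20 * τ₁) + 1 / (20 * τ₁) * √V + 1 / (20 * τ₁) * √V ≤
      41 / 10 / τ₁ * √V := by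
    have e : 3795 / 1000 * √V / (19 / 20 * τ₁) + 1 / (20 * τ₁) * √V + 1 / (20 * τ₁) * √V =
        (3795 / 950 + 1 / 10) * (1 / τ₁ * √V) := by
      field_simp
      ring
    have e2 : 41 / 10 / τ₁ * √V = 41 / 10 * (1 / τ₁ * √V) := by ring
    rw [e, e2]
    gcongr
    norm_num
  linarith

lemma eventually_local_const_le {τ R δ : ℝ} (hτ : 0 < τ) (hδ : 0 < δ) :
    ∀ᶠ A : ℝ in Filter.atTop, √8 / (√A * τ) + (R + 1) / A ≤ δ := by
  have h1 : Filter.Tendsto (fun A : ℝ => √8 / (√A * τ)) Filter.atTop (nhds 0) :=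
    (Real.tendsto_sqrt_atTop.atTop_mul_const hτ).const_div_atTop _
  have h2 : Filter.Tendsto (fun A : ℝ => (R + 1) / A) Filter.atTop (nhds 0) :=
    Filter.tendsto_id.const_div_atTop _
  have h3 := h1.add h2
  rw [add_zero] at h3
  exact h3.eventually (eventually_le_nhds hδ)

end Summation

/-- The exceptional event of a client is encoded in one nonnegative variable with tiny moments, so
the server can take weighted sums over clients instead of a union of events. -/
theorem eventually_exists_client_excess {τ₁ τ₂ W C₁ C₂ R L : ℝ} (hτ₁ : 0 < τ₁) (hτ₂ : 0 < τ₂)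
    (hW : 0 < W) (hC₁ : 0 < C₁) (hR : 0 < R) (hL : 0 ≤ L) {q : ℕ} (hq : q ≠ 0) :
    ∀ᶠ A : ℝ in Filter.atTop, ∀ (d n K : ℕ) (a η r : ℝ) (𝒳 : Type u) [MeasurableSpace 𝒳]
      (P : Measure 𝒳) [IsProbabilityMeasure P] (ρ : 𝒳 → Vec d → ℝ) (Θ : Set (Vec d))
      (θ₀ : Vec d), 1 ≤ d → 0 < a → 1 / (2 * τ₂) ≤ η → η ≤ 9 / (10 * τ₂) →
      A * (d * (1 + Real.log d) + K) ≤ n → A * d ≤ r → r ≤ n → a ^ 2 * d ≤ r ^ 2 / (A * n) →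
      Assumptions P ρ Θ τ₁ τ₂ W C₁ C₂ → IsTarget P ρ Θ θ₀ → ‖θ₀‖ ≤ R * √d →
      ∃ X : (Fin n → 𝒳) × (ℕ → Vec d) → ℝ, Measurable X ∧ (∀ ω, 0 ≤ X ω) ∧
        LpBound (clientLaw P d n) q X ((n : ℝ) ^ 4)⁻¹ ∧
        ∀ ω, ClientGood ρ θ₀ τ₁ η a r K ω.1 ω.2 ∨
          L * (1 + ‖avgGrad ρ ω.1 θ₀‖ + ‖localGD ρ ω.1 η a ω.2 K - θ₀‖) ≤ X ω := by
  filter_upwards [eventually_exists_client_event (C₂ := C₂) hτ₁ hτ₂ hW hC₁ hR hL hq] with A hev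
    d n K a η r 𝒳 _ P _ ρ Θ θ₀ hd ha hη1 hη2 hn hr hrn had hA hT hθ₀
  obtain ⟨B, hBm, hBg, hBX⟩ := hev d n K a η r 𝒳 P ρ Θ θ₀ hd ha hη1 hη2 hn hr hrn had hA hT hθ₀
  refine ⟨_, ?_, fun ω => Set.indicator_nonneg (fun ω _ => by positivity) ω, hBX, fun ω => ?_⟩
  · exact (((measurable_const.add (hA.measurable_avgGrad measurable_fst measurable_const).norm).add
      ((hA.measurable_localGD measurable_fst measurable_snd η a K).sub_const θ₀).norm).const_mul
        L).indicator hBm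
  · by_cases hω : ω ∈ B
    · right
      rw [Set.indicator_of_mem hω]
    · exact Or.inl (hBg ω hω)

/-! ### Negligibility of the exceptional event in the given configuration -/

namespace Config

variable {τ₁ τ₂ s c A : ℝ} {d m : ℕ} {n K₁ : Fin m → ℕ} {K₂ : ℕ} {CB μ t : ℝ}

/-- The smallness of the probability of the exceptional event and of its contribution. -/
lemma eventually_exceptional_le (hτ₁ : 0 < τ₁) (hτ : τ₁ ≤ τ₂) (hs : 0 < s) {M ε : ℝ}
    (hM : 0 ≤ M) (hε : 0 < ε) : ∃ (q : ℕ) (β : ℝ → ℝ), 4 ≤ q ∧ (∀ N, 0 ≤ N → 0 ≤ β N) ∧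
      ∀ᶠ A : ℝ in Filter.atTop,
      ∀ (d m : ℕ) (n K₁ : Fin m → ℕ) (K₂ : ℕ) (CB μ t η r : ℝ),
        Config τ₁ τ₂ s c A d m n K₁ K₂ CB μ t → 0 ≤ η → η * τ₂ ≤ 1 → (∃ i, r = n i) →
        2 * (m * (1 / √(min 1 (s / 2) * √(totalSize n))) ^ q +
            Real.exp (-(√(min 1 (s / 2) * √(totalSize n)) / 2))) +
          K₂ * (tailConst * Real.exp (-((19 / 20 * τ₁ * r / 4) ^ 2 /
            (2 * √(104 / 10 * (∑ i, (clientErr d n t CB μ τ₁ τ₂ i)⁻¹)⁻¹)) ^ 2))) ≤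
              β (totalSize n) ^ 4 ∧
        β (totalSize n) * (2 ^ K₂ * (r / 2 + 1 + K₂ * (η * (19 / 20 * τ₁ * r / 4 / 2 + 1 +
          2 * √(104 / 10 * (∑ i, (clientErr d n t CB μ τ₁ τ₂ i)⁻¹)⁻¹) * M)))) ≤
            ε * √(1 / totalSize n) := by
  have hl := rateLog_pos hτ₁ hτ
  have hτ₂ : 0 < τ₂ := by linarith
  have hT := one_le_tailConst
  obtain ⟨p, hp⟩ := exists_nat_ge (2 * Real.log 2 / rateLog τ₁ τ₂)
  set CK : ℝ := 2 / rateLog τ₁ τ₂ + 1 with hCK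
  have hCK0 : 0 ≤ CK := by positivity
  -- The crude bound grows like N^(p+2), so β = N^(-(p+4)) leaves N⁻². The moment order q is then
  -- what makes the exceptional probability at most β⁴.
  refine ⟨4 * (4 * (p + 4) + 2), fun N => (N ^ (p + 4))⁻¹, by omega, fun N hN => by positivity, ?_⟩
  filter_upwards [eventually_meas_bad_le (κ := min 1 (s / 2)) (c := (19 / 20 * τ₁) ^ 2 / 1332)
      (C := CK) (T := tailConst) (lt_min one_pos (by positivity)) (by positivity) hCK0
      (by linarith) (p + 4),
    eventually_crude_le (C := 2 * (1 + CK * (1 + 1 / τ₂ * (1 + 10 * M)))) hε p,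
    Filter.eventually_ge_atTop 2, Filter.eventually_ge_atTop c,
    Filter.eventually_ge_atTop (2 / rateLog τ₁ τ₂)] with A hbad hcrude hA2 hAc hAl
    d m n K₁ K₂ CB μ t η r h hη hη₂ hr
  obtain ⟨i, rfl⟩ := hr
  have hw := h.isWeight hA2 hs hτ₁ hτ
  have hsq := h.sqrt_le hA2 hs hτ₁ hτ hAc hAl i
  set S := ∑ i, (clientErr d n t CB μ τ₁ τ₂ i)⁻¹ with hS
  set N : ℝ := (totalSize n : ℝ) with hN
  have hS0 := hw.S_pos
  have hn : ∀ i, (2 : ℝ) ≤ n i := fun i => hA2.trans (h.le_size hA2 i).1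
  have hnN : ∀ i, (n i : ℝ) ≤ N := fun i => by
    rw [hN, totalSize_eq]
    exact Finset.single_le_sum (f := fun i => (n i : ℝ)) (fun j _ => Nat.cast_nonneg _)
      (Finset.mem_univ i)
  have hAN : A ≤ N := (h.le_size hA2 i).1.trans (hnN i)
  have hN1 : 1 ≤ N := by linarith
  have hmN : (m : ℝ) ≤ N := by
    rw [hN, totalSize_eq]
    calc (m : ℝ) = ∑ _i : Fin m, (1 : ℝ) := by simp
      _ ≤ _ := Finset.sum_le_sum fun i _ => by linarith [hn i]
  obtain ⟨hK1, hK2⟩ := two_pow_ceil_le hl h.clients_pos h.server_steps hp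
  have hK3 : (K₂ : ℝ) ≤ CK * N := hK1.trans (by gcongr)
  have hb0 : 0 ≤ √(104 / 10 * S⁻¹) := Real.sqrt_nonneg _
  have hb2 : √(104 / 10 * S⁻¹) ^ 2 = 104 / 10 * S⁻¹ := Real.sq_sqrt (by positivity)
  have hn0 : (0 : ℝ) < n i := by linarith [hn i]
  constructor
  · refine hbad N m K₂ _ hAN hmN hK3 ?_
    -- The constant 665.6 is 16 · 4 · 10.4; with n²S ≥ √N/2 it becomes 1331.2, below the 1332 used
    -- for the decay rate.
    have e : (19 / 20 * τ₁ * n i / 4) ^ 2 / (2 * √(104 / 10 * S⁻¹)) ^ 2 =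
        (19 / 20 * τ₁) ^ 2 / (6656 / 10) * ((n i : ℝ) ^ 2 * S) := by
      rw [mul_pow 2, hb2]
      field_simp
      norm_num
    rw [e]
    calc (19 / 20 * τ₁) ^ 2 / 1332 * √N ≤ (19 / 20 * τ₁) ^ 2 / (6656 / 10) * (√N / 2) := by
          have : 0 ≤ (19 / 20 * τ₁) ^ 2 * √N := by positivity
          linarith
      _ ≤ _ := by gcongr
  · refine hcrude N _ hAN (crude_le_pow hN1 (hn i) (hnN i) (by positivity) hτ₂ (by linarith) hη
      hη₂ ?_ hM ?_ (by positivity) (by positivity) hK3)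
    -- Here S⁻¹ ≤ 2r², and 10.4 · 2 is below 5².
    · refine Real.sqrt_le_iff.2 ⟨by positivity, ?_⟩
      have h1 : 1 ≤ √N := Real.one_le_sqrt.2 hN1
      have h2 : S⁻¹ ≤ 2 * (n i : ℝ) ^ 2 := by
        rw [inv_le_iff_one_le_mul₀ hS0]
        linarith
      nlinarith
    · refine hK2.trans ?_
      gcongr

end Config

/-! ### Assembly of the error bound -/

/-- The mean square error of the initial value of the server, after the contraction. -/
lemma Config.init_terms_le {τ₁ τ₂ s c A : ℝ} {d m : ℕ} {n K₁ : Fin m → ℕ} {K₂ : ℕ} {CB μ t : ℝ}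
    (h : Config τ₁ τ₂ s c A d m n K₁ K₂ CB μ t) (hA : 2 ≤ A) (hτ₁ : 0 < τ₁) (hτ : τ₁ ≤ τ₂)
    {η₁ η₂ R θ : ℝ} (hη₁ : 1 / (2 * τ₂) ≤ η₁) (hη₁' : η₁ * τ₂ ≤ 1) (hη₂ : 1 / (2 * τ₂) ≤ η₂)
    (hη₂' : η₂ * τ₂ ≤ 1) (hAτ : 8 / τ₂ ^ 2 ≤ A) (hR : 0 ≤ R) (hθ : θ ≤ R * √d) {a : Fin m → ℝ}
    (ha : ∀ i, a i = 2 * (CB * √(dimLog d n)) * η₁ * √(2 * (K₁ i : ℝ)) / (μ * (n i : ℝ))) :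
    (1 - η₂ * (19 / 20 * τ₁)) ^ K₂ * ∑ i, (n i : ℝ) / totalSize n *
        ((1 - η₁ * (19 / 20 * τ₁)) ^ K₁ i * θ +
          (√(t / n i) + a i * √d / η₁) / (19 / 20 * τ₁) + ((n i : ℝ) ^ 4)⁻¹) ≤
      √(t / totalSize n) / (19 / 20 * τ₁) +
        (√8 / (√A * (19 / 20 * τ₁)) + (R + 1) / A) * √(1 / totalSize n) := by
  have hτ₂ : 0 < τ₂ := by linarith
  have hη₁0 : 0 < η₁ := lt_of_lt_of_le (by positivity) hη₁
  have hm : (1 : ℝ) ≤ m := by exact_mod_cast h.clients_pos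
  have hd : (1 : ℝ) ≤ d := by exact_mod_cast h.one_le_dim
  have hn : ∀ i, (2 : ℝ) ≤ n i := fun i => hA.trans (h.le_size hA i).1
  have hn0 : ∀ i, (0 : ℝ) < n i := fun i => by linarith [hn i]
  have hN0 : (0 : ℝ) < totalSize n := by
    rw [Config.totalSize_eq]
    exact Finset.sum_pos (fun i _ => hn0 i) ⟨⟨0, h.clients_pos⟩, Finset.mem_univ _⟩
  have hA0 : 0 < A := by linarith
  have hY : 0 ≤ √t / (19 / 20 * τ₁) + (√8 / (√A * (19 / 20 * τ₁)) + (R + 1) / A) *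
      √((m : ℝ) ^ 3) := by positivity
  have h1 := sum_client_error_le (n := fun i => (n i : ℝ)) hn0 Config.totalSize_eq.symm hN0 hY
    fun i => by
      obtain ⟨hQ0, hQ⟩ := one_sub_pow_le_inv_pow hτ₁ hτ hη₁ hη₁' (hn0 i) (c := 4) (K := K₁ i)
        (by exact_mod_cast h.local_steps i)
      have h2 := (h.local_noise_le hA hτ₁ hτ hη₁0.le hη₁' hAτ i i (ha i)).2
      have h3 : (d : ℝ) ≤ n i := by nlinarith [(h.le_size hA i).2.1]
      exact client_error_le (t := t) (by linarith) (h.le_size hA i).1 hd h3 hθ hR hm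
        (by positivity) hη₁0 h2 (pow_nonneg hQ0 _) hQ
  obtain ⟨hq0, hq⟩ := one_sub_pow_le_inv_pow hτ₁ hτ hη₂ hη₂' (x := (m : ℝ)) (by linarith) (c := 2)
    (K := K₂) (by
      rw [h.server_steps]
      exact_mod_cast Nat.le_ceil _)
  calc _ ≤ (1 - η₂ * (19 / 20 * τ₁)) ^ K₂ * _ := mul_le_mul_of_nonneg_left h1 (pow_nonneg hq0 _)
    _ ≤ ((m : ℝ) ^ 2)⁻¹ * _ := mul_le_mul_of_nonneg_right hq (by positivity)
    _ ≤ _ := init_error_le hm hN0 (by positivity)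

/-- The theorem in L² form, for fixed τ₁ ≤ τ₂ and all large A. The parameter c bounds the trace by
c·d, so that n ≥ Ad dominates the trace for every client. -/
theorem eventually_lpBound_fedHybrid {τ₁ τ₂ W C₁ C₂ R s c : ℝ} (hτ₁ : 0 < τ₁) (hτ : τ₁ ≤ τ₂)
    (hW : 0 < W) (hC₁ : 0 < C₁) (hR : 0 < R) (hs : 0 < s) :
    ∀ᶠ A : ℝ in Filter.atTop, ∀ (d m : ℕ) (n K₁ : Fin m → ℕ) (K₂ : ℕ) (CB μ η₁ η₂ t : ℝ)
      (𝒳 : Type u) [MeasurableSpace 𝒳] (P : Measure 𝒳) [IsProbabilityMeasure P]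
      (ρ : 𝒳 → Vec d → ℝ) (Θ : Set (Vec d)) (θ₀ : Vec d),
      Config τ₁ τ₂ s c A d m n K₁ K₂ CB μ t → Assumptions P ρ Θ τ₁ τ₂ W C₁ C₂ →
      IsTarget P ρ Θ θ₀ → ‖θ₀‖ ≤ R * √d → t = (gradCov P ρ θ₀).trace →
      η₁ ∈ Set.Icc (1 / (2 * τ₂)) (9 / (10 * τ₂)) → η₂ ∈ Set.Icc (1 / (2 * τ₂)) (9 / (10 * τ₂)) →
      0 ≤ (∑ i, (clientErr d n t CB μ τ₁ τ₂ i)⁻¹)⁻¹ ∧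
      LpBound (sampleLaw P d n) 2 (fun ω => ‖fedHybrid ρ η₁ η₂ μ (CB * √(dimLog d n)) K₁ K₂
        (serverWeight d n t CB μ τ₁ τ₂) ω.1 ω.2.1 ω.2.2 - θ₀‖)
        (41 / 10 / τ₁ * √(∑ i, (clientErr d n t CB μ τ₁ τ₂ i)⁻¹)⁻¹) := by
  have hτ₂ : 0 < τ₂ := by linarith
  have hM := one_le_momentConst 2
  have hε : 0 < √s / (20 * τ₁) := by positivity
  obtain ⟨q, β, hq, hβ, hexc⟩ := Config.eventually_exceptional_le (c := c) hτ₁ hτ hs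
    (M := momentConst 2) (by linarith) hε
  filter_upwards [hexc, eventually_exists_client_excess (C₂ := C₂) (L := 100 * τ₂ / τ₁) hτ₁ hτ₂ hW
      hC₁ hR (by positivity) (show q ≠ 0 by omega),
    eventually_local_const_le (R := R) (τ := 19 / 20 * τ₁) (by positivity) hε,
    Filter.eventually_ge_atTop 2, Filter.eventually_ge_atTop c,
    Filter.eventually_ge_atTop (2 / rateLog τ₁ τ₂), Filter.eventually_ge_atTop (8 / τ₂ ^ 2),
    Filter.eventually_ge_atTop (8 / (19 / 20 * τ₁))] with A hexc hcl hloc hA2 hAc hAl hAτ hA8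
    d m n K₁ K₂ CB μ η₁ η₂ t 𝒳 _ P _ ρ Θ θ₀ h hA hT hθ₀ ht hη₁ hη₂
  have hlt : ∀ η : ℝ, η ≤ 9 / (10 * τ₂) → η * τ₂ ≤ 1 := fun η hη => by
    calc η * τ₂ ≤ 9 / (10 * τ₂) * τ₂ := by gcongr
      _ = 9 / 10 := by field_simp
      _ ≤ 1 := by norm_num
  have hη₁' := hlt η₁ hη₁.2
  have hη₂' := hlt η₂ hη₂.2
  have hη₁0 : 0 < η₁ := lt_of_lt_of_le (by positivity) hη₁.1
  have hη₂0 : 0 < η₂ := lt_of_lt_of_le (by positivity) hη₂.1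
  have : Nonempty (Fin m) := ⟨⟨0, h.clients_pos⟩⟩
  -- The smallest sample size is the common radius: it exceeds A·d, hence contains the start, and
  -- does not exceed any nᵢ, as the entropy bound for each client requires.
  obtain ⟨i₀, hi₀⟩ := Finite.exists_min n
  have hL1 : 1 ≤ 100 * τ₂ / τ₁ := by
    rw [le_div_iff₀ hτ₁]
    linarith
  have hn0 : ∀ i, (0 : ℝ) < n i := fun i => by linarith [(h.le_size hA2 i).1]
  have hd : 0 < d := h.one_le_dim
  have hd' : (0 : ℝ) < d := by exact_mod_cast hd
  have hD : 0 < dimLog d n := lt_max_of_lt_left hd'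
  have hCB := h.CB_pos
  have hμ := h.μ_pos
  set a : Fin m → ℝ := fun i =>
    2 * (CB * √(dimLog d n)) * η₁ * √(2 * (K₁ i : ℝ)) / (μ * (n i : ℝ)) with ha
  have ha0 : ∀ i, 0 < a i := fun i => by
    have h1 : (0 : ℝ) < K₁ i := lt_of_lt_of_le one_pos (h.one_le_steps hA2 hτ₁ hτ i)
    have h2 := hn0 i
    rw [ha]
    positivity
  have hX := fun i => hcl d (n i) (K₁ i) (a i) η₁ (n i₀) 𝒳 P ρ Θ θ₀ hd (ha0 i) hη₁.1 hη₁.2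
    (h.size_le i) (h.le_size hA2 i₀).2.1 (by exact_mod_cast hi₀ i)
    (h.local_noise_le hA2 hτ₁ hτ hη₁0.le hη₁' hAτ i i₀ rfl).1 hA hT hθ₀
  choose X hXm hX0 hXb hXcl using hX
  have hY := fun i => hA.lpBound_localGD hT hC₁ hd (by exact_mod_cast hn0 i) hτ₁ hτ hη₁0 hη₁'
    (ha0 i).le hL1 (hX0 i) ((hXb i).exponent_le (by exact_mod_cast (show 2 ≤ q by omega)))
    (hXcl i) (Real.sqrt_nonneg (t / n i)) (by
      rw [Real.sq_sqrt (div_nonneg (hs.le.trans h.le_trace) (hn0 i).le), ht])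
  have hw := h.isWeight hA2 hs hτ₁ hτ
  obtain ⟨hex1, hex2⟩ := hexc d m n K₁ K₂ CB μ t η₂ (n i₀) h hη₂0.le hη₂' ⟨i₀, rfl⟩
  have ht0 : 0 ≤ t := hs.le.trans h.le_trace
  have hm : (1 : ℝ) ≤ m := by exact_mod_cast h.clients_pos
  have hx0 : 0 ≤ t * ∑ i, serverWeight d n t CB μ τ₁ τ₂ i ^ 2 / (n i : ℝ) :=
    mul_nonneg ht0 (Finset.sum_nonneg fun i _ => by positivity)
  have hy0 : 0 ≤ Config.noiseScale CB μ d n * (2 * Real.log m / rateLog τ₁ τ₂) *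
      ∑ i, serverWeight d n t CB μ τ₁ τ₂ i ^ 2 / (n i : ℝ) ^ 2 :=
    mul_nonneg (mul_nonneg Config.noiseScale_nonneg (div_nonneg (mul_nonneg zero_le_two
      (Real.log_nonneg hm)) (rateLog_pos hτ₁ hτ).le)) (Finset.sum_nonneg fun i _ => by positivity)
  have hξ := (h.server_noise_le hτ₁ hτ (serverWeight d n t CB μ τ₁ τ₂)).trans
    (Real.sq_sqrt (mul_nonneg (by norm_num : (0 : ℝ) ≤ 104 / 10) hy0)).ge
  have hmain := hA.lpBound_hybrid (K := K₂) hT hC₁ hd hτ₁ hτ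
    (h.serverRegime hA2 hs hτ₁ hτ hAc hAl) hη₂0 hη₂' le_rfl
    (hA2.trans (h.le_size hA2 i₀).1) (by
      rw [← div_le_iff₀' (by positivity)]
      exact hA8.trans (h.le_size hA2 i₀).1) hXm hX0 hXb hq hXcl hY
    (Real.sqrt_nonneg _) (by rw [← ht, Real.sq_sqrt hx0]) (Real.sqrt_nonneg _) hξ
    (hβ _ (Nat.cast_nonneg _)) hex1
  refine ⟨(inv_pos.2 hw.S_pos).le, hmain.weaken ?_⟩
  have hinit := h.init_terms_le hA2 hτ₁ hτ hη₁.1 hη₁' hη₂.1 hη₂' hAτ hR.le hθ₀ (a := a)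
    fun i => rfl
  have hε₁ : 0 ≤ √8 / (√A * (19 / 20 * τ₁)) + (R + 1) / A := by positivity
  -- Both remainders, the local constant and the exceptional event, were made at most √s/(20τ₁) in
  -- units of 1/√N.
  have htot := total_error_le hx0 hy0 hw.sum_sq hs hτ₁ hw.div_le
    (hw.one_div_le hs h.le_trace) hε₁ hε.le hloc le_rfl
  linarith

lemma one_le_dim_of_trace_pos {d : ℕ} {M : Matrix (Fin d) (Fin d) ℝ} (h : 0 < M.trace) :
    1 ≤ d := by
  rcases Nat.eq_zero_or_pos d with rfl | hd
  · simp [Matrix.trace] at h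
  · exact hd

end FedHybrid

theorem theorem3p4 (τ₁ τ₂ W C₁ C₂ R s : ℝ) (hτ₁ : 0 < τ₁) (hτ₂ : 0 < τ₂) (hW : 0 < W)
    (hC₁ : 0 < C₁) (hC₂ : 0 < C₂) (hR : 0 < R) (hs : 0 < s) :
    ∃ A : ℝ, 0 < A ∧
      ∀ (d m : ℕ) (n K₁ : Fin m → ℕ) (K₂ : ℕ) (CB μ η₁ η₂ : ℝ)
        (𝒳 : Type u) [MeasurableSpace 𝒳] (P : Measure 𝒳) [IsProbabilityMeasure P]
        (ρ : 𝒳 → FedHybrid.Vec d → ℝ) (Θ : Set (FedHybrid.Vec d)) (θ₀ : FedHybrid.Vec d)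
        (trS : ℝ),
        0 < m → 0 < CB → 0 < μ →
        FedHybrid.Assumptions P ρ Θ τ₁ τ₂ W C₁ C₂ →
        FedHybrid.IsTarget P ρ Θ θ₀ →
        (∀ θ ∈ Θ, ‖θ‖ ≤ R * √(d : ℝ)) →
        trS = (FedHybrid.gradCov P ρ θ₀).trace →
        s ≤ trS →
        η₁ ∈ Set.Icc (1 / (2 * τ₂)) (9 / (10 * τ₂)) →
        η₂ ∈ Set.Icc (1 / (2 * τ₂)) (9 / (10 * τ₂)) →
        (∀ i, 4 * Real.log (n i : ℝ) / FedHybrid.rateLog τ₁ τ₂ ≤ (K₁ i : ℝ)) →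
        K₂ = ⌈2 * Real.log (m : ℝ) / FedHybrid.rateLog τ₁ τ₂⌉₊ →
        (∀ i, A * ((d : ℝ) * (1 + Real.log (d : ℝ)) + (K₁ i : ℝ)) ≤ (n i : ℝ)) →
        (∀ i, A * (CB ^ 2 * (d : ℝ) * FedHybrid.dimLog d n * (K₁ i : ℝ)) ≤
          μ ^ 2 * (n i : ℝ) * min ((m : ℝ) ^ 3) (n i : ℝ)) →
        Integrable
          (fun ω : FedHybrid.Sample 𝒳 d n =>
            ‖FedHybrid.fedHybrid ρ η₁ η₂ μ (CB * √(FedHybrid.dimLog d n)) K₁ K₂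
              (FedHybrid.serverWeight d n trS CB μ τ₁ τ₂) ω.1 ω.2.1 ω.2.2 - θ₀‖ ^ 2)
          (FedHybrid.sampleLaw P d n) ∧
        ∫ ω : FedHybrid.Sample 𝒳 d n,
            ‖FedHybrid.fedHybrid ρ η₁ η₂ μ (CB * √(FedHybrid.dimLog d n)) K₁ K₂
              (FedHybrid.serverWeight d n trS CB μ τ₁ τ₂) ω.1 ω.2.1 ω.2.2 - θ₀‖ ^ 2
            ∂(FedHybrid.sampleLaw P d n) ≤
          17 / τ₁ ^ 2 * (∑ i, (FedHybrid.clientErr d n trS CB μ τ₁ τ₂ i)⁻¹)⁻¹ := by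
  by_cases hτ : τ₁ ≤ τ₂
  · obtain ⟨A, hev, hA0⟩ := ((FedHybrid.eventually_lpBound_fedHybrid (C₂ := C₂)
      (c := 2 * C₁ ^ 2 * FedHybrid.momentConst 1 ^ 2) hτ₁ hτ hW hC₁ hR hs).and
      (Filter.eventually_gt_atTop 0)).exists
    refine ⟨A, hA0, fun d m n K₁ K₂ CB μ η₁ η₂ 𝒳 _ P _ ρ Θ θ₀ trS hm hCB hμ hA hT hΘ htr hst hη₁ hη₂
      hK₁ hK₂ hsize hnoise => ?_⟩
    have hd : 1 ≤ d := FedHybrid.one_le_dim_of_trace_pos (htr ▸ hs.trans_le hst)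
    obtain ⟨hS, h⟩ := hev d m n K₁ K₂ CB μ η₁ η₂ trS 𝒳 P ρ Θ θ₀
      ⟨hd, hm, hCB, hμ, hst, htr ▸ hA.trace_gradCov_le hT hC₁ hd, hK₁, hK₂, hsize, hnoise⟩ hA hT
      (hΘ θ₀ (interior_subset hT.mem_interior)) htr hη₁ hη₂
    obtain ⟨h1, h2⟩ := h.integrable_sq_and_integral_le
    refine ⟨h1, h2.trans ?_⟩
    -- The constant is (41/10)² = 16.81 ≤ 17.
    rw [mul_pow, Real.sq_sqrt hS, div_pow]
    gcongr
    norm_num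
  -- If τ₁ > τ₂ no law satisfies the assumptions in positive dimension, and a positive trace forces
  -- positive dimension; any A will do.
  · refine ⟨1, one_pos, fun d m n K₁ K₂ CB μ η₁ η₂ 𝒳 _ P _ ρ Θ θ₀ trS hm hCB hμ hA hT hΘ htr hst
      hη₁ hη₂ hK₁ hK₂ hsize hnoise => ?_⟩
    exact absurd (hA.tau_le hτ₁ (FedHybrid.one_le_dim_of_trace_pos (htr ▸ hs.trans_le hst))) hτ
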